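/- Let $d\ge 1$ and $N\ge 1$ be integers, and let $\gamma>0$, with $\gamma>1/2$ if $d=1$. For $0\le V\in L^{\gamma+d/2}(\mathbb{R}^d)$ and $j\ge 1$ let $$\lambda_j(-\Delta-V)=\inf_{\substack{W\subset H^1(\mathbb{R}^d)\\ \dim W=j}}\ \sup_{\substack{u\in W\\ \|u\|_{L^2}=1}}\left(\int_{\mathbb{R}^d}|\nabla u|^2\,dx-\int_{\mathbb{R}^d}V|u|^2\,dx\right)$$ be the $j$-th min-max level of the Schrödinger operator $-\Delta-V$ on $L^2(\mathbb{R}^d)$ (it equals the $j$-th negative eigenvalue counted with multiplicity if it exists, and $0$ otherwise). Define the finite-rank Lieb--Thirring constant $$L^{(N)}_{\gamma,d}=\sup_{\substack{0\le V\in L^{\gamma+d/2}(\mathbb{R}^d)\\ V\ne 0}}\frac{\sum_{j=1}^N|\lambda_j(-\Delta-V)|^\gamma}{\int_{\mathbb{R}^d}V(x)^{\gamma+d/2}\,dx}.$$ Then $L^{(N)}_{\gamma,d}<\infty$ and $L^{(N)}_{\gamma,d}$ admits an optimizer: there exists $0\le V\in L^{\gamma+d/2}(\mathbb{R}^d)$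 with $V\neq 0$ such that $$\frac{\sum_{j=1}^N|\lambda_j(-\Delta-V)|^\gamma}{\int_{\mathbb{R}^d}V(x)^{\gamma+d/2}\,dx}=L^{(N)}_{\gamma,d}.$$ -/

import Mathlib

open MeasureTheory
open scoped ENNReal ContDiff

noncomputable section

namespace LiebThirring

/-- The Euclidean space `ℝ^d`. -/
abbrev Space (d : ℕ) : Type := EuclideanSpace ℝ (Fin d)

/-- The complex Hilbert space `L²(ℝ^d)`. -/
abbrev L2 (d : ℕ) : Type := Lp ℂ 2 (volume : Measure (Space d))

/-- `g` is a weak gradient of `u`: `∫ u ∂ᵢφ = - ∫ gᵢ φ` for every test function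
`φ ∈ C_c^∞(ℝ^d)` and every `i`. It is used for square-integrable `u` and `g` only. -/
def IsWeakGradient {d : ℕ} (u : Space d → ℂ) (g : Space d → EuclideanSpace ℂ (Fin d)) : Prop :=
  ∀ φ : Space d → ℝ, ContDiff ℝ ∞ φ → HasCompactSupport φ → ∀ i : Fin d,
    ∫ x, (fderiv ℝ φ x (EuclideanSpace.single i 1)) • u x = - ∫ x, φ x • g x i

/-- `u ∈ L²(ℝ^d)` belongs to the Sobolev space `H¹(ℝ^d)`: it has a weak gradient in `L²`. -/
def MemH1 {d : ℕ} (u : L2 d) : Prop :=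
  ∃ g : Space d → EuclideanSpace ℂ (Fin d), MemLp g 2 volume ∧ IsWeakGradient u g

/-- A square-integrable weak gradient is unique almost everywhere. -/
theorem IsWeakGradient.ae_eq {d : ℕ} {u : Space d → ℂ}
    {g h : Space d → EuclideanSpace ℂ (Fin d)} (hg : MemLp g 2 volume) (hh : MemLp h 2 volume)
    (hug : IsWeakGradient u g) (huh : IsWeakGradient u h) : g =ᵐ[volume] h := by
  have key : ∀ i : Fin d, ∀ᵐ x, g x i = h x i := by
    intro i
    have hgi : LocallyIntegrable (fun x => g x i) volume :=
      ((EuclideanSpace.proj (𝕜 := ℂ) i).comp_memLp' hg).locallyIntegrable (by norm_num)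
    have hhi : LocallyIntegrable (fun x => h x i) volume :=
      ((EuclideanSpace.proj (𝕜 := ℂ) i).comp_memLp' hh).locallyIntegrable (by norm_num)
    refine ae_eq_of_integral_contDiff_smul_eq hgi hhi ?_
    intro φ hφ hc
    have h1 := hug φ hφ hc i
    have h2 := huh φ hφ hc i
    exact neg_injective (h1.symm.trans h2)
  filter_upwards [ae_all_iff.2 key] with x hx
  ext i
  exact hx i

open Classical in
/-- The weak gradient `∇u` of `u ∈ H¹(ℝ^d)` (and `0` by convention if `u ∉ H¹(ℝ^d)`). -/
def weakGradient {d : ℕ} (u : L2 d) : Space d → EuclideanSpace ℂ (Fin d) :=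
  if h : MemH1 u then h.choose else 0

/-- The quadratic form `u ↦ ∫ |∇u|² - ∫ V |u|²` of `-Δ - V`, to be used on its form domain
`H¹(ℝ^d)`. -/
def energy {d : ℕ} (V : Space d → ℝ) (u : L2 d) : ℝ :=
  (∫ x, ‖weakGradient u x‖ ^ 2) - ∫ x, V x * ‖u x‖ ^ 2

/-- The `j`-th min-max level `λ_j(-Δ - V)`, for `j ≥ 1`: the infimum over the `j`-dimensional
subspaces `W` of the form domain `H¹(ℝ^d)` of the supremum of the quadratic form over the
`L²`-normalized elements of `W`. -/
def level {d : ℕ} (V : Space d → ℝ) (j : ℕ) : EReal :=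
  ⨅ (W : Submodule ℂ (L2 d)) (_ : ∀ u ∈ W, MemH1 u) (_ : Module.finrank ℂ W = j),
    ⨆ (u : L2 d) (_ : u ∈ W) (_ : ‖u‖ = 1), (energy V u : EReal)

/-- The competitors: `0 ≤ V ∈ L^{γ+d/2}(ℝ^d)` with `V ≠ 0`, as almost-everywhere classes. -/
structure IsAdmissible (d : ℕ) (γ : ℝ) (V : Space d → ℝ) : Prop where
  memLp : MemLp V (ENNReal.ofReal (γ + d / 2)) volume
  nonneg : 0 ≤ᵐ[volume] V
  nontrivial : ¬ V =ᵐ[volume] 0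

/-- The quotient `(∑_{j=1}^N |λ_j(-Δ - V)|^γ) / ∫ V^{γ+d/2}`. -/
def quotient (d : ℕ) (γ : ℝ) (N : ℕ) (V : Space d → ℝ) : ℝ≥0∞ :=
  (∑ j ∈ Finset.Icc 1 N, (level V j).abs ^ γ) /
    ∫⁻ x, ENNReal.ofReal (V x) ^ (γ + d / 2)

/-- The finite-rank Lieb-Thirring constant `L^{(N)}_{γ,d}`, the supremum of the quotient. -/
def constant (d : ℕ) (γ : ℝ) (N : ℕ) : ℝ≥0∞ :=
  ⨆ (V : Space d → ℝ) (_ : IsAdmissible d γ V), quotient d γ N V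

/-- `V` is an optimizer for `L^{(N)}_{γ,d}`: it is a competitor that realizes the supremum. -/
def IsOptimizer (d : ℕ) (γ : ℝ) (N : ℕ) (V : Space d → ℝ) : Prop :=
  IsAdmissible d γ V ∧ quotient d γ N V = constant d γ N

end LiebThirring

end

open MeasureTheory
open scoped ENNReal ContDiff

noncomputable section

namespace LiebThirring

/-! ### Weak gradients and the space H¹. -/

variable {d : ℕ}

/-! Put p = γ + d/2, write S(V) for the sum of the |λ_j(-Δ-V)|^γ over j ≤ N, and L for the supremum.
The hypotheses give p > 1 and d < 2p. The quotient does not change under V ↦ t² V(t x + a), so one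
may assume ∫ V^p = 1. Since d < 2p, the form ∫ V|u|² is then bounded relative to ∫ |∇u|² with
arbitrarily small relative bound, uniformly in V. All levels therefore lie in a fixed interval [-C,
0] (`exists_depth_bound`), and L is finite (`constant_lt_top`).

For the optimizer, take a normalized maximizing sequence V_n. A level bounded away from 0 forces
some dyadic cube of fixed size to carry a fixed amount of ∫ V_n (`exists_cube_of_level_lt`). After
translation this is the same cube for all n, so the weak limit V₀ in L^p is not zero. The core is
the binding estimate `eventually_rieszSum_le`: for R large, S(V_n) ≤ S(V₀) + S(V_n 1_{|x|>R}) + ε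
along the sequence. Bounding the outer term by L ∫_{|x|>R} V_n^p and using ∫ V_n^p = 1 gives L
∫_{|x|≤R} V_n^p ≤ S(V₀) + 2ε. Weak lower semicontinuity and R → ∞ yield L ∫ V₀^p ≤ S(V₀), which is
optimality (`constant_mul_le`). The limit V₀ may have lost mass; no strict binding inequality is
needed.

Binding rests on three facts. The localization formula with cutoffs cos θ and sin θ, with linear
algebra on hermitian forms, splits a j-dimensional negative subspace into an inner and an outer one
of total dimension at least j (`exists_split`). On functions supported in a fixed ball, the forms of
V_n and V₀ are close (`eventually_energy_le`). Hall's marriage theorem turns the resulting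
domination of each level into an inequality between sums (`sum_le_sum_add_sum_of_forall`).

All Sobolev-type input comes from dyadic averages: they approximate H¹ functions in L²(V dx) at a
geometric rate uniform in V, and inside a ball they involve only the masses of finitely many cubes.
-/

theorem _root_.MeasureTheory.MemLp.integrable_testFunction_smul {F : Type*} [NormedAddCommGroup F]
    [NormedSpace ℝ F] {φ : Space d → ℝ} (hφ : Continuous φ) (hc : HasCompactSupport φ)
    {u : Space d → F} (hu : MemLp u 2 volume) : Integrable (fun x => φ x • u x) volume := by
  have h : MemLp φ 2 volume := hφ.memLp_of_hasCompactSupport hc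
  exact memLp_one_iff_integrable.1 (hu.smul h)

theorem continuous_partialDeriv {φ : Space d → ℝ} (hφ : ContDiff ℝ ∞ φ) (v : Space d) :
    Continuous fun x => fderiv ℝ φ x v :=
  (hφ.continuous_fderiv (by simp)).clm_apply continuous_const

theorem hasCompactSupport_partialDeriv {φ : Space d → ℝ} (hc : HasCompactSupport φ)
    (v : Space d) : HasCompactSupport fun x => fderiv ℝ φ x v := by
  have := hc.fderiv ℝ
  exact this.comp_left (g := fun L : Space d →L[ℝ] ℝ => L v) (by simp)

theorem memLp_proj {g : Space d → EuclideanSpace ℂ (Fin d)} (hg : MemLp g 2 volume)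
    (i : Fin d) : MemLp (fun x => g x i) 2 volume :=
  (EuclideanSpace.proj (𝕜 := ℂ) i).comp_memLp' hg

namespace IsWeakGradient

variable {u v : Space d → ℂ} {g h : Space d → EuclideanSpace ℂ (Fin d)}

theorem congr (H : IsWeakGradient u g) (huv : u =ᵐ[volume] v) (hgh : g =ᵐ[volume] h) :
    IsWeakGradient v h := by
  intro φ hφ hc i
  have h1 : ∫ x, (fderiv ℝ φ x (EuclideanSpace.single i 1)) • v x
      = ∫ x, (fderiv ℝ φ x (EuclideanSpace.single i 1)) • u x :=
    integral_congr_ae (huv.mono fun x hx => by simp only [hx])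
  have h2 : ∫ x, φ x • h x i = ∫ x, φ x • g x i :=
    integral_congr_ae (hgh.mono fun x hx => by simp only [hx])
  rw [h1, h2, H φ hφ hc i]

theorem add (hu : MemLp u 2 volume) (hv : MemLp v 2 volume) (hg : MemLp g 2 volume)
    (hh : MemLp h 2 volume) (Hu : IsWeakGradient u g) (Hv : IsWeakGradient v h) :
    IsWeakGradient (u + v) (g + h) := by
  intro φ hφ hc i
  simp only [Pi.add_apply, PiLp.add_apply, smul_add]
  rw [integral_add, integral_add, Hu φ hφ hc i, Hv φ hφ hc i, neg_add]
  · exact (memLp_proj hg i).integrable_testFunction_smul hφ.continuous hc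
  · exact (memLp_proj hh i).integrable_testFunction_smul hφ.continuous hc
  · exact hu.integrable_testFunction_smul (continuous_partialDeriv hφ _)
      (hasCompactSupport_partialDeriv hc _)
  · exact hv.integrable_testFunction_smul (continuous_partialDeriv hφ _)
      (hasCompactSupport_partialDeriv hc _)

theorem const_smul (c : ℂ) (Hu : IsWeakGradient u g) : IsWeakGradient (c • u) (c • g) := by
  intro φ hφ hc i
  simp only [Pi.smul_apply, PiLp.smul_apply]
  simp_rw [smul_comm _ c]
  rw [integral_smul, integral_smul, Hu φ hφ hc i, smul_neg]

end IsWeakGradient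

variable (d) in
/-- The Sobolev space `H¹(ℝ^d)` as a subspace of `L²(ℝ^d)`. -/
def H1 : Submodule ℂ (L2 d) where
  carrier := {u | MemH1 u}
  add_mem' := by
    rintro u v ⟨g, hg, Hg⟩ ⟨h, hh, Hh⟩
    exact ⟨g + h, hg.add hh, (Hg.add (Lp.memLp u) (Lp.memLp v) hg hh Hh).congr
      (Lp.coeFn_add u v).symm .rfl⟩
  zero_mem' := by
    refine ⟨0, MemLp.zero, ?_⟩
    intro φ hφ hc i
    have : ∫ x, (fderiv ℝ φ x (EuclideanSpace.single i 1)) • (0 : L2 d) x = 0 := by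
      rw [integral_eq_zero_of_ae]
      filter_upwards [Lp.coeFn_zero ℂ 2 (volume : Measure (Space d))] with x hx
      rw [hx, Pi.zero_apply, smul_zero]
    rw [this]
    simp
  smul_mem' := by
    rintro c u ⟨g, hg, Hg⟩
    exact ⟨c • g, hg.const_smul c, (Hg.const_smul c).congr (Lp.coeFn_smul c u).symm .rfl⟩

theorem mem_H1 {u : L2 d} : u ∈ H1 d ↔ MemH1 u := Iff.rfl

theorem MemH1.memLp_weakGradient {u : L2 d} (hu : MemH1 u) : MemLp (weakGradient u) 2 volume := by
  rw [weakGradient, dif_pos hu]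
  exact hu.choose_spec.1

theorem MemH1.isWeakGradient {u : L2 d} (hu : MemH1 u) : IsWeakGradient u (weakGradient u) := by
  rw [weakGradient, dif_pos hu]
  exact hu.choose_spec.2

theorem weakGradient_ae_eq {u : L2 d} {g : Space d → EuclideanSpace ℂ (Fin d)}
    (hg : MemLp g 2 volume) (H : IsWeakGradient u g) : weakGradient u =ᵐ[volume] g := by
  have hu : MemH1 u := ⟨g, hg, H⟩
  exact hu.isWeakGradient.ae_eq hu.memLp_weakGradient hg H

/-- The gradient as a linear map from `H¹(ℝ^d)` to `L²(ℝ^d; ℂ^d)`. -/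
def grad : H1 d →ₗ[ℂ] Lp (EuclideanSpace ℂ (Fin d)) 2 (volume : Measure (Space d)) where
  toFun u := (mem_H1.1 u.2).memLp_weakGradient.toLp
  map_add' u v := by
    have hu := mem_H1.1 u.2
    have hv := mem_H1.1 v.2
    rw [← MemLp.toLp_add, MemLp.toLp_eq_toLp_iff]
    refine weakGradient_ae_eq (hu.memLp_weakGradient.add hv.memLp_weakGradient) ?_
    exact (hu.isWeakGradient.add (Lp.memLp _) (Lp.memLp _) hu.memLp_weakGradient
      hv.memLp_weakGradient hv.isWeakGradient).congr (Lp.coeFn_add _ _).symm .rfl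
  map_smul' c u := by
    have hu := mem_H1.1 u.2
    rw [RingHom.id_apply, ← MemLp.toLp_const_smul, MemLp.toLp_eq_toLp_iff]
    exact weakGradient_ae_eq (hu.memLp_weakGradient.const_smul c)
      ((hu.isWeakGradient.const_smul c).congr (Lp.coeFn_smul _ _).symm .rfl)

theorem grad_eq_toLp {u : H1 d} {g : Space d → EuclideanSpace ℂ (Fin d)}
    (hg : MemLp g 2 volume) (H : IsWeakGradient (u : L2 d) g) : grad u = hg.toLp := by
  rw [grad, LinearMap.coe_mk, AddHom.coe_mk, MemLp.toLp_eq_toLp_iff]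
  exact weakGradient_ae_eq hg H

theorem coeFn_grad (u : H1 d) : grad u =ᵐ[volume] weakGradient (u : L2 d) :=
  (mem_H1.1 u.2).memLp_weakGradient.coeFn_toLp

theorem isWeakGradient_grad (u : H1 d) : IsWeakGradient (u : L2 d) (grad u) :=
  (mem_H1.1 u.2).isWeakGradient.congr .rfl (coeFn_grad u).symm

/-! ### L² norms and the translation estimate. -/

theorem _root_.MeasureTheory.Lp.norm_sq_eq_integral {α F : Type*} [MeasurableSpace α]
    {μ : Measure α} [NormedAddCommGroup F] (f : Lp F 2 μ) : ‖f‖ ^ 2 = ∫ x, ‖f x‖ ^ 2 ∂μ := by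
  have h := (Lp.memLp f).eLpNorm_eq_integral_rpow_norm (by norm_num) (by norm_num)
  rw [Lp.norm_def, h, ENNReal.toReal_ofReal (by positivity)]
  simp only [ENNReal.toReal_ofNat, Real.rpow_two]
  rw [← Real.rpow_natCast, ← Real.rpow_mul (integral_nonneg fun x => by positivity)]
  norm_num

theorem _root_.MeasureTheory.Lp.enorm_sq_eq_lintegral {α F : Type*} [MeasurableSpace α]
    {μ : Measure α} [NormedAddCommGroup F] (f : Lp F 2 μ) : ‖f‖ₑ ^ 2 = ∫⁻ x, ‖f x‖ₑ ^ 2 ∂μ := by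
  rw [Lp.enorm_def, eLpNorm_eq_lintegral_rpow_enorm_toReal (by norm_num) (by norm_num)]
  simp only [ENNReal.toReal_ofNat, ENNReal.rpow_ofNat, one_div]
  rw [← ENNReal.rpow_ofNat, ← ENNReal.rpow_mul]
  norm_num

theorem norm_grad_sq (u : H1 d) : ‖grad u‖ ^ 2 = ∫ x, ‖weakGradient (u : L2 d) x‖ ^ 2 := by
  rw [Lp.norm_sq_eq_integral]
  exact integral_congr_ae ((coeFn_grad u).mono fun x hx => by simp only [hx])

theorem _root_.MeasureTheory.sq_lintegral_le {α : Type*} [MeasurableSpace α] (ν : Measure α)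
    {f : α → ℝ≥0∞} (hf : AEMeasurable f ν) :
    (∫⁻ x, f x ∂ν) ^ 2 ≤ ν Set.univ * ∫⁻ x, f x ^ 2 ∂ν := by
  have h := ENNReal.lintegral_mul_le_Lp_mul_Lq ν Real.HolderConjugate.two_two
    (aemeasurable_const (b := (1 : ℝ≥0∞))) hf
  simp only [Pi.mul_apply, one_mul, one_pow, lintegral_const, ENNReal.rpow_two] at h
  calc (∫⁻ x, f x ∂ν) ^ 2 ≤ _ := pow_le_pow_left' h 2
    _ = _ := by
      rw [mul_pow, ← ENNReal.rpow_mul_natCast, ← ENNReal.rpow_mul_natCast]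
      norm_num

theorem IsWeakGradient.integral_fderiv_smul {u : Space d → ℂ}
    {g : Space d → EuclideanSpace ℂ (Fin d)} (H : IsWeakGradient u g) (hu : MemLp u 2 volume)
    (hg : MemLp g 2 volume) {φ : Space d → ℝ} (hφ : ContDiff ℝ ∞ φ) (hc : HasCompactSupport φ)
    (h : Space d) :
    ∫ x, (fderiv ℝ φ x h) • u x = - ∫ x, φ x • ∑ i, h i • g x i := by
  have e : ∀ x, (fderiv ℝ φ x h) • u x
      = ∑ i, h i • ((fderiv ℝ φ x (EuclideanSpace.single i 1)) • u x) := by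
    intro x
    have : h = ∑ i, h i • EuclideanSpace.single i (1 : ℝ) := by
      have := (EuclideanSpace.basisFun (Fin d) ℝ).sum_repr h
      simpa using this.symm
    conv_lhs => rw [this]
    simp only [map_sum, map_smul, Finset.sum_smul, smul_assoc]
  have e2 : ∀ x, φ x • ∑ i, h i • g x i = ∑ i, h i • (φ x • g x i) := by
    intro x
    rw [Finset.smul_sum]
    exact Finset.sum_congr rfl fun i _ => smul_comm _ _ _
  simp_rw [e, e2]
  rw [integral_finsetSum, integral_finsetSum, ← Finset.sum_neg_distrib]
  · refine Finset.sum_congr rfl fun i _ => ?_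
    rw [integral_smul, integral_smul, H φ hφ hc i, smul_neg]
  · exact fun i _ => ((memLp_proj hg i).integrable_testFunction_smul hφ.continuous hc).smul (h i)
  · exact fun i _ => (hu.integrable_testFunction_smul (continuous_partialDeriv hφ _)
      (hasCompactSupport_partialDeriv hc _)).smul (h i)

theorem enorm_sum_smul_le (h : Space d) (z : EuclideanSpace ℂ (Fin d)) :
    ‖∑ i, h i • z i‖ₑ ≤ ‖h‖ₑ * ‖z‖ₑ := by
  have h1 : ‖∑ i, h i • z i‖ ≤ ‖h‖ * ‖z‖ := by
    have := norm_inner_le_norm (𝕜 := ℂ) (WithLp.toLp 2 fun i => (h i : ℂ)) z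
    have e : inner ℂ (WithLp.toLp 2 fun i => (h i : ℂ)) z = ∑ i, h i • z i := by
      simp [PiLp.inner_apply, mul_comm]
    have e2 : ‖(WithLp.toLp 2 fun i => (h i : ℂ) : EuclideanSpace ℂ (Fin d))‖ = ‖h‖ := by
      simp [EuclideanSpace.norm_eq]
    rwa [e, e2] at this
  simp only [← ofReal_norm]
  rw [← ENNReal.ofReal_mul (norm_nonneg _)]
  exact ENNReal.ofReal_le_ofReal h1

/-- The uniform distribution on the unit interval. -/
def unitMeasure : Measure ℝ := volume.restrict (Set.Ioc 0 1)

instance : IsProbabilityMeasure unitMeasure := ⟨by simp [unitMeasure]⟩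

/-- Each slice is a translation. Composing with this map puts almost-everywhere classes on the
product space, so integrals of an L² function along segments are measurable and Fubini applies. -/
theorem measurePreserving_add_smul (h : Space d) :
    MeasurePreserving (fun z : Space d × ℝ => z.1 + z.2 • h)
      ((volume : Measure (Space d)).prod unitMeasure) volume := by
  have hm : Measurable (fun z : Space d × ℝ => z.1 + z.2 • h) := by fun_prop
  refine ⟨hm, ?_⟩
  ext s hs
  rw [Measure.map_apply hm hs, Measure.prod_apply_symm (hm hs)]
  have : ∀ t : ℝ, volume ((fun x : Space d => (x, t)) ⁻¹' ((fun z : Space d × ℝ => z.1 + z.2 • h)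
      ⁻¹' s)) = volume s := fun t => measure_preimage_add_right volume (t • h) s
  simp [this]

/-- This is u(x+h) - u(x) = ∫₀¹ h·∇u(x+sh) ds, followed by Cauchy–Schwarz in s and translation
invariance. The identity is proved by duality rather than density: tested against φ, the difference
moves to φ, where the classical fundamental theorem of calculus applies. -/
theorem lintegral_translate_sub_le (u : H1 d) (h : Space d) :
    ∫⁻ x, ‖(u : L2 d) (x + h) - (u : L2 d) x‖ₑ ^ 2 ≤ ‖h‖ₑ ^ 2 * ‖grad u‖ₑ ^ 2 := by
  set U : Space d → ℂ := ((u : L2 d) : Space d → ℂ) with hU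
  have hUm : MemLp U 2 volume := Lp.memLp _
  set g : Space d → EuclideanSpace ℂ (Fin d) := (grad u : Space d → EuclideanSpace ℂ (Fin d)) with hg
  have hgm : MemLp g 2 volume := Lp.memLp _
  have H : IsWeakGradient U g := isWeakGradient_grad u
  set κ : Space d → ℂ := fun x => ∑ i, h i • g x i with hκ
  have hκm : MemLp κ 2 volume := memLp_finsetSum _ fun i _ => (memLp_proj hgm i).const_smul (h i)
  have hKm : MemLp (fun z : Space d × ℝ => κ (z.1 + z.2 • h)) 2 (volume.prod unitMeasure) :=
    hκm.comp_measurePreserving (measurePreserving_add_smul h)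
  set w : Space d → ℂ := fun x => ∫ s, κ (x + s • h) ∂unitMeasure with hw
  have hwsm : AEStronglyMeasurable w volume := hKm.1.integral_prod_right'
  have hKx : ∀ᵐ x, AEStronglyMeasurable (fun s => κ (x + s • h)) unitMeasure :=
    hKm.1.prodMk_left
  have hwle : ∫⁻ x, ‖w x‖ₑ ^ 2 ≤ ‖h‖ₑ ^ 2 * ‖grad u‖ₑ ^ 2 := by
    calc ∫⁻ x, ‖w x‖ₑ ^ 2 ≤ ∫⁻ x, ∫⁻ s, ‖κ (x + s • h)‖ₑ ^ 2 ∂unitMeasure := by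
          refine lintegral_mono_ae (hKx.mono fun x hx => ?_)
          calc ‖w x‖ₑ ^ 2 ≤ (∫⁻ s, ‖κ (x + s • h)‖ₑ ∂unitMeasure) ^ 2 :=
                pow_le_pow_left' (enorm_integral_le_lintegral_enorm _) 2
            _ ≤ _ := (sq_lintegral_le unitMeasure hx.enorm).trans_eq (by simp)
      _ = ∫⁻ x, ‖κ x‖ₑ ^ 2 := by
          rw [← lintegral_prod (fun z : Space d × ℝ => ‖κ (z.1 + z.2 • h)‖ₑ ^ 2)
            (hKm.1.enorm.pow_const 2)]
          have := (measurePreserving_add_smul h).map_eq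
          conv_rhs => rw [← this]
          rw [lintegral_map' _ (measurePreserving_add_smul h).aemeasurable]
          rw [this]
          exact hκm.1.enorm.pow_const 2
      _ ≤ ∫⁻ x, ‖h‖ₑ ^ 2 * ‖g x‖ₑ ^ 2 := by
          refine lintegral_mono fun x => ?_
          rw [← mul_pow]
          exact pow_le_pow_left' (enorm_sum_smul_le h (g x)) 2
      _ = _ := by
          rw [lintegral_const_mul'' _ (hgm.1.enorm.pow_const 2), Lp.enorm_sq_eq_lintegral]
  have hUh : MemLp (fun x => U (x + h)) 2 volume :=
    hUm.comp_measurePreserving (measurePreserving_add_right volume h)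
  have hw2 : MemLp w 2 volume := by
    refine ⟨hwsm, ?_⟩
    rw [eLpNorm_lt_top_iff_lintegral_rpow_enorm_lt_top (by norm_num) (by norm_num)]
    simp only [ENNReal.toReal_ofNat, ENNReal.rpow_two]
    refine hwle.trans_lt ?_
    exact ENNReal.mul_lt_top (by simp) (by simp)
  -- Both sides are in L², hence locally integrable, so testing against smooth compactly supported
  -- functions suffices.
  have key : (fun x => U (x + h) - U x) =ᵐ[volume] w := by
    refine ae_eq_of_integral_contDiff_smul_eq ((hUh.sub hUm).locallyIntegrable (by norm_num))
      (hw2.locallyIntegrable (by norm_num)) ?_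
    intro φ hφ hc
    have hφ2 : MemLp φ 2 volume := hφ.continuous.memLp_of_hasCompactSupport hc
    have shift : ∀ s : ℝ, ContDiff ℝ ∞ (fun x : Space d => φ (x - s • h)) ∧
        HasCompactSupport (fun x : Space d => φ (x - s • h)) := fun s =>
      ⟨hφ.comp (contDiff_id.sub contDiff_const), by
        simp only [sub_eq_add_neg]
        exact hc.comp_homeomorph (Homeomorph.addRight (-(s • h)))⟩
    have hint1 : Integrable (fun z : Space d × ℝ => φ z.1 • κ (z.1 + z.2 • h))
        (volume.prod unitMeasure) :=
      memLp_one_iff_integrable.1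
        (hKm.smul (hφ2.comp_measurePreserving measurePreserving_fst))
    have hD : MemLp (fun x => fderiv ℝ φ x h) 2 volume :=
      (continuous_partialDeriv hφ h).memLp_of_hasCompactSupport (hasCompactSupport_partialDeriv hc h)
    have hint2 : Integrable (fun z : Space d × ℝ => fderiv ℝ φ (z.1 + z.2 • (-h)) h • U z.1)
        (volume.prod unitMeasure) :=
      memLp_one_iff_integrable.1
        ((hUm.comp_measurePreserving measurePreserving_fst).smul
          (hD.comp_measurePreserving (measurePreserving_add_smul (-h))))
    -- The weak gradient identity for the translated test function φ(· - sh).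
    have hinner : ∀ s : ℝ, ∫ x, φ x • κ (x + s • h)
        = - ∫ x, fderiv ℝ φ (x + s • (-h)) h • U x := by
      intro s
      have h1 := H.integral_fderiv_smul hUm hgm (shift s).1 (shift s).2 h
      have h2 : ∀ x, fderiv ℝ (fun x : Space d => φ (x - s • h)) x h
          = fderiv ℝ φ (x + s • (-h)) h := by
        intro x
        rw [fderiv_comp_sub, smul_neg, sub_eq_add_neg]
      simp_rw [h2] at h1
      rw [h1, neg_neg, ← integral_add_right_eq_self
        (fun x => φ (x - s • h) • ∑ i, h i • g x i) (s • h)]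
      simp only [hκ, add_sub_cancel_right]
    have hFTC : ∀ x, ∫ s, fderiv ℝ φ (x + s • (-h)) h ∂unitMeasure = φ x - φ (x - h) := by
      intro x
      have hder : ∀ s ∈ Set.uIcc (0 : ℝ) 1, HasDerivAt (fun s : ℝ => -φ (x + s • (-h)))
          (fderiv ℝ φ (x + s • (-h)) h) s := by
        intro s _
        have h1 : HasDerivAt (fun s : ℝ => x + s • (-h)) (-h) s := by
          simpa using ((hasDerivAt_id s).smul_const (-h)).const_add x
        have h2 : HasFDerivAt φ (fderiv ℝ φ (x + s • (-h))) (x + s • (-h)) :=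
          ((hφ.differentiable (by simp)) _).hasFDerivAt
        have h3 := (h2.comp_hasDerivAt s h1).neg
        rw [map_neg, neg_neg] at h3
        exact h3
      have hc' : Continuous fun s : ℝ => fderiv ℝ φ (x + s • (-h)) h :=
        (continuous_partialDeriv hφ h).comp (by fun_prop)
      have := intervalIntegral.integral_eq_sub_of_hasDerivAt hder
        (hc'.intervalIntegrable _ _)
      rw [intervalIntegral.integral_of_le zero_le_one] at this
      rw [unitMeasure, this]
      simp [sub_eq_add_neg, add_comm]
    have hR : ∫ x, φ x • w x = ∫ x, (φ (x - h) - φ x) • U x := by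
      calc ∫ x, φ x • w x = ∫ x, ∫ s, φ x • κ (x + s • h) ∂unitMeasure := by
            simp_rw [hw, integral_smul]
        _ = ∫ s, (∫ x, φ x • κ (x + s • h)) ∂unitMeasure :=
            integral_integral_swap hint1
        _ = ∫ s, (∫ x, - (fderiv ℝ φ (x + s • (-h)) h • U x)) ∂unitMeasure := by
            simp_rw [hinner, integral_neg]
        _ = ∫ x, ∫ s, - (fderiv ℝ φ (x + s • (-h)) h • U x) ∂unitMeasure :=
            (integral_integral_swap hint2.neg).symm
        _ = ∫ x, (φ (x - h) - φ x) • U x := by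
            refine integral_congr_ae (.of_forall fun x => ?_)
            simp only
            rw [integral_neg, integral_smul_const, hFTC, ← neg_smul, neg_sub]
    rw [hR]
    simp_rw [smul_sub, sub_smul]
    have hs := shift 1
    simp only [one_smul] at hs
    rw [integral_sub (hUh.integrable_testFunction_smul hφ.continuous hc)
      (hUm.integrable_testFunction_smul hφ.continuous hc),
      integral_sub (hUm.integrable_testFunction_smul hs.1.continuous hs.2)
      (hUm.integrable_testFunction_smul hφ.continuous hc)]
    congr 1
    rw [← integral_add_right_eq_self (fun x => φ (x - h) • U x) h]
    simp
  calc ∫⁻ x, ‖U (x + h) - U x‖ₑ ^ 2 = ∫⁻ x, ‖w x‖ₑ ^ 2 :=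
        lintegral_congr_ae (key.mono fun x hx => by simp only [hx])
    _ ≤ _ := hwle

/-! ### Dyadic cubes. -/

/-- The index of the dyadic cube of side `2⁻ᵏ` that contains `x`. -/
def cell (k : ℕ) (x : Space d) : Fin d → ℤ := fun i => ⌊(2 : ℝ) ^ k * x i⌋

/-- The dyadic cube of side `2⁻ᵏ` with index `z`. -/
def cube (k : ℕ) (z : Fin d → ℤ) : Set (Space d) := cell k ⁻¹' {z}

theorem mem_cube {k : ℕ} {z : Fin d → ℤ} {x : Space d} : x ∈ cube k z ↔ cell k x = z := Iff.rfl

theorem measurable_cell (k : ℕ) : Measurable (cell k : Space d → Fin d → ℤ) := by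
  refine measurable_pi_iff.2 fun i => Int.measurable_floor.comp ?_
  fun_prop

theorem measurableSet_cube (k : ℕ) (z : Fin d → ℤ) : MeasurableSet (cube k z) :=
  measurable_cell k (measurableSet_singleton z)

theorem cell_eq_iff {k : ℕ} {z : Fin d → ℤ} {x : Space d} :
    cell k x = z ↔ ∀ i, x i ∈ Set.Ico ((z i : ℝ) / 2 ^ k) ((z i + 1) / 2 ^ k) := by
  have h2 : (0 : ℝ) < 2 ^ k := by positivity
  rw [funext_iff]
  refine forall_congr' fun i => ?_
  rw [cell, Int.floor_eq_iff, Set.mem_Ico, div_le_iff₀ h2, lt_div_iff₀ h2, mul_comm]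

/-- Dyadic cubes are nested: halving the index, with rounding down, gives the index of the parent
cube. -/
theorem cell_eq_of_le {k m : ℕ} (hkm : k ≤ m) {x y : Space d} (h : cell m x = cell m y) :
    cell k x = cell k y := by
  induction m, hkm using Nat.le_induction with
  | base => exact h
  | succ m _ ih =>
    refine ih (funext fun i => ?_)
    have key : ∀ x : Space d, cell m x i = cell (m + 1) x i / 2 := by
      intro x
      have := Int.floor_div_natCast ((2 : ℝ) ^ (m + 1) * x i) 2
      simp only [cell]
      push_cast at this
      rw [← this]
      congr 1
      ring
    rw [key, key, h]

theorem volume_box (a b : Fin d → ℝ) (c : ℝ) (hab : ∀ i, b i - a i = c) :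
    volume {x : Space d | ∀ i, x i ∈ Set.Ico (a i) (b i)} = ENNReal.ofReal c ^ d := by
  have h := (PiLp.volume_preserving_ofLp (Fin d)).measure_preimage
    (MeasurableSet.univ_pi fun i => measurableSet_Ico (a := a i) (b := b i)).nullMeasurableSet
  have e : (WithLp.ofLp ⁻¹' (Set.univ.pi fun i => Set.Ico (a i) (b i)) : Set (Space d))
      = {x : Space d | ∀ i, x i ∈ Set.Ico (a i) (b i)} := by
    ext x; simp [Set.mem_pi]
  rw [← e, h, Real.volume_pi_Ico]
  simp [hab]

theorem volume_cube (k : ℕ) (z : Fin d → ℤ) :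
    volume (cube k z) = ((2 : ℝ≥0∞) ^ (k * d))⁻¹ := by
  have e : cube k z = {x : Space d | ∀ i, x i ∈ Set.Ico ((z i : ℝ) / 2 ^ k) ((z i + 1) / 2 ^ k)} :=
    Set.ext fun x => cell_eq_iff
  rw [e, volume_box _ _ ((2 ^ k)⁻¹) fun i => by ring, ENNReal.ofReal_inv_of_pos (by positivity),
    ENNReal.ofReal_pow (by norm_num), pow_mul, ← ENNReal.inv_pow]
  simp

theorem volume_cube_ne_zero (k : ℕ) (z : Fin d → ℤ) : volume (cube k z) ≠ 0 := by
  rw [volume_cube]; simp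

theorem volume_cube_ne_top (k : ℕ) (z : Fin d → ℤ) : volume (cube k z) ≠ ⊤ := by
  rw [volume_cube]; simp

theorem lintegral_comp_cell (k : ℕ) (ν : Measure (Space d)) (F : (Fin d → ℤ) → ℝ≥0∞) :
    ∫⁻ x, F (cell k x) ∂ν = ∑' z, F z * ν (cube k z) := by
  have hF : Measurable F := Measurable.of_discrete
  rw [← lintegral_map hF (measurable_cell k), lintegral_countable']
  refine tsum_congr fun z => ?_
  rw [Measure.map_apply (measurable_cell k) (measurableSet_singleton z)]
  rfl

theorem tsum_setLIntegral_cube (k : ℕ) (ν : Measure (Space d)) (f : Space d → ℝ≥0∞) :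
    ∑' z, ∫⁻ x in cube k z, f x ∂ν = ∫⁻ x, f x ∂ν := by
  have hU : (⋃ z, cube k z : Set (Space d)) = Set.univ := by
    ext x; simp [mem_cube]
  rw [← setLIntegral_univ, ← hU, lintegral_iUnion (measurableSet_cube k)]
  intro z w hzw
  refine Set.disjoint_left.2 fun x hx hx' => hzw ?_
  rw [← mem_cube.1 hx, mem_cube.1 hx']

/-! ### Dyadic averages and the Poincaré inequality. -/

/-- The average of `u` over a dyadic cube. -/
def cubeAvg (k : ℕ) (u : Space d → ℂ) (z : Fin d → ℤ) : ℂ :=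
  ((2 : ℝ) ^ (k * d)) • ∫ y in cube k z, u y

/-- The dyadic average of `u` at scale `2⁻ᵏ`, constant on each cube. -/
def avg (k : ℕ) (u : Space d → ℂ) (x : Space d) : ℂ := cubeAvg k u (cell k x)

theorem measurable_avg (k : ℕ) (u : Space d → ℂ) : Measurable (avg k u) :=
  (Measurable.of_discrete (f := cubeAvg k u)).comp (measurable_cell k)

theorem enorm_two_pow (n : ℕ) : ‖(2 : ℝ) ^ n‖ₑ = 2 ^ n := by
  rw [Real.enorm_eq_ofReal (by positivity), ENNReal.ofReal_pow (by norm_num)]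
  simp

theorem sq_enorm_cubeAvg_le (k : ℕ) {u : Space d → ℂ} (hu : AEStronglyMeasurable u volume)
    (z : Fin d → ℤ) :
    ‖cubeAvg k u z‖ₑ ^ 2 ≤ 2 ^ (k * d) * ∫⁻ y in cube k z, ‖u y‖ₑ ^ 2 := by
  rw [cubeAvg, enorm_smul, enorm_two_pow, mul_pow]
  calc _ ≤ ((2 : ℝ≥0∞) ^ (k * d)) ^ 2 * (volume (cube k z) * ∫⁻ y in cube k z, ‖u y‖ₑ ^ 2) := by
        gcongr
        refine (pow_le_pow_left' (enorm_integral_le_lintegral_enorm _) 2).trans ?_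
        refine (sq_lintegral_le _ hu.enorm.restrict).trans_eq ?_
        rw [Measure.restrict_apply_univ]
    _ = _ := by
        rw [volume_cube, ← mul_assoc, pow_two, mul_assoc (2 ^ (k * d)),
          ENNReal.mul_inv_cancel (by simp) (by simp), mul_one]

/-- Cauchy–Schwarz for the average over y of u(x) - u(y), with x frozen. -/
theorem sq_enorm_sub_avg_le (k : ℕ) {u : Space d → ℂ} (hu : MemLp u 2 volume) (x : Space d) :
    ‖u x - avg k u x‖ₑ ^ 2 ≤ 2 ^ (k * d) * ∫⁻ y in cube k (cell k x), ‖u x - u y‖ₑ ^ 2 := by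
  have hfin : IsFiniteMeasure (volume.restrict (cube k (cell k x))) :=
    ⟨by simpa using (volume_cube_ne_top k (cell k x)).lt_top⟩
  have hui : Integrable u (volume.restrict (cube k (cell k x))) :=
    (hu.restrict _).integrable (by norm_num)
  have h : cubeAvg k (fun y => u x - u y) (cell k x) = u x - avg k u x := by
    rw [cubeAvg, avg, cubeAvg, integral_sub (integrable_const _) hui, smul_sub, integral_const,
      measureReal_def, Measure.restrict_apply_univ, volume_cube, ← smul_assoc]
    simp
  rw [← h]
  exact sq_enorm_cubeAvg_le k (aestronglyMeasurable_const.sub hu.1) _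

theorem sq_eLpNorm_two {α F : Type*} [MeasurableSpace α] {μ : Measure α} [NormedAddCommGroup F]
    (f : α → F) : eLpNorm f 2 μ ^ 2 = ∫⁻ x, ‖f x‖ₑ ^ 2 ∂μ := by
  rw [eLpNorm_eq_lintegral_rpow_enorm_toReal (by norm_num) (by norm_num)]
  simp only [ENNReal.toReal_ofNat, ENNReal.rpow_ofNat, one_div]
  rw [← ENNReal.rpow_ofNat, ← ENNReal.rpow_mul]
  norm_num

theorem le_of_sq_le_sq {a b : ℝ≥0∞} (h : a ^ 2 ≤ b ^ 2) : a ≤ b := by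
  rw [← ENNReal.rpow_ofNat, ← ENNReal.rpow_ofNat] at h
  exact (ENNReal.rpow_le_rpow_iff (by norm_num)).1 h

/-- Differences of points of a common dyadic cube. -/
def differenceBox (d k : ℕ) : Set (Space d) :=
  {h | ∀ i, h i ∈ Set.Ico (-((2 : ℝ) ^ k)⁻¹) (((2 : ℝ) ^ k)⁻¹)}

theorem measurableSet_differenceBox (k : ℕ) : MeasurableSet (differenceBox d k) := by
  simp only [differenceBox, Set.ofPred_forall]
  exact MeasurableSet.iInter fun i => measurableSet_Ico.preimage (by fun_prop)

theorem volume_differenceBox (k : ℕ) :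
    volume (differenceBox d k) = 2 ^ d * ((2 : ℝ≥0∞) ^ (k * d))⁻¹ := by
  rw [differenceBox, volume_box _ _ (2 * (2 ^ k)⁻¹) fun i => by ring,
    ENNReal.ofReal_mul (by norm_num), ENNReal.ofReal_inv_of_pos (by positivity),
    ENNReal.ofReal_pow (by norm_num), mul_pow, pow_mul, ← ENNReal.inv_pow]
  simp

theorem enorm_sq_le_of_mem_differenceBox {k : ℕ} {h : Space d} (hh : h ∈ differenceBox d k) :
    ‖h‖ₑ ^ 2 ≤ d * (((2 : ℝ≥0∞) ^ k)⁻¹) ^ 2 := by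
  have h1 : ‖h‖ ^ 2 ≤ d * ((2 ^ k)⁻¹) ^ 2 := by
    rw [EuclideanSpace.norm_sq_eq]
    calc _ ≤ ∑ i : Fin d, (((2 : ℝ) ^ k)⁻¹) ^ 2 := by
          refine Finset.sum_le_sum fun i _ => ?_
          gcongr
          exact abs_le.2 ⟨(hh i).1, (hh i).2.le⟩
      _ = _ := by simp
  calc ‖h‖ₑ ^ 2 = ENNReal.ofReal (‖h‖ ^ 2) := by
        rw [ENNReal.ofReal_pow (norm_nonneg _), ofReal_norm]
    _ ≤ ENNReal.ofReal (d * ((2 ^ k)⁻¹) ^ 2) := ENNReal.ofReal_le_ofReal h1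
    _ = _ := by
        rw [ENNReal.ofReal_mul (by positivity), ENNReal.ofReal_pow (by positivity),
          ENNReal.ofReal_inv_of_pos (by positivity), ENNReal.ofReal_pow (by norm_num)]
        simp

theorem sub_mem_differenceBox {k : ℕ} {x y : Space d} (h : cell k y = cell k x) :
    y - x ∈ differenceBox d k := by
  intro i
  have h1 := cell_eq_iff.1 h i
  have h2 := cell_eq_iff.1 (rfl : cell k x = cell k x) i
  have h3 : ((cell k x i : ℝ) + 1) / 2 ^ k = (cell k x i : ℝ) / 2 ^ k + (2 ^ k)⁻¹ := by
    rw [add_div, one_div]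
  rw [h3] at h1 h2
  simp only [PiLp.sub_apply, Set.mem_Ico] at *
  constructor <;> linarith [h1.1, h1.2, h2.1, h2.2]

/-- The Poincaré inequality on dyadic cubes. -/
theorem eLpNorm_sub_avg_le (k : ℕ) (u : H1 d) :
    eLpNorm (fun x => (u : L2 d) x - avg k (u : L2 d) x) 2 volume
      ≤ 2 ^ d * d * (2 ^ k)⁻¹ * ‖grad u‖ₑ := by
  have hu : MemLp (u : L2 d) 2 volume := Lp.memLp _
  have husm : StronglyMeasurable ((u : L2 d) : Space d → ℂ) := Lp.stronglyMeasurable _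
  have hum : Measurable ((u : L2 d) : Space d → ℂ) := husm.measurable
  have hmeas : Measurable fun z : Space d × Space d =>
      ‖(u : L2 d) (z.1 + z.2) - (u : L2 d) z.1‖ₑ ^ 2 :=
    (((hum.comp (measurable_fst.add measurable_snd)).sub
      (hum.comp measurable_fst)).enorm).pow_const 2
  -- Writing y = x + h and enlarging the range of h to the difference box makes the domain
  -- independent of x. Fubini then leaves the translation estimate for each h.
  have h1 : ∀ x, ‖(u : L2 d) x - avg k (u : L2 d) x‖ₑ ^ 2 ≤ 2 ^ (k * d) *
      ∫⁻ h in differenceBox d k, ‖(u : L2 d) (x + h) - (u : L2 d) x‖ₑ ^ 2 := by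
    intro x
    refine (sq_enorm_sub_avg_le k hu x).trans ?_
    refine mul_le_mul_right ?_ _
    rw [← lintegral_indicator (measurableSet_cube _ _),
      ← lintegral_indicator (measurableSet_differenceBox k),
      ← lintegral_add_left_eq_self _ x]
    refine lintegral_mono fun h => ?_
    simp only [Set.indicator]
    split_ifs with ha hb
    · rw [← enorm_neg, neg_sub]
    · refine absurd ?_ hb
      simpa using sub_mem_differenceBox (mem_cube.1 ha)
    · exact zero_le
    · exact le_rfl
  have h2 : eLpNorm (fun x => (u : L2 d) x - avg k (u : L2 d) x) 2 volume ^ 2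
      ≤ (2 ^ d * d * (2 ^ k)⁻¹ * ‖grad u‖ₑ) ^ 2 := by
    rw [sq_eLpNorm_two]
    calc _ ≤ ∫⁻ x, 2 ^ (k * d) *
          ∫⁻ h in differenceBox d k, ‖(u : L2 d) (x + h) - (u : L2 d) x‖ₑ ^ 2 :=
          lintegral_mono h1
      _ = 2 ^ (k * d) * ∫⁻ h in differenceBox d k, ∫⁻ x,
            ‖(u : L2 d) (x + h) - (u : L2 d) x‖ₑ ^ 2 := by
          rw [lintegral_const_mul _ hmeas.lintegral_prod_right', lintegral_lintegral_swap]
          exact hmeas.aemeasurable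
      _ ≤ 2 ^ (k * d) * ∫⁻ h in differenceBox d k,
            (d * (((2 : ℝ≥0∞) ^ k)⁻¹) ^ 2 * ‖grad u‖ₑ ^ 2) := by
          gcongr 2 ^ (k * d) * ?_
          refine setLIntegral_mono' (measurableSet_differenceBox k) fun h hh => ?_
          refine (lintegral_translate_sub_le u h).trans ?_
          gcongr
          exact enorm_sq_le_of_mem_differenceBox hh
      _ = (2 ^ (k * d) * (2 ^ (k * d))⁻¹) *
            (2 ^ d * d * (((2 : ℝ≥0∞) ^ k)⁻¹) ^ 2 * ‖grad u‖ₑ ^ 2) := by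
          rw [setLIntegral_const, volume_differenceBox]
          ring
      _ = 2 ^ d * d * (((2 : ℝ≥0∞) ^ k)⁻¹) ^ 2 * ‖grad u‖ₑ ^ 2 := by
          rw [ENNReal.mul_inv_cancel (by simp) (by simp), one_mul]
      -- The constant is squared only so that the square root can be taken without radicals.
      _ ≤ (2 ^ d * d) ^ 2 * (((2 : ℝ≥0∞) ^ k)⁻¹) ^ 2 * ‖grad u‖ₑ ^ 2 := by
          gcongr
          exact_mod_cast Nat.le_self_pow two_ne_zero (2 ^ d * d)
      _ = _ := by ring
  exact le_of_sq_le_sq h2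

/-! ### Approximation by averages in L²(ν) for subcritical ν. -/

/-- Measures whose mass on dyadic cubes of side `δ` is at most `δ^(d - 2θ)`. -/
structure IsSubcritical (θ : ℝ) (ν : Measure (Space d)) : Prop where
  ac : ν ≪ volume
  le : ∀ (k : ℕ) (z : Fin d → ℤ), ν (cube k z) ≤ ((2 : ℝ≥0∞) ^ (θ * k)) ^ 2 * volume (cube k z)

/-- For functions constant on cubes both norms are sums over cubes, so the masses compare term by
term. -/
theorem eLpNorm_comp_cell_le {k : ℕ} {ν : Measure (Space d)} {B : ℝ≥0∞}
    (h : ∀ z : Fin d → ℤ, ν (cube k z) ≤ B ^ 2 * volume (cube k z)) (F : (Fin d → ℤ) → ℂ) :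
    eLpNorm (fun x => F (cell k x)) 2 ν ≤ B * eLpNorm (fun x => F (cell k x)) 2 volume := by
  refine le_of_sq_le_sq ?_
  rw [mul_pow, sq_eLpNorm_two, sq_eLpNorm_two, lintegral_comp_cell k ν (fun z => ‖F z‖ₑ ^ 2),
    lintegral_comp_cell k volume (fun z => ‖F z‖ₑ ^ 2), ← ENNReal.tsum_mul_left]
  refine ENNReal.tsum_le_tsum fun z => (mul_le_mul_right (h z) _).trans_eq (by ring)

/-- The increment is constant on the finer cubes, so passing from volume to ν costs a factor
2^(θ(m+1)), while Poincaré bounds its L² norm by a multiple of 2^(-m). The balance decays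
geometrically as soon as θ < 1. -/
theorem eLpNorm_avg_succ_sub_le {θ : ℝ} (hθ : θ ≤ 1) {ν : Measure (Space d)}
    (hν : IsSubcritical θ ν) (m : ℕ) (u : H1 d) :
    eLpNorm (fun x => avg (m + 1) (u : L2 d) x - avg m (u : L2 d) x) 2 ν
      ≤ 4 * (2 ^ d * d) * ‖grad u‖ₑ * ((2 : ℝ≥0∞) ^ (θ - 1)) ^ m := by
  have hum : AEStronglyMeasurable ((u : L2 d) : Space d → ℂ) volume := Lp.aestronglyMeasurable _
  obtain ⟨F, hF⟩ : ∃ F : (Fin d → ℤ) → ℂ,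
      (fun x => avg (m + 1) (u : L2 d) x - avg m (u : L2 d) x) = F ∘ cell (m + 1) := by
    refine (Function.factorsThrough_iff _).1 fun x y hxy => ?_
    have h2 : cell m x = cell m y := cell_eq_of_le m.le_succ hxy
    simp only [avg, hxy, h2]
  have h1 := eLpNorm_comp_cell_le (hν.le (m + 1)) F
  have h2 : eLpNorm (fun x => avg (m + 1) (u : L2 d) x - avg m (u : L2 d) x) 2 volume
      ≤ 2 * (2 ^ d * d) * ‖grad u‖ₑ * (2⁻¹) ^ m := by
    have e : (fun x => avg (m + 1) (u : L2 d) x - avg m (u : L2 d) x)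
        = (fun x => (u : L2 d) x - avg m (u : L2 d) x)
          - (fun x => (u : L2 d) x - avg (m + 1) (u : L2 d) x) := by
      ext x; simp
    rw [e]
    refine (eLpNorm_sub_le (hum.sub (measurable_avg m _).aestronglyMeasurable)
      (hum.sub (measurable_avg (m + 1) _).aestronglyMeasurable) (by norm_num)).trans ?_
    calc _ ≤ 2 ^ d * d * (2 ^ m)⁻¹ * ‖grad u‖ₑ + 2 ^ d * d * (2 ^ (m + 1))⁻¹ * ‖grad u‖ₑ :=
          add_le_add (eLpNorm_sub_avg_le m u) (eLpNorm_sub_avg_le (m + 1) u)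
      _ ≤ 2 ^ d * d * (2 ^ m)⁻¹ * ‖grad u‖ₑ + 2 ^ d * d * (2 ^ m)⁻¹ * ‖grad u‖ₑ := by
          gcongr
          · norm_num
          · exact m.le_succ
      _ = _ := by rw [ENNReal.inv_pow]; ring
  change eLpNorm (F ∘ cell (m + 1)) 2 ν ≤ _ at h1
  rw [← hF] at h1
  refine h1.trans ((mul_le_mul_right (hF ▸ h2 : eLpNorm (F ∘ cell (m + 1)) 2 volume ≤ _) _).trans ?_)
  have e1 : (2 : ℝ≥0∞) ^ (θ * ((m + 1 : ℕ) : ℝ)) ≤ 2 * (2 ^ θ) ^ m := by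
    rw [Nat.cast_add, Nat.cast_one, mul_add, mul_one,
      ENNReal.rpow_add _ _ (by norm_num) (by norm_num), ENNReal.rpow_mul_natCast, mul_comm]
    gcongr
    calc (2 : ℝ≥0∞) ^ θ ≤ 2 ^ (1 : ℝ) := ENNReal.rpow_le_rpow_of_exponent_le (by norm_num) hθ
      _ = 2 := ENNReal.rpow_one _
  have e2 : (2 : ℝ≥0∞) ^ (θ - 1) = 2 ^ θ * 2⁻¹ := by
    rw [ENNReal.rpow_sub _ _ (by norm_num) (by norm_num), ENNReal.rpow_one, div_eq_mul_inv]
  rw [e2, mul_pow]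
  refine (mul_le_mul_left e1 _).trans_eq ?_
  ring

theorem eLpNorm_avg_add_sub_le {θ : ℝ} (hθ : θ ≤ 1) {ν : Measure (Space d)}
    (hν : IsSubcritical θ ν) (k n : ℕ) (u : H1 d) :
    eLpNorm (fun x => avg (k + n) (u : L2 d) x - avg k (u : L2 d) x) 2 ν
      ≤ 4 * (2 ^ d * d) * ‖grad u‖ₑ * ((2 : ℝ≥0∞) ^ (θ - 1)) ^ k *
        ∑ i ∈ Finset.range n, ((2 : ℝ≥0∞) ^ (θ - 1)) ^ i := by
  induction n with
  | zero => simp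
  | succ n ih =>
    have e : (fun x => avg (k + (n + 1)) (u : L2 d) x - avg k (u : L2 d) x)
        = (fun x => avg (k + n) (u : L2 d) x - avg k (u : L2 d) x)
          + (fun x => avg (k + n + 1) (u : L2 d) x - avg (k + n) (u : L2 d) x) := by
      ext x; simp [add_assoc]
    rw [e, Finset.sum_range_succ, mul_add]
    refine (eLpNorm_add_le
      ((measurable_avg (k + n) _).sub (measurable_avg k _)).aestronglyMeasurable
      ((measurable_avg (k + n + 1) _).sub (measurable_avg (k + n) _)).aestronglyMeasurable
      (by norm_num)).trans (add_le_add ih ?_)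
    refine (eLpNorm_avg_succ_sub_le hθ hν (k + n) u).trans_eq ?_
    rw [pow_add]; ring

theorem two_rpow_lt_one {θ : ℝ} (hθ : θ < 1) : (2 : ℝ≥0∞) ^ (θ - 1) < 1 :=
  ENNReal.rpow_lt_one_of_one_lt_of_neg (by norm_num) (by linarith)

/-- The dyadic averages approximate `H¹` functions in `L²(ν)`. -/
theorem eLpNorm_sub_avg_le_of_isSubcritical {θ : ℝ} (hθ : θ < 1) {ν : Measure (Space d)}
    (hν : IsSubcritical θ ν) (k : ℕ) (u : H1 d) :
    eLpNorm (fun x => (u : L2 d) x - avg k (u : L2 d) x) 2 ν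
      ≤ 4 * (2 ^ d * d) * (1 - (2 : ℝ≥0∞) ^ (θ - 1))⁻¹ * ((2 : ℝ≥0∞) ^ (θ - 1)) ^ k *
        ‖grad u‖ₑ := by
  have husm : StronglyMeasurable ((u : L2 d) : Space d → ℂ) := Lp.stronglyMeasurable _
  have hK : (2 ^ d * d : ℝ≥0∞) * ‖grad u‖ₑ ≠ ⊤ := ENNReal.mul_ne_top
    (ENNReal.mul_ne_top (by simp) (by simp)) (by simp)
  have hlim : Filter.Tendsto (fun m => eLpNorm (avg m (u : L2 d) - ((u : L2 d) : Space d → ℂ)) 2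
      volume) Filter.atTop (nhds 0) := by
    have h0 : Filter.Tendsto (fun m : ℕ => (2 ^ d * d : ℝ≥0∞) * ‖grad u‖ₑ * (2⁻¹) ^ m)
        Filter.atTop (nhds 0) := by
      have := ENNReal.Tendsto.const_mul (a := (2 ^ d * d : ℝ≥0∞) * ‖grad u‖ₑ)
        (ENNReal.tendsto_pow_atTop_nhds_zero_of_lt_one (r := 2⁻¹) (by norm_num)) (.inr hK)
      simpa using this
    refine tendsto_of_tendsto_of_tendsto_of_le_of_le tendsto_const_nhds h0 (fun _ => zero_le)
      fun m => ?_
    rw [eLpNorm_sub_comm]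
    refine (eLpNorm_sub_avg_le m u).trans_eq ?_
    rw [ENNReal.inv_pow]; ring
  -- The averages converge to u in L², hence almost everywhere along a subsequence. Absolute
  -- continuity carries this to ν, and Fatou's lemma bounds the limit by the geometric series.
  obtain ⟨ns, hns, hae⟩ := (tendstoInMeasure_of_tendsto_eLpNorm (by norm_num)
    (fun m => (measurable_avg m _).aestronglyMeasurable) husm.aestronglyMeasurable
    hlim).exists_seq_tendsto_ae
  have hae' : ∀ᵐ x ∂ν, Filter.Tendsto (fun i => avg (ns i) (u : L2 d) x - avg k (u : L2 d) x)
      Filter.atTop (nhds ((u : L2 d) x - avg k (u : L2 d) x)) :=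
    Filter.Eventually.mono (hν.ac.ae_le hae) fun x hx => hx.sub_const _
  refine (Lp.eLpNorm_lim_le_liminf_eLpNorm
    (fun i => ((measurable_avg (ns i) _).sub (measurable_avg k _)).aestronglyMeasurable)
    _ hae').trans ?_
  refine Filter.liminf_le_of_frequently_le' (Filter.Eventually.frequently ?_)
  filter_upwards [hns.tendsto_atTop.eventually_ge_atTop k] with i hi
  obtain ⟨n, hn⟩ := Nat.exists_eq_add_of_le hi
  rw [hn]
  refine (eLpNorm_avg_add_sub_le hθ.le hν k n u).trans ?_
  calc _ ≤ 4 * (2 ^ d * d) * ‖grad u‖ₑ * ((2 : ℝ≥0∞) ^ (θ - 1)) ^ k *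
        (1 - (2 : ℝ≥0∞) ^ (θ - 1))⁻¹ := by
        gcongr
        rw [← ENNReal.tsum_geometric]
        exact ENNReal.sum_le_tsum _
    _ = _ := by ring

/-- The scale k depends on θ and ε but not on ν; this uniformity is what gives compactness later. -/
theorem exists_eLpNorm_sub_avg_le (d : ℕ) {θ : ℝ} (hθ : θ < 1) {ε : ℝ≥0∞} (hε : ε ≠ 0) :
    ∃ k : ℕ, ∀ (ν : Measure (Space d)), IsSubcritical θ ν → ∀ u : H1 d,
      eLpNorm (fun x => (u : L2 d) x - avg k (u : L2 d) x) 2 ν ≤ ε * ‖grad u‖ₑ := by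
  have hC : (4 * (2 ^ d * d) * (1 - (2 : ℝ≥0∞) ^ (θ - 1))⁻¹ : ℝ≥0∞) ≠ ⊤ := by
    refine ENNReal.mul_ne_top (ENNReal.mul_ne_top (by simp) (ENNReal.mul_ne_top (by simp)
      (by simp))) (ENNReal.inv_ne_top.2 ?_)
    exact (tsub_pos_of_lt (two_rpow_lt_one hθ)).ne'
  have := ENNReal.Tendsto.const_mul (a := 4 * (2 ^ d * d) * (1 - (2 : ℝ≥0∞) ^ (θ - 1))⁻¹)
    (ENNReal.tendsto_pow_atTop_nhds_zero_of_lt_one (two_rpow_lt_one hθ)) (.inr hC)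
  rw [mul_zero] at this
  obtain ⟨k, hk⟩ := (this.eventually (ge_mem_nhds hε.bot_lt)).exists
  exact ⟨k, fun ν hν u => (eLpNorm_sub_avg_le_of_isSubcritical hθ hν k u).trans
    (mul_le_mul_left hk _)⟩

theorem sq_eLpNorm_avg_le {k : ℕ} {ν : Measure (Space d)} {A : ℝ≥0∞}
    (h : ∀ z : Fin d → ℤ, ν (cube k z) ≤ A) (u : L2 d) :
    eLpNorm (avg k u) 2 ν ^ 2 ≤ 2 ^ (k * d) * A * ‖u‖ₑ ^ 2 := by
  rw [sq_eLpNorm_two]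
  simp only [avg]
  rw [lintegral_comp_cell k ν (fun z => ‖cubeAvg k u z‖ₑ ^ 2), Lp.enorm_sq_eq_lintegral,
    ← tsum_setLIntegral_cube k volume, ← ENNReal.tsum_mul_left]
  refine ENNReal.tsum_le_tsum fun z => ?_
  calc _ ≤ (2 ^ (k * d) * ∫⁻ y in cube k z, ‖u y‖ₑ ^ 2) * A :=
        mul_le_mul' (sq_enorm_cubeAvg_le k (Lp.aestronglyMeasurable u) z) (h z)
    _ = _ := by ring

theorem eLpNorm_le_avg_add {ε : ℝ≥0∞} {k : ℕ} {ν : Measure (Space d)} {u : H1 d}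
    (h : eLpNorm (fun x => (u : L2 d) x - avg k (u : L2 d) x) 2 ν ≤ ε * ‖grad u‖ₑ) :
    eLpNorm (u : L2 d) 2 ν ≤ eLpNorm (avg k (u : L2 d)) 2 ν + ε * ‖grad u‖ₑ ∧
    eLpNorm (avg k (u : L2 d)) 2 ν ≤ eLpNorm (u : L2 d) 2 ν + ε * ‖grad u‖ₑ := by
  have hum : AEStronglyMeasurable ((u : L2 d) : Space d → ℂ) ν :=
    (Lp.stronglyMeasurable (u : L2 d)).aestronglyMeasurable
  have ham : AEStronglyMeasurable (avg k (u : L2 d)) ν := (measurable_avg k _).aestronglyMeasurable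
  constructor
  · have e : ((u : L2 d) : Space d → ℂ) = avg k (u : L2 d) +
        (fun x => (u : L2 d) x - avg k (u : L2 d) x) := by ext x; simp
    conv_lhs => rw [e]
    exact (eLpNorm_add_le ham (hum.sub ham) (by norm_num)).trans (add_le_add le_rfl h)
  · have e : avg k (u : L2 d) = ((u : L2 d) : Space d → ℂ) -
        (fun x => (u : L2 d) x - avg k (u : L2 d) x) := by ext x; simp
    conv_lhs => rw [e]
    exact (eLpNorm_sub_le hum (hum.sub ham) (by norm_num)).trans (add_le_add le_rfl h)

/-- Smallness of the mass of all cubes at a fixed scale controls the `L²(ν)` norm. -/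
theorem exists_eLpNorm_le (d : ℕ) {θ : ℝ} (hθ : θ < 1) {ε : ℝ≥0∞} (hε : ε ≠ 0) :
    ∃ k : ℕ, ∀ (ν : Measure (Space d)), IsSubcritical θ ν → ∀ A : ℝ≥0∞,
      (∀ z : Fin d → ℤ, ν (cube k z) ≤ A ^ 2) → ∀ u : H1 d,
      eLpNorm (u : L2 d) 2 ν ≤ 2 ^ (k * d) * A * ‖u‖ₑ + ε * ‖grad u‖ₑ := by
  obtain ⟨k, hk⟩ := exists_eLpNorm_sub_avg_le d hθ hε
  refine ⟨k, fun ν hν A hA u => (eLpNorm_le_avg_add (hk ν hν u)).1.trans ?_⟩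
  gcongr
  refine le_of_sq_le_sq ((sq_eLpNorm_avg_le hA _).trans ?_)
  have : (2 : ℝ≥0∞) ^ (k * d) ≤ (2 ^ (k * d)) ^ 2 :=
    le_self_pow₀ (one_le_pow₀ (by norm_num)) two_ne_zero
  calc _ ≤ (2 ^ (k * d)) ^ 2 * A ^ 2 * ‖(u : L2 d)‖ₑ ^ 2 := by gcongr
    _ = _ := by rw [mul_pow, mul_pow]; rfl

/-- A function supported in a ball has only finitely many nonzero averages at scale k, so
convergence of cube masses one at a time becomes uniform. -/
theorem finite_cell_image_ball (k : ℕ) (ρ : ℝ) :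
    (cell k '' Metric.closedBall (0 : Space d) ρ).Finite := by
  refine (Set.Finite.pi' fun _ : Fin d =>
    Set.finite_Icc (⌊-((2 : ℝ) ^ k * ρ)⌋) (⌊(2 : ℝ) ^ k * ρ⌋)).subset ?_
  rintro _ ⟨x, hx, rfl⟩ i
  have h1 : |x i| ≤ ρ := (PiLp.norm_apply_le x i).trans (mem_closedBall_zero_iff.1 hx)
  have h2 := abs_le.1 h1
  have h3 : (0 : ℝ) ≤ 2 ^ k := by positivity
  constructor
  · refine Int.floor_le_floor ?_
    nlinarith
  · refine Int.floor_le_floor ?_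
    nlinarith

/-- Compactness: convergence of the masses of cubes controls the `L²(ν)` norms, uniformly on
bounded sets of `H¹` functions supported in a fixed ball. -/
theorem eventually_eLpNorm_le {ι : Type*} {l : Filter ι} {θ : ℝ} (hθ : θ < 1)
    {ν : ι → Measure (Space d)} (hν : ∀ n, IsSubcritical θ (ν n)) {ν₀ : Measure (Space d)}
    (hν₀ : IsSubcritical θ ν₀)
    (hlim : ∀ k z, ∀ η : ℝ≥0∞, η ≠ 0 → ∀ᶠ n in l, ν n (cube k z) ≤ ν₀ (cube k z) + η)
    (ρ : ℝ) {ε : ℝ≥0∞} (hε : ε ≠ 0) :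
    ∀ᶠ n in l, ∀ u : H1 d, (∀ᵐ x, x ∉ Metric.closedBall (0 : Space d) ρ → (u : L2 d) x = 0) →
      eLpNorm (u : L2 d) 2 (ν n) ≤ eLpNorm (u : L2 d) 2 ν₀ + ε * (‖u‖ₑ + ‖grad u‖ₑ) := by
  have hε2 : ε / 2 ≠ 0 := by simp [hε]
  obtain ⟨k, hk⟩ := exists_eLpNorm_sub_avg_le d hθ hε2
  -- This is the tolerance on each cube mass: after the Cauchy–Schwarz factor 2^(kd) for the
  -- averages, the errors add up to at most ε²‖u‖².
  have hη : (ε / 2 ^ (k * d)) ^ 2 ≠ 0 := by simp [hε]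
  have hfin := finite_cell_image_ball (d := d) k ρ
  filter_upwards [(Filter.eventually_all_finite hfin).2 fun z _ => hlim k z _ hη] with n hn u hu
  have hzero : ∀ z ∉ cell k '' Metric.closedBall (0 : Space d) ρ, cubeAvg k (u : L2 d) z = 0 := by
    intro z hz
    rw [cubeAvg, setIntegral_eq_zero_of_ae_eq_zero, smul_zero]
    filter_upwards [hu] with x hx hxz
    refine hx fun hxb => hz ⟨x, hxb, hxz⟩
  have h1 : eLpNorm (avg k (u : L2 d)) 2 (ν n) ^ 2
      ≤ (eLpNorm (avg k (u : L2 d)) 2 ν₀ + ε * ‖u‖ₑ) ^ 2 := by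
    calc eLpNorm (avg k (u : L2 d)) 2 (ν n) ^ 2
        = ∑' z, ‖cubeAvg k (u : L2 d) z‖ₑ ^ 2 * ν n (cube k z) := by
          rw [sq_eLpNorm_two]
          exact lintegral_comp_cell k _ fun z => ‖cubeAvg k (u : L2 d) z‖ₑ ^ 2
      _ ≤ ∑' z, (‖cubeAvg k (u : L2 d) z‖ₑ ^ 2 * ν₀ (cube k z) +
            ε ^ 2 * ∫⁻ y in cube k z, ‖(u : L2 d) y‖ₑ ^ 2) := by
          refine ENNReal.tsum_le_tsum fun z => ?_
          by_cases hz : z ∈ cell k '' Metric.closedBall (0 : Space d) ρ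
          · refine (mul_le_mul_right (hn z hz) _).trans ?_
            rw [mul_add]
            refine add_le_add le_rfl ?_
            calc _ ≤ (2 ^ (k * d) * ∫⁻ y in cube k z, ‖(u : L2 d) y‖ₑ ^ 2) *
                  (ε / 2 ^ (k * d)) ^ 2 := by
                  gcongr
                  exact sq_enorm_cubeAvg_le k (Lp.aestronglyMeasurable _) z
              _ ≤ ((2 ^ (k * d)) ^ 2 * ∫⁻ y in cube k z, ‖(u : L2 d) y‖ₑ ^ 2) *
                  (ε / 2 ^ (k * d)) ^ 2 := by
                  refine mul_le_mul_left (mul_le_mul_left ?_ _) _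
                  exact le_self_pow₀ (one_le_pow₀ (by norm_num)) two_ne_zero
              _ = (2 ^ (k * d) * (ε / 2 ^ (k * d))) ^ 2 *
                    ∫⁻ y in cube k z, ‖(u : L2 d) y‖ₑ ^ 2 := by ring
              _ = _ := by rw [ENNReal.mul_div_cancel (by simp) (by simp)]
          · simp [hzero z hz]
      _ = eLpNorm (avg k (u : L2 d)) 2 ν₀ ^ 2 + (ε * ‖u‖ₑ) ^ 2 := by
          rw [ENNReal.tsum_add, ENNReal.tsum_mul_left, tsum_setLIntegral_cube, sq_eLpNorm_two,
            mul_pow]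
          congr 1
          · exact (lintegral_comp_cell k _ fun z => ‖cubeAvg k (u : L2 d) z‖ₑ ^ 2).symm
          · rw [← Lp.enorm_sq_eq_lintegral]; rfl
      _ ≤ _ := by rw [add_sq]; gcongr; exact le_self_add
  calc eLpNorm (u : L2 d) 2 (ν n) ≤ eLpNorm (avg k (u : L2 d)) 2 (ν n) + ε / 2 * ‖grad u‖ₑ :=
        (eLpNorm_le_avg_add (hk _ (hν n) u)).1
    _ ≤ eLpNorm (avg k (u : L2 d)) 2 ν₀ + ε * ‖u‖ₑ + ε / 2 * ‖grad u‖ₑ := by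
        gcongr; exact le_of_sq_le_sq h1
    _ ≤ eLpNorm (u : L2 d) 2 ν₀ + ε / 2 * ‖grad u‖ₑ + ε * ‖u‖ₑ + ε / 2 * ‖grad u‖ₑ := by
        gcongr; exact (eLpNorm_le_avg_add (hk _ hν₀ u)).2
    _ = eLpNorm (u : L2 d) 2 ν₀ + (ε * ‖u‖ₑ + (ε / 2 + ε / 2) * ‖grad u‖ₑ) := by ring
    _ = _ := by rw [ENNReal.add_halves]; ring

/-- Potentials in the unit ball of `L^p` define subcritical measures when `p > d / 2`. -/
theorem isSubcritical_withDensity {p : ℝ} (hp : 1 < p) {W : Space d → ℝ≥0∞}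
    (hW : AEMeasurable W volume) (h1 : ∫⁻ x, W x ^ p ≤ 1) :
    IsSubcritical (d / (2 * p)) (volume.withDensity W) := by
  refine ⟨withDensity_absolutelyContinuous _ _, fun k z => ?_⟩
  have hp0 : p ≠ 0 := by linarith
  rw [withDensity_apply _ (measurableSet_cube k z)]
  have hH := ENNReal.lintegral_mul_le_Lp_mul_Lq (volume.restrict (cube k z))
    (Real.HolderConjugate.conjExponent hp) hW.restrict (aemeasurable_const (b := (1 : ℝ≥0∞)))
  simp only [Pi.mul_apply, mul_one, ENNReal.one_rpow, lintegral_const, one_mul,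
    Measure.restrict_apply_univ] at hH
  refine hH.trans ?_
  have e1 : (∫⁻ x in cube k z, W x ^ p) ^ (1 / p) ≤ 1 := by
    refine ENNReal.rpow_le_one ((setLIntegral_le_lintegral _ _).trans h1) (by positivity)
  -- Hölder leaves |Q|^(1-1/p), and |Q|^(-1/p) = 2^(kd/p) = (2^(θk))² for θ = d/(2p).
  have e2 : volume (cube k z) ^ (1 / p.conjExponent)
      = ((2 : ℝ≥0∞) ^ (d / (2 * p) * k : ℝ)) ^ 2 * volume (cube k z) := by
    have e3 : 1 / p.conjExponent = -(1 / p) + 1 := by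
      rw [one_div, ← (Real.HolderConjugate.conjExponent hp).one_sub_inv]; ring
    rw [e3, ENNReal.rpow_add _ _ (volume_cube_ne_zero k z) (volume_cube_ne_top k z),
      ENNReal.rpow_one, volume_cube, ENNReal.inv_rpow, ENNReal.rpow_neg, inv_inv,
      ← ENNReal.rpow_natCast 2, ← ENNReal.rpow_mul, ← ENNReal.rpow_mul_natCast]
    congr 2
    push_cast
    field_simp
  calc _ ≤ 1 * volume (cube k z) ^ (1 / p.conjExponent) := by gcongr
    _ = _ := by rw [one_mul, e2]

/-! ### Weak compactness in L^p through setwise limits of measures. -/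

section

open Filter Topology

section Setwise

variable {α ι : Type*} [MeasurableSpace α]

/-- A family of measures that is uniformly absolutely continuous with respect to a finite measure
converges setwise along every ultrafilter. -/
theorem exists_setwise_limit (U : Ultrafilter ι) (μ : ι → Measure α) (γ : Measure α)
    [IsFiniteMeasure γ] {s : ℝ} (hs : 0 < s)
    (h : ∀ n A, MeasurableSet A → μ n A ≤ γ A ^ s) :
    ∃ v : Measure α, ∀ A, MeasurableSet A →
      Tendsto (fun n => μ n A) U (𝓝 (v A)) ∧ v A ≤ γ A ^ s := by
  -- `ℝ≥0∞` is compact, so limits along an ultrafilter exist for every set at once.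
  have hlim : ∀ A : Set α, ∃ a, Tendsto (fun n => μ n A) U (𝓝 a) := fun A =>
    ⟨_, (U.map fun n => μ n A).le_nhds_lim⟩
  choose m hm using hlim
  have hle : ∀ A, MeasurableSet A → m A ≤ γ A ^ s := fun A hA =>
    le_of_tendsto (hm A) (.of_forall fun n => h n A hA)
  have h0 : m ∅ = 0 := by
    have := hle ∅ .empty
    rw [measure_empty, ENNReal.zero_rpow_of_pos hs] at this
    exact le_antisymm this zero_le
  have hadd : ∀ A B, MeasurableSet B → Disjoint A B → m (A ∪ B) = m A + m B := by
    intro A B hB hAB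
    refine tendsto_nhds_unique (hm (A ∪ B)) ?_
    simp_rw [measure_union hAB hB]
    exact (hm A).add (hm B)
  refine ⟨Measure.ofMeasurable (fun A _ => m A) h0 ?_, fun A hA => ?_⟩
  · intro f hf hd
    set T : ℕ → Set α := fun N => ⋃ i ∈ Finset.range N, f i with hT
    have hTm : ∀ N, MeasurableSet (T N) := fun N =>
      Finset.measurableSet_biUnion _ fun i _ => hf i
    have hTs : ∀ N, m (T N) = ∑ i ∈ Finset.range N, m (f i) := by
      intro N
      induction N with
      | zero => simpa [hT] using h0
      | succ N ih =>
        have e : T (N + 1) = T N ∪ f N := by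
          simp only [hT, Finset.range_add_one, Finset.set_biUnion_insert]
          rw [Set.union_comm]
        rw [e, hadd _ _ (hf N), ih, Finset.sum_range_succ]
        simp only [hT, Set.disjoint_iUnion_left]
        intro i hi
        exact hd (Finset.mem_range.1 hi).ne
    have hFm : MeasurableSet (⋃ i, f i) := .iUnion hf
    have hTsub : ∀ N, T N ⊆ ⋃ i, f i := fun N => Set.iUnion₂_subset fun i _ => Set.subset_iUnion f i
    have hsplit : ∀ N, m (⋃ i, f i) = ∑ i ∈ Finset.range N, m (f i) + m ((⋃ i, f i) \ T N) := by
      intro N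
      rw [← hTs, ← hadd _ _ (hFm.diff (hTm N)) Set.disjoint_sdiff_right,
        Set.union_sdiff_cancel (hTsub N)]
    -- Finite additivity passes to the limit for free. Countable additivity needs the tails to
    -- vanish, which the uniform bound by the finite measure γ supplies.
    have hzero : Tendsto (fun N => m ((⋃ i, f i) \ T N)) atTop (𝓝 0) := by
      have h1 : Tendsto (fun N => γ ((⋃ i, f i) \ T N)) atTop (𝓝 0) := by
        have hanti : Antitone fun N => (⋃ i, f i) \ T N := by
          intro a b hab
          refine Set.sdiff_subset_sdiff_right ?_
          exact Set.biUnion_subset_biUnion_left fun i hi =>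
            Finset.mem_range.2 ((Finset.mem_range.1 hi).trans_le hab)
        have hT' : (⋃ N, T N) = ⋃ i, f i := by
          refine Set.Subset.antisymm (Set.iUnion_subset hTsub) (Set.iUnion_subset fun i => ?_)
          refine Set.subset_iUnion_of_subset (i + 1) ?_
          exact Set.subset_biUnion_of_mem (u := f) (Finset.mem_coe.2 (Finset.self_mem_range_succ i))
        have := tendsto_measure_iInter_atTop (μ := γ)
          (fun N => (hFm.diff (hTm N)).nullMeasurableSet) hanti ⟨0, measure_ne_top _ _⟩
        rwa [← Set.sdiff_iUnion, hT', Set.sdiff_self, measure_empty] at this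
      have h2 := h1.ennrpow_const s
      rw [ENNReal.zero_rpow_of_pos hs] at h2
      exact tendsto_of_tendsto_of_tendsto_of_le_of_le tendsto_const_nhds h2 (fun _ => zero_le)
        fun N => hle _ (hFm.diff (hTm N))
    have hsum := (ENNReal.tendsto_nat_tsum fun i => m (f i)).add hzero
    rw [add_zero] at hsum
    refine tendsto_nhds_unique (Tendsto.congr (fun N => hsplit N) tendsto_const_nhds) hsum
  · rw [Measure.ofMeasurable_apply _ hA]
    exact ⟨hm A, hle A hA⟩

variable {U : Ultrafilter ι} {μ : ι → Measure α} {v : Measure α}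

/-- A form of Fatou's lemma: simple functions below f have convergent integrals, and the integral of
f against the limit is their supremum. -/
theorem lintegral_le_of_setwise
    (h : ∀ A, MeasurableSet A → Tendsto (fun n => μ n A) U (𝓝 (v A)))
    (f : α → ℝ≥0∞) {a : ℝ≥0∞} (ha : Tendsto (fun n => ∫⁻ x, f x ∂μ n) U (𝓝 a)) :
    ∫⁻ x, f x ∂v ≤ a := by
  rw [lintegral_eq_nnreal]
  refine iSup₂_le fun φ hφ => ?_
  have h1 : Tendsto (fun n => (φ.map ((↑) : NNReal → ℝ≥0∞)).lintegral (μ n)) U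
      (𝓝 ((φ.map ((↑) : NNReal → ℝ≥0∞)).lintegral v)) := by
    simp only [SimpleFunc.map_lintegral]
    exact tendsto_finsetSum _ fun c _ =>
      ENNReal.Tendsto.const_mul (h _ (φ.measurableSet_fiber c)) (.inr ENNReal.coe_ne_top)
  refine le_of_tendsto_of_tendsto h1 ha (.of_forall fun n => ?_)
  exact (SimpleFunc.lintegral_eq_lintegral _ (μ n)).symm.trans_le (lintegral_mono fun x => hφ x)

/-- Apply the Fatou inequality to both f and M - f. Their integrals add up to M times the total
mass, which converges, so neither inequality can be strict. -/
theorem tendsto_lintegral_of_setwise [IsFiniteMeasure v]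
    (h : ∀ A, MeasurableSet A → Tendsto (fun n => μ n A) U (𝓝 (v A)))
    {f : α → ℝ≥0∞} (hf : Measurable f) {M : ℝ≥0∞} (hM : M ≠ ⊤) (hfM : ∀ x, f x ≤ M) :
    Tendsto (fun n => ∫⁻ x, f x ∂μ n) U (𝓝 (∫⁻ x, f x ∂v)) := by
  obtain ⟨a, ha⟩ : ∃ a, Tendsto (fun n => ∫⁻ x, f x ∂μ n) U (𝓝 a) :=
    ⟨_, (U.map fun n => ∫⁻ x, f x ∂μ n).le_nhds_lim⟩
  obtain ⟨b, hb⟩ : ∃ b, Tendsto (fun n => ∫⁻ x, (M - f x) ∂μ n) U (𝓝 b) :=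
    ⟨_, (U.map fun n => ∫⁻ x, (M - f x) ∂μ n).le_nhds_lim⟩
  have hsum : ∀ w : Measure α, ∫⁻ x, f x ∂w + ∫⁻ x, (M - f x) ∂w = M * w Set.univ := by
    intro w
    rw [← lintegral_add_left hf, ← lintegral_const]
    exact lintegral_congr fun x => add_tsub_cancel_of_le (hfM x)
  have hab : a + b = M * v Set.univ := by
    refine tendsto_nhds_unique (ha.add hb) ?_
    simp_rw [hsum]
    exact ENNReal.Tendsto.const_mul (h _ .univ) (.inr hM)
  have h1 := lintegral_le_of_setwise h f ha
  have h2 := lintegral_le_of_setwise h _ hb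
  have hfin : ∫⁻ x, (M - f x) ∂v ≠ ⊤ := by
    refine ne_top_of_le_ne_top (ENNReal.mul_ne_top hM (measure_ne_top v Set.univ)) ?_
    rw [← hsum v]; exact le_add_self
  have h3 : a ≤ ∫⁻ x, f x ∂v := by
    refine (ENNReal.add_le_add_iff_right hfin).1 ?_
    rw [hsum v, ← hab]
    gcongr
  rwa [le_antisymm h1 h3]

end Setwise

/-- A positive weight with finite integral. -/
def weight (x : Space d) : ℝ≥0∞ := ENNReal.ofReal ((1 + ‖x‖) ^ (-((d : ℝ) + 1)))

theorem weight_pos (x : Space d) : weight x ≠ 0 := by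
  rw [weight, ne_eq, ENNReal.ofReal_eq_zero, not_le]
  positivity

theorem weight_ne_top (x : Space d) : weight x ≠ ⊤ := ENNReal.ofReal_ne_top

theorem weight_le_one (x : Space d) : weight x ≤ 1 := by
  rw [weight, ← ENNReal.ofReal_one]
  refine ENNReal.ofReal_le_ofReal (Real.rpow_le_one_of_one_le_of_nonpos ?_ (by linarith))
  linarith [norm_nonneg x]

theorem measurable_weight : Measurable (weight : Space d → ℝ≥0∞) := by
  unfold weight; fun_prop

theorem lintegral_weight_lt_top : ∫⁻ x : Space d, weight x < ⊤ :=
  finite_integral_one_add_norm (by simp)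

/-- The indicator of a cube divided by the weight is therefore bounded, and hence a legitimate test
function for setwise convergence. -/
theorem exists_weight_ge_of_mem_cube (k : ℕ) (z : Fin d → ℤ) :
    ∃ c : ℝ≥0∞, c ≠ 0 ∧ ∀ x ∈ cube k z, c ≤ weight x := by
  obtain ⟨y, hy⟩ : (cube k z).Nonempty := nonempty_of_measure_ne_zero (volume_cube_ne_zero k z)
  refine ⟨ENNReal.ofReal ((1 + (‖y‖ + d)) ^ (-((d : ℝ) + 1))), ?_, fun x hx => ?_⟩
  · rw [ne_eq, ENNReal.ofReal_eq_zero, not_le]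
    positivity
  · refine ENNReal.ofReal_le_ofReal (Real.rpow_le_rpow_of_nonpos (by positivity) ?_ (by linarith))
    have h1 := sub_mem_differenceBox (hx.trans hy.symm : cell k x = cell k y)
    have h2 : ‖x - y‖ ≤ d := by
      have h3 := EuclideanSpace.norm_sq_eq (x - y)
      have h4 : ∑ i, ‖(x - y) i‖ ^ 2 ≤ ∑ i : Fin d, (1 : ℝ) := by
        refine Finset.sum_le_sum fun i _ => ?_
        have h5 := h1 i
        have h6 : ((2 : ℝ) ^ k)⁻¹ ≤ 1 := inv_le_one_of_one_le₀ (one_le_pow₀ (by norm_num))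
        rw [sq_le_one_iff_abs_le_one, abs_norm, Real.norm_eq_abs, abs_le]
        constructor <;> linarith [h5.1, h5.2]
      simp only [Finset.sum_const, Finset.card_univ, Fintype.card_fin, nsmul_eq_mul, mul_one] at h4
      have h7 : (d : ℝ) ≤ d ^ 2 := by exact_mod_cast Nat.le_self_pow two_ne_zero d
      exact (sq_le_sq₀ (norm_nonneg _) (by positivity)).1 (by linarith)
    have := norm_add_le (x - y) y
    rw [sub_add_cancel] at this
    linarith

/-- Weak compactness of the unit ball of `L^p`. -/
theorem exists_weak_limit {ι : Type*} (U : Ultrafilter ι) {p : ℝ} (hp : 1 < p)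
    {W : ι → Space d → ℝ≥0∞} (hW : ∀ n, Measurable (W n)) (h1 : ∀ n, ∫⁻ x, W n x ^ p ≤ 1) :
    ∃ W₀ : Space d → ℝ≥0∞, Measurable W₀ ∧
      (∀ k z, Tendsto (fun n => ∫⁻ x in cube k z, W n x) U (𝓝 (∫⁻ x in cube k z, W₀ x))) ∧
      ∀ B, MeasurableSet B → ∀ c, (∀ᶠ n in U, ∫⁻ x in B, W n x ^ p ≤ c) →
        ∫⁻ x in B, W₀ x ^ p ≤ c := by
  have hpq := Real.HolderConjugate.conjExponent hp
  set q := p.conjExponent with hq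
  have hq1 : 1 < q := hpq.symm.lt
  set γ : Measure (Space d) := volume.withDensity weight with hγ
  have hγfin : IsFiniteMeasure γ := isFiniteMeasure_withDensity lintegral_weight_lt_top.ne
  set μ : ι → Measure (Space d) := fun n => volume.withDensity fun x => weight x * W n x with hμ
  have hgW : ∀ n, Measurable fun x => weight x * W n x := fun n => measurable_weight.mul (hW n)
  -- Hölder with weight^q ≤ weight. The weight makes γ finite, which gives uniform absolute
  -- continuity on the whole space.
  have hbound : ∀ n A, MeasurableSet A → μ n A ≤ γ A ^ (1 / q) := by
    intro n A hA
    rw [hμ, hγ, withDensity_apply _ hA, withDensity_apply _ hA]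
    refine (ENNReal.lintegral_mul_le_Lp_mul_Lq _ hpq.symm measurable_weight.aemeasurable
      (hW n).aemeasurable).trans ?_
    calc _ ≤ (∫⁻ x in A, weight x) ^ (1 / q) * 1 := by
          gcongr with x
          · exact ENNReal.rpow_le_self_of_le_one (weight_le_one x) hq1.le
          · exact ENNReal.rpow_le_one ((setLIntegral_le_lintegral _ _).trans (h1 n))
              (by have := hpq.pos; positivity)
      _ = _ := mul_one _
  obtain ⟨v, hv⟩ := exists_setwise_limit U μ γ (s := 1 / q) (by positivity) hbound
  have hvfin : IsFiniteMeasure v := ⟨((hv _ .univ).2).trans_lt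
    (ENNReal.rpow_lt_top_of_nonneg (by positivity) (measure_ne_top γ _))⟩
  have hac : v ≪ volume := by
    refine Measure.AbsolutelyContinuous.mk fun A hA h0 => ?_
    have := (hv A hA).2
    rw [withDensity_absolutelyContinuous _ _ h0, ENNReal.zero_rpow_of_pos (by positivity)] at this
    exact le_antisymm this zero_le
  set f := v.rnDeriv volume with hf
  have hfm : Measurable f := Measure.measurable_rnDeriv _ _
  have hvf : volume.withDensity f = v := Measure.withDensity_rnDeriv_eq _ _ hac
  have hset : ∀ A, MeasurableSet A → Tendsto (fun n => μ n A) U (𝓝 (v A)) := fun A hA => (hv A hA).1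
  have cancel : ∀ (x : Space d) (a : ℝ≥0∞), weight x * (a / weight x) = a := fun x a =>
    ENNReal.mul_div_cancel (weight_pos x) (weight_ne_top x)
  have hμint : ∀ n (ψ : Space d → ℝ≥0∞), Measurable ψ →
      ∫⁻ x, ψ x / weight x ∂μ n = ∫⁻ x, W n x * ψ x := by
    intro n ψ hψ
    have hm : Measurable fun x => ψ x / weight x := hψ.div measurable_weight
    refine (lintegral_withDensity_eq_lintegral_mul _ (hgW n) hm).trans ?_
    refine lintegral_congr fun x => ?_
    calc weight x * W n x * (ψ x / weight x) = W n x * (weight x * (ψ x / weight x)) := by ring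
      _ = _ := by rw [cancel]
  have hvint : ∀ (ψ : Space d → ℝ≥0∞), Measurable ψ →
      ∫⁻ x, ψ x / weight x ∂v = ∫⁻ x, f x / weight x * ψ x := by
    intro ψ hψ
    have hm : Measurable fun x => ψ x / weight x := hψ.div measurable_weight
    rw [← hvf, lintegral_withDensity_eq_lintegral_mul _ hfm hm]
    refine lintegral_congr fun x => ?_
    simp only [Pi.mul_apply, div_eq_mul_inv]
    ring
  refine ⟨fun x => f x / weight x, hfm.div measurable_weight, fun k z => ?_, fun B hB c hc => ?_⟩
  · obtain ⟨c, hc0, hc⟩ := exists_weight_ge_of_mem_cube k z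
    have hind : Measurable ((cube k z).indicator fun _ => (1 : ℝ≥0∞)) :=
      measurable_const.indicator (measurableSet_cube k z)
    have hm : Measurable fun x => (cube k z).indicator (fun _ => (1 : ℝ≥0∞)) x / weight x :=
      hind.div measurable_weight
    have := tendsto_lintegral_of_setwise hset hm (M := c⁻¹) (ENNReal.inv_ne_top.2 hc0) ?_
    · simp_rw [hvint _ hind, hμint _ _ hind] at this
      have e : ∀ g : Space d → ℝ≥0∞, ∫⁻ x, g x * (cube k z).indicator (fun _ => 1) x
          = ∫⁻ x in cube k z, g x := by
        intro g
        rw [← lintegral_indicator (measurableSet_cube k z)]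
        refine lintegral_congr fun x => ?_
        by_cases hx : x ∈ cube k z <;> simp [hx]
      simpa only [e] using this
    · intro x
      by_cases hx : x ∈ cube k z
      · simpa [hx] using hc x hx
      · simp [hx]
  · set W₀ : Space d → ℝ≥0∞ := fun x => f x / weight x with hW₀
    have hW₀m : Measurable W₀ := hfm.div measurable_weight
    by_cases hct : c = ⊤
    · rw [hct]; exact le_top
    have hp1 : 0 < p - 1 := by linarith
    -- The dual function W₀^(p-1) on B, for which ψ^q would equal W₀^p and W₀ψ. The truncation at M
    -- times the weight keeps its q-integral I finite, so that I can be divided out of I ≤ c^(1/p)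
    -- I^(1/q).
    set ψ : ℕ → Space d → ℝ≥0∞ := fun M => B.indicator fun x => min (W₀ x ^ (p - 1)) (M * weight x)
      with hψ
    have hψm : ∀ M, Measurable (ψ M) := fun M =>
      ((hW₀m.pow_const _).min (measurable_weight.const_mul _)).indicator hB
    have hψle : ∀ M x, ψ M x ≤ M * weight x := by
      intro M x
      by_cases hx : x ∈ B
      · simp [hψ, hx]
      · simp [hψ, hx]
    have hqp : q * (p - 1) = p := by
      linear_combination hpq.mul_eq_add
    have hbd : ∀ M, ∫⁻ x, ψ M x ^ q ≤ c := by
      intro M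
      set I := ∫⁻ x, ψ M x ^ q with hI
      have hIfin : I ≠ ⊤ := by
        refine ne_top_of_le_ne_top (b := (M : ℝ≥0∞) ^ q * ∫⁻ x : Space d, weight x) ?_ ?_
        · exact ENNReal.mul_ne_top (ENNReal.rpow_ne_top_of_nonneg (by positivity) (by simp))
            lintegral_weight_lt_top.ne
        · rw [← lintegral_const_mul _ measurable_weight]
          refine lintegral_mono fun x => ?_
          calc ψ M x ^ q ≤ (M * weight x) ^ q := by gcongr; exact hψle M x
            _ = M ^ q * weight x ^ q := ENNReal.mul_rpow_of_nonneg _ _ (by positivity)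
            _ ≤ _ := by
              gcongr
              exact ENNReal.rpow_le_self_of_le_one (weight_le_one x) hq1.le
      have hA : I ≤ ∫⁻ x, W₀ x * ψ M x := by
        refine lintegral_mono fun x => ?_
        have h2 : ψ M x ≤ W₀ x ^ (p - 1) := by
          by_cases hx : x ∈ B
          · simp [hψ, hx]
          · simp [hψ, hx]
        have h3 : ψ M x ^ (q - 1) ≤ W₀ x := by
          calc ψ M x ^ (q - 1) ≤ (W₀ x ^ (p - 1)) ^ (q - 1) :=
                ENNReal.rpow_le_rpow h2 (by linarith)
            _ = W₀ x := by
                rw [← ENNReal.rpow_mul]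
                have : (p - 1) * (q - 1) = 1 := by linarith [hpq.mul_eq_add]
                rw [this, ENNReal.rpow_one]
        calc ψ M x ^ q = ψ M x ^ ((q - 1) + 1) := by ring_nf
          _ = ψ M x ^ (q - 1) * ψ M x := by
              rw [ENNReal.rpow_add_of_nonneg _ _ (by linarith) zero_le_one, ENNReal.rpow_one]
          _ ≤ _ := by gcongr
      -- Only the Fatou direction is needed here; Hölder is then applied before the limit.
      have hB' : ∫⁻ x, W₀ x * ψ M x ≤ c ^ (1 / p) * I ^ (1 / q) := by
        obtain ⟨a, ha⟩ : ∃ a, Tendsto (fun n => ∫⁻ x, ψ M x / weight x ∂μ n) U (𝓝 a) :=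
          ⟨_, (U.map fun n => ∫⁻ x, ψ M x / weight x ∂μ n).le_nhds_lim⟩
        have h2 := lintegral_le_of_setwise hset _ ha
        rw [hvint _ (hψm M)] at h2
        refine h2.trans (le_of_tendsto ha ?_)
        filter_upwards [hc] with n hn
        rw [hμint _ _ (hψm M)]
        have e : ∫⁻ x, W n x * ψ M x = ∫⁻ x in B, W n x * ψ M x := by
          rw [← lintegral_indicator hB]
          refine lintegral_congr fun x => ?_
          by_cases hx : x ∈ B <;> simp [hψ, hx]
        rw [e]
        refine (ENNReal.lintegral_mul_le_Lp_mul_Lq _ hpq (hW n).aemeasurable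
          (hψm M).aemeasurable).trans ?_
        gcongr
        exact setLIntegral_le_lintegral _ _
      have hAB := hA.trans hB'
      by_cases hI0 : I = 0
      · rw [hI0]; exact zero_le
      have e1 : I = I ^ (1 / p) * I ^ (1 / q) := by
        rw [← ENNReal.rpow_add _ _ hI0 hIfin, one_div, one_div, hpq.inv_add_inv_eq_one,
          ENNReal.rpow_one]
      have h5 : I ^ (1 / p) ≤ c ^ (1 / p) := by
        have h6 : I ^ (1 / q) ≠ 0 := by
          simp [hI0, hIfin]
        have h7 : I ^ (1 / q) ≠ ⊤ := ENNReal.rpow_ne_top_of_nonneg (by positivity) hIfin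
        exact (ENNReal.mul_le_mul_iff_left h6 h7).1 (e1.symm.trans_le hAB)
      exact (ENNReal.rpow_le_rpow_iff (by have := hpq.pos; positivity)).1 h5
    have hmono : Monotone fun M => fun x => ψ M x ^ q := by
      intro M N hMN x
      have hMN' : (M : ℝ≥0∞) ≤ N := by exact_mod_cast hMN
      by_cases hx : x ∈ B
      · simp only [hψ, hx, Set.indicator_of_mem]
        gcongr
      · simp [hψ, hx]
    have hsup : ∫⁻ x in B, W₀ x ^ p = ⨆ M, ∫⁻ x, ψ M x ^ q := by
      rw [← lintegral_iSup (fun M => (hψm M).pow_const q) hmono, ← lintegral_indicator hB]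
      refine lintegral_congr fun x => ?_
      by_cases hx : x ∈ B
      · simp only [hψ, hx, Set.indicator_of_mem]
        have htop : Tendsto (fun M : ℕ => (M : ℝ≥0∞) * weight x) atTop (𝓝 ⊤) := by
          have := ENNReal.Tendsto.mul_const (b := weight x) ENNReal.tendsto_nat_nhds_top
            (.inl (by simp))
          rwa [ENNReal.top_mul (weight_pos x)] at this
        have h2 : Tendsto (fun M : ℕ => (min (W₀ x ^ (p - 1)) (M * weight x)) ^ q) atTop
            (𝓝 (W₀ x ^ p)) := by
          have := ((tendsto_const_nhds (x := W₀ x ^ (p - 1))).min htop).ennrpow_const q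
          rwa [min_eq_left le_top, ← ENNReal.rpow_mul, mul_comm (p - 1), hqp] at this
        refine tendsto_nhds_unique h2 (tendsto_atTop_iSup fun M N hMN => ?_)
        have hMN' : (M : ℝ≥0∞) ≤ N := by exact_mod_cast hMN
        gcongr
      · simp [hψ, hx, ENNReal.zero_rpow_of_pos (zero_lt_one.trans hq1)]
    rw [hsup]
    exact iSup_le hbd

end

/-! ### Min-max levels -/

theorem energy_eq (V : Space d → ℝ) (u : H1 d) :
    energy V (u : L2 d) = ‖grad u‖ ^ 2 - ∫ x, V x * ‖(u : L2 d) x‖ ^ 2 := by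
  rw [energy, norm_grad_sq]

theorem energy_smul (V : Space d → ℝ) (c : ℂ) (u : H1 d) :
    energy V ((c • u : H1 d) : L2 d) = ‖c‖ ^ 2 * energy V (u : L2 d) := by
  rw [energy_eq, energy_eq, map_smul, norm_smul, mul_sub, mul_pow, ← integral_const_mul]
  congr 1
  refine integral_congr_ae ((Lp.coeFn_smul c (u : L2 d)).mono fun x hx => ?_)
  simp only [Submodule.coe_smul]
  rw [hx, Pi.smul_apply, norm_smul]
  ring

/-- Homogeneity of the form replaces the supremum over the unit sphere by a strict inequality on all
nonzero vectors. -/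
theorem exists_submodule_of_level_lt {V : Space d → ℝ} {j : ℕ} {s : ℝ} (h : level V j < s) :
    ∃ W : Submodule ℂ (H1 d), Module.finrank ℂ W = j ∧
      ∀ u ∈ W, u ≠ 0 → energy V (u : L2 d) < s * ‖u‖ ^ 2 := by
  simp only [level, iInf_lt_iff] at h
  obtain ⟨W, hW, hj, hs⟩ := h
  have hWle : W ≤ H1 d := hW
  refine ⟨W.submoduleOf (H1 d), ?_, fun u hu hu0 => ?_⟩
  · rw [← hj]
    exact (Submodule.submoduleOfEquivOfLe hWle).finrank_eq
  · have hn : ‖u‖ ≠ 0 := norm_ne_zero_iff.2 hu0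
    set c : ℂ := ((‖u‖⁻¹ : ℝ) : ℂ) with hc
    have hcn : ‖c‖ = ‖u‖⁻¹ := by simp [hc]
    have h1 : energy V ((c • u : H1 d) : L2 d) < s := by
      have := hs
      rw [iSup_lt_iff] at this
      obtain ⟨b, hb, hb'⟩ := this
      have h2 := hb' ((c • u : H1 d) : L2 d)
      have h3 : ((c • u : H1 d) : L2 d) ∈ W := W.smul_mem c hu
      have h4 : ‖((c • u : H1 d) : L2 d)‖ = 1 := by
        change ‖c • u‖ = 1
        rw [norm_smul, hcn, inv_mul_cancel₀ hn]
      rw [iSup_pos h3, iSup_pos h4] at h2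
      exact_mod_cast h2.trans_lt hb
    rw [energy_smul, hcn] at h1
    have h5 : 0 < ‖u‖ ^ 2 := by positivity
    calc energy V (u : L2 d) = ‖u‖ ^ 2 * (‖u‖⁻¹ ^ 2 * energy V (u : L2 d)) := by field_simp
      _ < ‖u‖ ^ 2 * s := by gcongr
      _ = _ := mul_comm _ _

theorem level_le_of_submodule {V : Space d → ℝ} {j : ℕ} {s : ℝ} (W : Submodule ℂ (H1 d))
    (hj : Module.finrank ℂ W = j) (h : ∀ u ∈ W, energy V (u : L2 d) ≤ s * ‖u‖ ^ 2) :
    level V j ≤ s := by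
  refine iInf₂_le_of_le (W.map (H1 d).subtype) ?_ (iInf_le_of_le ?_ ?_)
  · rintro u ⟨w, -, rfl⟩
    exact w.2
  · rw [← hj]
    exact (Submodule.equivMapOfInjective _ (H1 d).injective_subtype W).finrank_eq.symm
  · refine iSup_le fun u => iSup₂_le fun hu h1 => ?_
    obtain ⟨w, hw, rfl⟩ := hu
    have h2 := h w hw
    have h3 : ‖w‖ = 1 := h1
    rw [h3, one_pow, mul_one] at h2
    exact_mod_cast h2

theorem level_mono {V V' : Space d → ℝ} (h : ∀ u : H1 d, energy V u ≤ energy V' u) (j : ℕ) :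
    level V j ≤ level V' j := by
  refine iInf_mono fun W => iInf_mono fun hW => iInf_mono fun _ =>
    iSup_mono fun u => iSup_mono fun hu => iSup_mono fun _ => ?_
  exact_mod_cast h ⟨u, hW u hu⟩

theorem level_congr {V V' : Space d → ℝ} (h : V =ᵐ[volume] V') (j : ℕ) :
    level V j = level V' j := by
  have : ∀ u : L2 d, energy V u = energy V' u := fun u => by
    rw [energy, energy]
    congr 1
    exact integral_congr_ae (h.mono fun x hx => by simp only [hx])
  simp only [level, this]

theorem energy_le_energy_zero {V : Space d → ℝ} (hV : 0 ≤ᵐ[volume] V) (u : L2 d) :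
    energy V u ≤ energy 0 u := by
  have : 0 ≤ ∫ x, V x * ‖u x‖ ^ 2 := integral_nonneg_of_ae (hV.mono fun x hx =>
    mul_nonneg hx (by positivity))
  simp only [energy, Pi.zero_apply, zero_mul, integral_zero]
  linarith

/-! ### Smooth functions -/

theorem isWeakGradient_smooth {f : Space d → ℝ} (hf : ContDiff ℝ ∞ f) :
    IsWeakGradient (fun x => (f x : ℂ))
      (fun x => WithLp.toLp 2 fun i => ((fderiv ℝ f x (EuclideanSpace.single i 1) : ℝ) : ℂ)) := by
  intro φ hφ hc i
  have hd := hφ.differentiable (by simp)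
  have hdf := hf.differentiable (by simp)
  have h1 : Continuous fun x => fderiv ℝ φ x (EuclideanSpace.single i 1) :=
    continuous_partialDeriv hφ _
  have h2 : Continuous fun x => fderiv ℝ f x (EuclideanSpace.single i 1) :=
    continuous_partialDeriv hf _
  have hc1 := hasCompactSupport_partialDeriv hc (EuclideanSpace.single i 1)
  have h := integral_mul_fderiv_eq_neg_fderiv_mul_of_integrable (μ := volume)
    (f := φ) (g := f) (v := EuclideanSpace.single i (1 : ℝ))
    ((h1.mul hf.continuous).integrable_of_hasCompactSupport hc1.mul_right)
    ((hφ.continuous.mul h2).integrable_of_hasCompactSupport hc.mul_right)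
    ((hφ.continuous.mul hf.continuous).integrable_of_hasCompactSupport hc.mul_right) 
    (fun x _ => hd x) (fun x _ => hdf x)
  have e1 : ∀ x, (fderiv ℝ φ x (EuclideanSpace.single i 1)) • (f x : ℂ)
      = ((fderiv ℝ φ x (EuclideanSpace.single i 1) * f x : ℝ) : ℂ) := fun x => by
    rw [Complex.real_smul, Complex.ofReal_mul]
  have e2 : ∀ x, φ x • ((fderiv ℝ f x (EuclideanSpace.single i 1) : ℝ) : ℂ)
      = ((φ x * fderiv ℝ f x (EuclideanSpace.single i 1) : ℝ) : ℂ) := fun x => by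
    rw [Complex.real_smul, Complex.ofReal_mul]
  simp_rw [e1, e2, integral_complex_ofReal]
  rw [h]
  simp

theorem memH1_smooth {f : Space d → ℝ} (hf : ContDiff ℝ ∞ f) (hc : HasCompactSupport f)
    (hL : MemLp (fun x => (f x : ℂ)) 2 volume) : MemH1 hL.toLp := by
  refine ⟨_, ?_, (isWeakGradient_smooth hf).congr hL.coeFn_toLp.symm .rfl⟩
  have hcont : Continuous fun x : Space d =>
      (WithLp.toLp 2 fun i => ((fderiv ℝ f x (EuclideanSpace.single i 1) : ℝ) : ℂ) :
        EuclideanSpace ℂ (Fin d)) :=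
    (PiLp.continuous_toLp 2 _).comp (continuous_pi fun i =>
      Complex.continuous_ofReal.comp (continuous_partialDeriv hf _))
  refine hcont.memLp_of_hasCompactSupport ((hc.fderiv ℝ).mono' ?_)
  refine fun x hx => ?_
  refine subset_tsupport _ fun h => hx ?_
  simp only [h]
  ext i
  simp

/-- Bumps of radius 2 centred 4 apart on a line have disjoint supports, hence are orthogonal. Trial
spaces of every dimension exist, so no level is an infimum over the empty family. -/
theorem exists_submodule_H1 (hd : 1 ≤ d) (j : ℕ) :
    ∃ W : Submodule ℂ (H1 d), Module.finrank ℂ W = j := by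
  set e : Space d := EuclideanSpace.single ⟨0, hd⟩ 1 with he
  let c : Fin j → Space d := fun i => (4 * (i : ℝ)) • e
  let B : ∀ i : Fin j, ContDiffBump (c i) := fun _ => ⟨1, 2, by norm_num, by norm_num⟩
  have hB : ∀ i, ContDiff ℝ ∞ (B i) := fun i => (B i).contDiff
  have hL : ∀ i, MemLp (fun x => ((B i x : ℝ) : ℂ)) 2 volume := fun i => by
    refine (Complex.continuous_ofReal.comp (B i).continuous).memLp_of_hasCompactSupport ?_
    exact (B i).hasCompactSupport.comp_left (g := ((↑) : ℝ → ℂ)) (by simp)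
  let v : Fin j → H1 d := fun i => ⟨(hL i).toLp, memH1_smooth (hB i) (B i).hasCompactSupport (hL i)⟩
  have hli : LinearIndependent ℂ v := by
    refine linearIndependent_of_ne_zero_of_inner_eq_zero (𝕜 := ℂ) (fun i h0 => ?_) fun i k hik => ?_
    · have h1 : (hL i).toLp = 0 := congrArg Subtype.val h0
      have h2 : (fun x => ((B i x : ℝ) : ℂ)) =ᵐ[volume] 0 :=
        (hL i).coeFn_toLp.symm.trans (h1 ▸ Lp.coeFn_zero _ _ _)
      have h3 : (fun x => ((B i x : ℝ) : ℂ)) = 0 :=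
        (Complex.continuous_ofReal.comp (B i).continuous).ae_eq_iff_eq volume continuous_zero |>.1 h2
      have h4 := congrFun h3 (c i)
      have h5 : B i (c i) = 1 := (B i).one_of_mem_closedBall
        (by simpa using (B i).rIn_pos.le)
      simp [h5] at h4
    · change inner ℂ ((hL i).toLp) ((hL k).toLp) = 0
      rw [L2.inner_def]
      refine integral_eq_zero_of_ae ?_
      filter_upwards [(hL i).coeFn_toLp, (hL k).coeFn_toLp] with x hx hx'
      rw [hx, hx', Pi.zero_apply]
      have hz : B i x = 0 ∨ B k x = 0 := by
        by_contra! hcon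
        have h1 : x ∈ Metric.ball (c i) 2 := by
          have : x ∈ Function.support (B i) := hcon.1
          rwa [(B i).support_eq] at this
        have h2 : x ∈ Metric.ball (c k) 2 := by
          have : x ∈ Function.support (B k) := hcon.2
          rwa [(B k).support_eq] at this
        have h3 : dist (c i) (c k) < 4 := by
          calc dist (c i) (c k) ≤ dist x (c i) + dist x (c k) := dist_triangle_left _ _ _
            _ < 2 + 2 := add_lt_add h1 h2
            _ = 4 := by norm_num
        have h4 : dist (c i) (c k) = 4 * |(i : ℝ) - k| := by
          rw [dist_eq_norm, ← sub_smul, ← mul_sub, norm_smul, he]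
          simp
        have h5 : (1 : ℝ) ≤ |(i : ℝ) - k| := by
          have : (1 : ℤ) ≤ |(i : ℤ) - k| := Int.one_le_abs (sub_ne_zero.2 fun h => hik
            (Fin.ext (by exact_mod_cast h)))
          exact_mod_cast this
        linarith
      rcases hz with h | h <;> simp [h]
  refine ⟨Submodule.span ℂ (Set.range v), ?_⟩
  rw [finrank_span_eq_card hli, Fintype.card_fin]

theorem _root_.LinearMap.exists_norm_le_of_finiteDimensional {X F : Type*} [NormedAddCommGroup X]
    [NormedSpace ℂ X] [NormedAddCommGroup F] [NormedSpace ℂ F] (W : Submodule ℂ X)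
    [FiniteDimensional ℂ W] (f : X →ₗ[ℂ] F) : ∃ C, ∀ x ∈ W, ‖f x‖ ≤ C * ‖x‖ :=
  ⟨_, fun x hx => (LinearMap.toContinuousLinearMap (f.comp W.subtype)).le_opNorm ⟨x, hx⟩⟩

theorem exists_level_zero_le (hd : 1 ≤ d) {j : ℕ} (hj : 1 ≤ j) :
    ∃ s : ℝ, level (0 : Space d → ℝ) j ≤ s := by
  obtain ⟨W, hW⟩ := exists_submodule_H1 hd j
  have : FiniteDimensional ℂ W := Module.finite_of_finrank_pos (by omega)
  obtain ⟨C, hC⟩ := LinearMap.exists_norm_le_of_finiteDimensional W grad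
  refine ⟨C ^ 2, level_le_of_submodule W hW fun u hu => ?_⟩
  have h1 : ‖grad u‖ ≤ C * ‖u‖ := hC u hu
  rw [energy_eq]
  simp only [Pi.zero_apply, zero_mul, integral_zero, sub_zero]
  rw [← mul_pow]
  exact pow_le_pow_left₀ (norm_nonneg _) h1 2

/-! ### Dilations and translations -/

/-- The affine map `x ↦ t x + a`. -/
def affine (t : ℝ) (a x : Space d) : Space d := t • x + a

theorem integral_comp_affine {F : Type*} [NormedAddCommGroup F] [NormedSpace ℝ F] {t : ℝ}
    (ht : 0 < t) (a : Space d) (f : Space d → F) :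
    ∫ x, f (affine t a x) = (t ^ d)⁻¹ • ∫ x, f x := by
  have h := Measure.integral_comp_smul volume (fun x : Space d => f (x + a)) t
  rw [integral_add_right_eq_self, finrank_euclideanSpace_fin, abs_of_pos (by positivity)] at h
  exact h

theorem map_affine {t : ℝ} (ht : 0 < t) (a : Space d) :
    Measure.map (affine t a) (volume : Measure (Space d)) = ENNReal.ofReal (t ^ d)⁻¹ • volume := by
  have h1 := Measure.map_addHaar_smul (volume : Measure (Space d)) ht.ne'
  rw [finrank_euclideanSpace_fin, abs_of_pos (by positivity)] at h1
  have h2 : (affine t a : Space d → Space d) = (fun x => x + a) ∘ (fun x => t • x) := rfl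
  rw [h2, ← Measure.map_map (measurable_add_const a) (measurable_const_smul t), h1,
    Measure.map_smul, map_add_right_eq_self]

theorem measurableEmbedding_affine {t : ℝ} (ht : 0 < t) (a : Space d) :
    MeasurableEmbedding (affine t a : Space d → Space d) :=
  (measurableEmbedding_addRight a).comp (measurableEmbedding_const_smul₀ ht.ne')

theorem lintegral_comp_affine {t : ℝ} (ht : 0 < t) (a : Space d) (f : Space d → ℝ≥0∞) :
    ∫⁻ x, f (affine t a x) = ENNReal.ofReal (t ^ d)⁻¹ * ∫⁻ x, f x := by
  rw [← (measurableEmbedding_affine ht a).lintegral_map, map_affine ht, lintegral_smul_measure,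
    smul_eq_mul]

theorem memLp_comp_affine {F : Type*} [NormedAddCommGroup F] {t : ℝ} (ht : 0 < t) (a : Space d)
    {q : ℝ≥0∞} {f : Space d → F} (hf : MemLp f q volume) :
    MemLp (fun x => f (affine t a x)) q volume := by
  have := (measurableEmbedding_affine ht a).memLp_map_measure_iff (g := f) (p := q) (μ := volume)
  rw [map_affine ht] at this
  exact this.1 (hf.smul_measure ENNReal.ofReal_ne_top)

theorem ae_comp_affine {t : ℝ} (ht : 0 < t) (a : Space d) {P : Space d → Prop}
    (h : ∀ᵐ x, P x) : ∀ᵐ x, P (affine t a x) := by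
  have h1 : ∀ᵐ x ∂(Measure.map (affine t a) (volume : Measure (Space d))), P x := by
    rw [map_affine ht]
    exact Measure.smul_absolutelyContinuous.ae_le h
  exact (measurableEmbedding_affine ht a).ae_map_iff.1 h1

/-- Composition with an affine map, on `L²(ℝ^d)`. -/
def compAffine {t : ℝ} (ht : 0 < t) (a : Space d) : L2 d →ₗ[ℂ] L2 d where
  toFun u := (memLp_comp_affine ht a (Lp.memLp u)).toLp
  map_add' u v := by
    rw [← MemLp.toLp_add, MemLp.toLp_eq_toLp_iff]
    exact ae_comp_affine ht a (Lp.coeFn_add u v)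
  map_smul' c u := by
    rw [RingHom.id_apply, ← MemLp.toLp_const_smul, MemLp.toLp_eq_toLp_iff]
    exact ae_comp_affine ht a (Lp.coeFn_smul c u)

theorem coeFn_compAffine {t : ℝ} (ht : 0 < t) (a : Space d) (u : L2 d) :
    compAffine ht a u =ᵐ[volume] fun x => u (affine t a x) :=
  (memLp_comp_affine ht a (Lp.memLp u)).coeFn_toLp

theorem IsWeakGradient.comp_affine {u : Space d → ℂ} {g : Space d → EuclideanSpace ℂ (Fin d)}
    (H : IsWeakGradient u g) {t : ℝ} (ht : 0 < t) (a : Space d) :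
    IsWeakGradient (fun x => u (affine t a x)) (fun x => (t : ℂ) • g (affine t a x)) := by
  intro φ hφ hc i
  set e : Space d := EuclideanSpace.single i 1
  set ψ : Space d → ℝ := fun y => φ (t⁻¹ • (y - a)) with hψ
  have hinv : ∀ x, t⁻¹ • (affine t a x - a) = x := fun x => by
    rw [affine, add_sub_cancel_right, smul_smul, inv_mul_cancel₀ ht.ne', one_smul]
  have hψs : ContDiff ℝ ∞ ψ := hφ.comp (by fun_prop)
  have hψc : HasCompactSupport ψ := by
    have := hc.comp_homeomorph ((Homeomorph.addRight (-a)).trans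
      (Homeomorph.smulOfNeZero t⁻¹ (inv_ne_zero ht.ne')))
    have e : ψ = φ ∘ ((Homeomorph.addRight (-a)).trans
      (Homeomorph.smulOfNeZero t⁻¹ (inv_ne_zero ht.ne'))) := by
      ext y; simp [hψ, sub_eq_add_neg]
    rwa [e]
  have hder : ∀ x, fderiv ℝ ψ (affine t a x) e = t⁻¹ * fderiv ℝ φ x e := by
    intro x
    have h1 : HasFDerivAt (fun y : Space d => t⁻¹ • (y - a)) (t⁻¹ • ContinuousLinearMap.id ℝ _)
        (affine t a x) := ((hasFDerivAt_id _).sub_const a).const_smul t⁻¹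
    have h2 : HasFDerivAt φ (fderiv ℝ φ x) (t⁻¹ • (affine t a x - a)) := by
      rw [hinv]
      exact ((hφ.differentiable (by simp)) x).hasFDerivAt
    have h3 : HasFDerivAt ψ _ (affine t a x) := h2.comp (affine t a x) h1
    rw [h3.fderiv]
    simp
  have h := H ψ hψs hψc i
  have e1 : ∀ x, (fderiv ℝ φ x e) • u (affine t a x)
      = t • ((fderiv ℝ ψ (affine t a x) e) • u (affine t a x)) := fun x => by
    rw [hder, smul_smul, ← mul_assoc, mul_inv_cancel₀ ht.ne', one_mul]
  have e2 : ∀ x, φ x • ((t : ℂ) • g (affine t a x)) i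
      = t • (ψ (affine t a x) • g (affine t a x) i) := fun x => by
    simp only [hψ, hinv, PiLp.smul_apply, Complex.coe_smul]
    exact smul_comm _ _ _
  simp_rw [e1, e2, integral_smul]
  rw [integral_comp_affine ht a fun y => (fderiv ℝ ψ y e) • u y,
    integral_comp_affine ht a fun y => ψ y • g y i, h]
  simp

/-- Composition with an affine map, on `H¹(ℝ^d)`. -/
def compAffineH1 {t : ℝ} (ht : 0 < t) (a : Space d) : H1 d →ₗ[ℂ] H1 d :=
  ((compAffine ht a).comp (H1 d).subtype).codRestrict (H1 d) fun u =>
    ⟨_, (memLp_comp_affine ht a (Lp.memLp (grad u))).const_smul (t : ℂ),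
      ((isWeakGradient_grad u).comp_affine ht a).congr (coeFn_compAffine ht a u).symm .rfl⟩

theorem norm_sq_compAffineH1 {t : ℝ} (ht : 0 < t) (a : Space d) (u : H1 d) :
    ‖compAffineH1 ht a u‖ ^ 2 = (t ^ d)⁻¹ * ‖u‖ ^ 2 := by
  change ‖compAffine ht a (u : L2 d)‖ ^ 2 = (t ^ d)⁻¹ * ‖(u : L2 d)‖ ^ 2
  rw [Lp.norm_sq_eq_integral, Lp.norm_sq_eq_integral, ← smul_eq_mul,
    ← integral_comp_affine ht a fun x => ‖(u : L2 d) x‖ ^ 2]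
  exact integral_congr_ae ((coeFn_compAffine ht a u).mono fun x hx => by simp only [hx])

/-- The potential `t² V(t x + a)`. -/
def rescale (t : ℝ) (a : Space d) (V : Space d → ℝ) (x : Space d) : ℝ :=
  t ^ 2 * V (affine t a x)

theorem energy_compAffineH1 {t : ℝ} (ht : 0 < t) (a : Space d) (V : Space d → ℝ) (u : H1 d) :
    energy (rescale t a V) (compAffineH1 ht a u : L2 d)
      = (t ^ d)⁻¹ * (t ^ 2 * energy V (u : L2 d)) := by
  have hg := (memLp_comp_affine ht a (Lp.memLp (grad u))).const_smul (t : ℂ)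
  have hw : IsWeakGradient (compAffineH1 ht a u : L2 d) (fun x => (t : ℂ) • grad u (affine t a x)) :=
    ((isWeakGradient_grad u).comp_affine ht a).congr (coeFn_compAffine ht a u).symm .rfl
  rw [energy_eq, energy_eq, grad_eq_toLp hg hw, Lp.norm_sq_eq_integral, Lp.norm_sq_eq_integral,
    mul_sub, mul_sub]
  congr 1
  · rw [← integral_const_mul, ← smul_eq_mul,
      ← integral_comp_affine ht a fun x => t ^ 2 * ‖grad u x‖ ^ 2]
    refine integral_congr_ae (hg.coeFn_toLp.mono fun x hx => ?_)
    simp only [hx, Pi.smul_apply]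
    rw [norm_smul, mul_pow]
    simp
  · rw [← integral_const_mul, ← smul_eq_mul,
      ← integral_comp_affine ht a fun x => t ^ 2 * (V x * ‖(u : L2 d) x‖ ^ 2)]
    refine integral_congr_ae ((coeFn_compAffine ht a u).mono fun x hx => ?_)
    change rescale t a V x * ‖compAffine ht a (u : L2 d) x‖ ^ 2 = _
    rw [hx, rescale, mul_assoc]

theorem injective_compAffineH1 {t : ℝ} (ht : 0 < t) (a : Space d) :
    Function.Injective (compAffineH1 ht a) := by
  rw [← LinearMap.ker_eq_bot, LinearMap.ker_eq_bot']
  intro u hu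
  have h := norm_sq_compAffineH1 ht a u
  rw [hu, norm_zero] at h
  have h2 : (t ^ d)⁻¹ ≠ 0 := by positivity
  have h3 : ‖u‖ ^ 2 = 0 := by
    have := h.symm
    rw [zero_pow two_ne_zero] at this
    exact (mul_eq_zero.1 this).resolve_left h2
  exact norm_eq_zero.1 (pow_eq_zero_iff two_ne_zero |>.1 h3)

theorem level_rescale_le_of_lt {t : ℝ} (ht : 0 < t) (a : Space d) {V : Space d → ℝ} {j : ℕ} {s : ℝ}
    (h : level V j < s) : level (rescale t a V) j ≤ ((t ^ 2 * s : ℝ) : EReal) := by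
  obtain ⟨W, hW, hs⟩ := exists_submodule_of_level_lt h
  refine level_le_of_submodule (W.map (compAffineH1 ht a)) ?_ ?_
  · rw [← hW]
    exact (Submodule.equivMapOfInjective _ (injective_compAffineH1 ht a) W).finrank_eq.symm
  · rintro _ ⟨u, hu, rfl⟩
    by_cases h0 : u = 0
    · subst h0
      rw [map_zero, energy_eq]
      have : (∫ x, rescale t a V x * ‖((0 : H1 d) : L2 d) x‖ ^ 2) = 0 := by
        refine integral_eq_zero_of_ae ((Lp.coeFn_zero ℂ 2 volume).mono fun x hx => ?_)
        simp only [Submodule.coe_zero, hx]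
        simp
      rw [this]
      simp
    · rw [energy_compAffineH1, norm_sq_compAffineH1]
      have h1 := (hs u hu h0).le
      have h2 : 0 < (t ^ d)⁻¹ := by positivity
      calc (t ^ d)⁻¹ * (t ^ 2 * energy V (u : L2 d)) ≤ (t ^ d)⁻¹ * (t ^ 2 * (s * ‖u‖ ^ 2)) := by
            gcongr
        _ = _ := by ring

/-- Trial spaces are transported by composition with the affine map. This one direction suffices,
since only a non-decrease of the quotient under rescaling is used. -/
theorem level_rescale_le {t : ℝ} (ht : 0 < t) (a : Space d) (V : Space d → ℝ) (j : ℕ) :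
    level (rescale t a V) j ≤ ((t ^ 2 : ℝ) : EReal) * level V j := by
  have ht2 : 0 < t ^ 2 := by positivity
  generalize h : level V j = L
  induction L with
  | bot =>
    refine (EReal.le_of_forall_lt_iff_le.1 fun z _ => ?_ : level (rescale t a V) j ≤ ⊥).trans bot_le
    have h1 : level V j < ((z / t ^ 2 : ℝ) : EReal) := h ▸ EReal.bot_lt_coe _
    have := level_rescale_le_of_lt ht a h1
    rwa [mul_div_cancel₀ _ ht2.ne'] at this
  | coe s =>
    refine EReal.le_of_forall_lt_iff_le.1 fun z hz => ?_
    have hz' : t ^ 2 * s < z := by exact_mod_cast hz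
    have h1 : level V j < ((z / t ^ 2 : ℝ) : EReal) := by
      rw [h]
      have : s < z / t ^ 2 := by rw [lt_div_iff₀ ht2]; linarith
      exact_mod_cast this
    have := level_rescale_le_of_lt ht a h1
    rwa [mul_div_cancel₀ _ ht2.ne'] at this
  | top => exact le_top.trans_eq (EReal.coe_mul_top_of_pos ht2).symm

/-- The zero potential is fixed by rescaling, so a finite upper bound s on its level improves to t²
s for every t > 0. -/
theorem level_zero_nonpos (hd : 1 ≤ d) {j : ℕ} (hj : 1 ≤ j) : level (0 : Space d → ℝ) j ≤ 0 := by
  obtain ⟨s, hs⟩ := exists_level_zero_le (d := d) hd hj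
  refine EReal.le_of_forall_lt_iff_le.1 fun z hz => ?_
  have hz' : 0 < z := by exact_mod_cast hz
  set s' := max s 0 + 1 with hs'
  have hs'0 : 0 < s' := by positivity
  have h1 : level (0 : Space d → ℝ) j < (s' : EReal) := by
    refine hs.trans_lt ?_
    have : s < s' := (le_max_left s 0).trans_lt (lt_add_one _)
    exact_mod_cast this
  have hpos : 0 < Real.sqrt (z / s') := Real.sqrt_pos.2 (by positivity)
  have h2 := level_rescale_le_of_lt hpos 0 h1
  rw [Real.sq_sqrt (by positivity), div_mul_cancel₀ _ hs'0.ne'] at h2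
  have e : rescale (Real.sqrt (z / s')) 0 (0 : Space d → ℝ) = 0 := by
    ext x; simp [rescale]
  rwa [e] at h2

theorem level_nonpos (hd : 1 ≤ d) {j : ℕ} (hj : 1 ≤ j) {V : Space d → ℝ} (hV : 0 ≤ᵐ[volume] V) :
    level V j ≤ 0 := by
  have h0 : ∀ u : H1 d, energy V (u : L2 d) ≤ energy (0 : Space d → ℝ) (u : L2 d) := fun u =>
    energy_le_energy_zero (V := V) hV (u : L2 d)
  have h : level V j ≤ level (0 : Space d → ℝ) j := level_mono h0 j
  exact h.trans (level_zero_nonpos hd hj)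

theorem _root_.EReal.abs_le_abs_of_nonpos {x y : EReal} (hxy : x ≤ y) (hy : y ≤ 0) :
    y.abs ≤ x.abs := by
  induction x with
  | bot => simp
  | top => exact absurd (hxy.trans hy) (by simp)
  | coe x =>
    induction y with
    | bot => simp at hxy
    | top => simp at hy
    | coe y =>
      rw [EReal.abs_def, EReal.abs_def]
      have h1 : x ≤ y := by exact_mod_cast hxy
      have h2 : y ≤ 0 := by exact_mod_cast hy
      refine ENNReal.ofReal_le_ofReal ?_
      rw [abs_of_nonpos h2, abs_of_nonpos (h1.trans h2)]
      linarith

/-- The exponent is 2(γ + d/2) - d = 2γ, which matches the factor gained by |λ_j|^γ. -/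
theorem lintegral_rescale {γ : ℝ} (hγ : 0 < γ) (V : Space d → ℝ) {t : ℝ} (ht : 0 < t)
    (a : Space d) : ∫⁻ x, ENNReal.ofReal (rescale t a V x) ^ (γ + d / 2)
      = ENNReal.ofReal t ^ (2 * γ) * ∫⁻ x, ENNReal.ofReal (V x) ^ (γ + d / 2) := by
  have hp : 0 ≤ γ + d / 2 := by positivity
  have e : ∀ x, ENNReal.ofReal (rescale t a V x) ^ (γ + d / 2)
      = ENNReal.ofReal (t ^ 2) ^ (γ + d / 2) * ENNReal.ofReal (V (affine t a x)) ^ (γ + d / 2) := by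
    intro x
    rw [rescale, ENNReal.ofReal_mul (by positivity), ENNReal.mul_rpow_of_nonneg _ _ hp]
  simp_rw [e]
  rw [lintegral_const_mul' _ _ (by
      exact ENNReal.rpow_ne_top_of_nonneg hp ENNReal.ofReal_ne_top),
    lintegral_comp_affine ht a fun x => ENNReal.ofReal (V x) ^ (γ + d / 2), ← mul_assoc]
  congr 1
  rw [ENNReal.ofReal_rpow_of_pos (by positivity), ENNReal.ofReal_rpow_of_pos ht,
    ← ENNReal.ofReal_mul (by positivity)]
  congr 1
  rw [← Real.rpow_natCast t 2, ← Real.rpow_natCast t d, ← Real.rpow_neg ht.le, ← Real.rpow_mul ht.le,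
    ← Real.rpow_add ht]
  congr 1
  push_cast
  ring

theorem quotient_le_quotient_rescale (hd : 1 ≤ d) {γ : ℝ} (hγ : 0 < γ) (N : ℕ) {V : Space d → ℝ}
    (hV : 0 ≤ᵐ[volume] V) {t : ℝ} (ht : 0 < t) (a : Space d) :
    quotient d γ N V ≤ quotient d γ N (rescale t a V) := by
  have hV' : 0 ≤ᵐ[volume] rescale t a V :=
    (ae_comp_affine ht a hV).mono fun x hx => mul_nonneg (by positivity) hx
  rw [quotient, quotient, lintegral_rescale hγ V ht a]
  have htp : ENNReal.ofReal t ≠ 0 := by simpa using ht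
  have h0 : ENNReal.ofReal t ^ (2 * γ) ≠ 0 := by
    simp [ht]
  have h1 : ENNReal.ofReal t ^ (2 * γ) ≠ ⊤ :=
    ENNReal.rpow_ne_top_of_nonneg (by positivity) ENNReal.ofReal_ne_top
  rw [← ENNReal.mul_div_mul_left _ _ h0 h1]
  gcongr
  rw [Finset.mul_sum]
  refine Finset.sum_le_sum fun j hj => ?_
  have hj1 := (Finset.mem_Icc.1 hj).1
  rw [ENNReal.rpow_mul, ← ENNReal.mul_rpow_of_nonneg _ _ hγ.le]
  gcongr
  have h2 := EReal.abs_le_abs_of_nonpos (level_rescale_le ht a V j) ?_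
  · rw [EReal.abs_mul, EReal.abs_def, abs_of_pos (by positivity), ENNReal.ofReal_pow ht.le] at h2
    simpa using h2
  · have h3 : (0 : EReal) ≤ ((t ^ 2 : ℝ) : EReal) := by
      have : 0 ≤ t ^ 2 := by positivity
      exact_mod_cast this
    have h4 := mul_le_mul_of_nonneg_left (level_nonpos hd hj1 hV) h3
    rwa [mul_zero] at h4

/-! ### Potentials in the unit ball of `L^p` -/

/-- Measurable nonnegative potentials in the unit ball of `L^p`. -/
structure IsNormalized (p : ℝ) (V : Space d → ℝ) : Prop where
  measurable : Measurable V
  nonneg : ∀ x, 0 ≤ V x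
  le_one : ∫⁻ x, ENNReal.ofReal (V x) ^ p ≤ 1

/-- The measure `V dx`. -/
def potMeasure (V : Space d → ℝ) : Measure (Space d) :=
  volume.withDensity fun x => ENNReal.ofReal (V x)

/-- The norm `(∫ V |u|²)^(1/2)`. -/
def potNorm (V : Space d → ℝ) (u : Space d → ℂ) : ℝ := (eLpNorm u 2 (potMeasure V)).toReal

theorem potNorm_nonneg (V : Space d → ℝ) (u : Space d → ℂ) : 0 ≤ potNorm V u :=
  ENNReal.toReal_nonneg

theorem sq_potNorm {V : Space d → ℝ} (hV : Measurable V) (hV0 : ∀ x, 0 ≤ V x) {u : Space d → ℂ}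
    (hu : AEStronglyMeasurable u volume) : potNorm V u ^ 2 = ∫ x, V x * ‖u x‖ ^ 2 := by
  have hm : AEStronglyMeasurable (fun x => V x * ‖u x‖ ^ 2) volume :=
    hV.aestronglyMeasurable.mul (hu.norm.pow 2)
  rw [potNorm, ← ENNReal.toReal_pow, sq_eLpNorm_two, potMeasure,
    lintegral_withDensity_eq_lintegral_mul₀ hV.ennreal_ofReal.aemeasurable (hu.enorm.pow_const 2),
    integral_eq_lintegral_of_nonneg_ae (.of_forall fun x => mul_nonneg (hV0 x) (by positivity)) hm]
  congr 1
  refine lintegral_congr fun x => ?_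
  rw [Pi.mul_apply, ENNReal.ofReal_mul (hV0 x), ENNReal.ofReal_pow (norm_nonneg _), ofReal_norm]

theorem energy_eq_sub_sq {V : Space d → ℝ} (hV : Measurable V) (hV0 : ∀ x, 0 ≤ V x) (u : H1 d) :
    energy V (u : L2 d) = ‖grad u‖ ^ 2 - potNorm V (u : L2 d) ^ 2 := by
  rw [energy_eq, sq_potNorm hV hV0 (Lp.aestronglyMeasurable _)]

variable {p : ℝ}

theorem IsNormalized.isSubcritical (hp : 1 < p) {V : Space d → ℝ} (hV : IsNormalized p V) :
    IsSubcritical (d / (2 * p)) (potMeasure V) :=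
  isSubcritical_withDensity hp hV.measurable.ennreal_ofReal.aemeasurable hV.le_one

theorem theta_lt_one (hp : 1 < p) (hdp : d < 2 * p) : (d : ℝ) / (2 * p) < 1 := by
  rw [div_lt_one (by linarith)]; exact hdp

/-- The mass bound A stays explicit, so the estimate serves both the uniform form bound (A from
normalization) and the nonvanishing argument (A small). -/
theorem exists_potNorm_le_cube (hp : 1 < p) (hdp : d < 2 * p) {ε : ℝ} (hε : 0 < ε) :
    ∃ k : ℕ, ∀ V : Space d → ℝ, IsNormalized p V → ∀ A : ℝ, 0 ≤ A →
      (∀ z : Fin d → ℤ, potMeasure V (cube k z) ≤ ENNReal.ofReal (A ^ 2)) → ∀ u : H1 d,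
      eLpNorm (u : L2 d) 2 (potMeasure V) ≠ ⊤ ∧
        potNorm V (u : L2 d) ≤ 2 ^ (k * d) * A * ‖u‖ + ε * ‖grad u‖ := by
  obtain ⟨k, hk⟩ := exists_eLpNorm_le d (theta_lt_one hp hdp) (ε := ENNReal.ofReal ε) (by simpa)
  refine ⟨k, fun V hV A hA hz u => ?_⟩
  have h1 := hk _ (hV.isSubcritical hp) (ENNReal.ofReal A)
    (fun z => (hz z).trans_eq (ENNReal.ofReal_pow hA 2)) u
  have e : (2 : ℝ≥0∞) ^ (k * d) * ENNReal.ofReal A * ‖u‖ₑ + ENNReal.ofReal ε * ‖grad u‖ₑ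
      = ENNReal.ofReal (2 ^ (k * d) * A * ‖u‖ + ε * ‖grad u‖) := by
    rw [ENNReal.ofReal_add (by positivity) (by positivity), ENNReal.ofReal_mul (by positivity),
      ENNReal.ofReal_mul (by positivity), ENNReal.ofReal_mul (by positivity),
      ENNReal.ofReal_pow (by norm_num), ofReal_norm, ofReal_norm]
    simp
  rw [e] at h1
  exact ⟨ne_top_of_le_ne_top ENNReal.ofReal_ne_top h1,
    ENNReal.toReal_le_of_le_ofReal (by positivity) h1⟩

/-- Subcriticality bounds every cube mass at scale k by 2^(2θk), so the cube estimate applies to all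
normalized potentials. -/
theorem exists_potNorm_le (hp : 1 < p) (hdp : d < 2 * p) {ε : ℝ} (hε : 0 < ε) :
    ∃ C : ℝ, 0 < C ∧ ∀ V : Space d → ℝ, IsNormalized p V → ∀ u : H1 d,
      eLpNorm (u : L2 d) 2 (potMeasure V) ≠ ⊤ ∧
        potNorm V (u : L2 d) ≤ C * ‖u‖ + ε * ‖grad u‖ := by
  obtain ⟨k, hk⟩ := exists_potNorm_le_cube (d := d) hp hdp hε
  refine ⟨2 ^ (k * d) * 2 ^ ((d : ℝ) / (2 * p) * k), by positivity, fun V hV =>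
    hk V hV _ (by positivity) fun z => ((hV.isSubcritical hp).le k z).trans ?_⟩
  rw [ENNReal.ofReal_pow (by positivity), ← ENNReal.ofReal_rpow_of_pos (by norm_num), volume_cube]
  refine (mul_le_mul_right (ENNReal.inv_le_one.2 (one_le_pow₀ (by norm_num))) _).trans_eq ?_
  simp

/-- Uniform form bounds for normalized potentials. -/
theorem exists_form_bound (hp : 1 < p) (hdp : d < 2 * p) :
    ∃ C : ℝ, 0 < C ∧ ∀ V : Space d → ℝ, IsNormalized p V → ∀ u : H1 d,
      eLpNorm (u : L2 d) 2 (potMeasure V) ≠ ⊤ ∧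
      potNorm V (u : L2 d) ≤ C * (‖u‖ + ‖grad u‖) ∧ -C * ‖u‖ ^ 2 ≤ energy V (u : L2 d) ∧
      (energy V (u : L2 d) < 0 → ‖grad u‖ ≤ C * ‖u‖) := by
  -- After squaring, ε = 1/2 puts only half of ‖∇u‖² into the potential term. The remaining half
  -- bounds the form below and controls the gradient when the energy is negative.
  obtain ⟨C, hC, h⟩ := exists_potNorm_le (d := d) hp hdp (ε := 1 / 2) (by norm_num)
  refine ⟨2 * C ^ 2 + 2 * C + 1, by positivity, fun V hV u => ?_⟩
  obtain ⟨h1, h2⟩ := h V hV u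
  have hu := norm_nonneg u
  have hg := norm_nonneg (grad u)
  have hP := potNorm_nonneg V (u : L2 d)
  have h3 : potNorm V (u : L2 d) ^ 2 ≤ 2 * C ^ 2 * ‖u‖ ^ 2 + 1 / 2 * ‖grad u‖ ^ 2 := by
    calc potNorm V (u : L2 d) ^ 2 ≤ (C * ‖u‖ + 1 / 2 * ‖grad u‖) ^ 2 := by gcongr
      _ ≤ _ := by nlinarith [sq_nonneg (C * ‖u‖ - 1 / 2 * ‖grad u‖)]
  have h4 := energy_eq_sub_sq hV.measurable hV.nonneg u
  refine ⟨h1, ?_, ?_, fun hneg => ?_⟩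
  · nlinarith [mul_nonneg (sq_nonneg C) hu, mul_nonneg hC.le hu, mul_nonneg hC.le hg,
      mul_nonneg (sq_nonneg C) hg]
  · rw [h4]
    nlinarith [sq_nonneg ‖grad u‖, mul_nonneg hC.le (sq_nonneg ‖u‖), sq_nonneg ‖u‖]
  · have h5 : ‖grad u‖ ^ 2 ≤ (2 * C * ‖u‖) ^ 2 := by nlinarith
    have h6 : ‖grad u‖ ≤ 2 * C * ‖u‖ := (sq_le_sq₀ hg (by positivity)).1 h5
    nlinarith [mul_nonneg (sq_nonneg C) hu]

theorem exists_ne_zero_of_finrank {j : ℕ} (hj : 1 ≤ j) {W : Submodule ℂ (H1 d)}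
    (hW : Module.finrank ℂ W = j) : ∃ u ∈ W, u ≠ 0 := by
  have : W ≠ ⊥ := by
    rintro rfl
    rw [finrank_bot] at hW
    omega
  exact W.exists_mem_ne_zero_of_ne_bot this

theorem le_level_of_forall {V : Space d → ℝ} {j : ℕ} (hj : 1 ≤ j) {s : ℝ}
    (h : ∀ u : H1 d, s * ‖u‖ ^ 2 ≤ energy V (u : L2 d)) : (s : EReal) ≤ level V j := by
  by_contra! hlt
  obtain ⟨W, hW, hs⟩ := exists_submodule_of_level_lt hlt
  obtain ⟨u, hu, hu0⟩ := exists_ne_zero_of_finrank hj hW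
  exact (hs u hu hu0).not_ge (h u)

/-- Potentials with a deep level have a cube of substantial mass. -/
theorem exists_cube_of_level_lt (hp : 1 < p) (hdp : d < 2 * p) {c : ℝ} (hc : 0 < c) :
    ∃ (k : ℕ) (m : ℝ), 0 < m ∧ ∀ V : Space d → ℝ, IsNormalized p V → ∀ j, 1 ≤ j →
      level V j < ((-c : ℝ) : EReal) →
      ∃ z : Fin d → ℤ, ENNReal.ofReal m < potMeasure V (cube k z) := by
  obtain ⟨k, hk⟩ := exists_potNorm_le_cube (d := d) hp hdp (ε := 1 / 2) (by norm_num)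
  set K : ℝ := 2 ^ (k * d) with hK
  have hK0 : 0 < K := by positivity
  -- Chosen so that 2(KA)² = c: if all cubes had mass at most A², the form would be bounded below by
  -- -c‖u‖².
  set A := Real.sqrt (c / (2 * K ^ 2)) with hA
  have hA2 : A ^ 2 = c / (2 * K ^ 2) := Real.sq_sqrt (by positivity)
  have hA0 : 0 < A := Real.sqrt_pos.2 (by positivity)
  refine ⟨k, A ^ 2, by positivity, fun V hV j hj hlt => ?_⟩
  by_contra! hz
  refine hlt.not_ge (le_level_of_forall hj fun u => ?_)
  obtain ⟨-, h2⟩ := hk V hV A hA0.le hz u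
  have hu := norm_nonneg u
  have hg := norm_nonneg (grad u)
  have hP := potNorm_nonneg V (u : L2 d)
  rw [energy_eq_sub_sq hV.measurable hV.nonneg u]
  have h3 : potNorm V (u : L2 d) ^ 2 ≤ 2 * (K * A * ‖u‖) ^ 2 + 1 / 2 * ‖grad u‖ ^ 2 := by
    calc potNorm V (u : L2 d) ^ 2 ≤ (K * A * ‖u‖ + 1 / 2 * ‖grad u‖) ^ 2 := by gcongr
      _ ≤ _ := by nlinarith [sq_nonneg (K * A * ‖u‖ - 1 / 2 * ‖grad u‖)]
  have h4 : 2 * (K * A * ‖u‖) ^ 2 = c * ‖u‖ ^ 2 := by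
    rw [mul_pow, mul_pow, hA2]; field_simp
  nlinarith [sq_nonneg ‖grad u‖]

/-! ### Depth of levels -/

/-- The absolute value of the `j`-th min-max level. -/
def depth (V : Space d → ℝ) (j : ℕ) : ℝ := -(level V j).toReal

/-- The numerator of the Lieb-Thirring quotient. -/
def rieszSum (γ : ℝ) (N : ℕ) (V : Space d → ℝ) : ℝ := ∑ j ∈ Finset.Icc 1 N, depth V j ^ γ

theorem level_eq_coe_of_mem {V : Space d → ℝ} {j : ℕ} {C : ℝ}
    (h1 : ((-C : ℝ) : EReal) ≤ level V j) (h2 : level V j ≤ 0) :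
    level V j = ((-depth V j : ℝ) : EReal) := by
  rw [depth, neg_neg, EReal.coe_toReal]
  · rintro h; rw [h] at h2; simp at h2
  · rintro h; rw [h] at h1; simp at h1

/-- The levels of normalized potentials are finite, so the `toReal` in `depth` loses nothing. -/
theorem exists_depth_bound (hd : 1 ≤ d) (hp : 1 < p) (hdp : d < 2 * p) :
    ∃ C : ℝ, 0 < C ∧ ∀ V : Space d → ℝ, IsNormalized p V → ∀ j, 1 ≤ j →
      level V j = ((-depth V j : ℝ) : EReal) ∧ 0 ≤ depth V j ∧ depth V j ≤ C := by
  obtain ⟨C, hC, h⟩ := exists_form_bound (d := d) hp hdp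
  refine ⟨C, hC, fun V hV j hj => ?_⟩
  have h1 : ((-C : ℝ) : EReal) ≤ level V j := le_level_of_forall hj fun u => (h V hV u).2.2.1
  have h2 : level V j ≤ 0 := level_nonpos hd hj (.of_forall hV.nonneg)
  have h3 := level_eq_coe_of_mem h1 h2
  refine ⟨h3, ?_, ?_⟩
  · rw [h3] at h2
    have : -depth V j ≤ 0 := by exact_mod_cast h2
    linarith
  · rw [h3] at h1
    have : -C ≤ -depth V j := by exact_mod_cast h1
    linarith

theorem sum_abs_level_eq (hd : 1 ≤ d) (hp : 1 < p) (hdp : d < 2 * p) {γ : ℝ} (hγ : 0 < γ) (N : ℕ)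
    {V : Space d → ℝ} (hV : IsNormalized p V) :
    ∑ j ∈ Finset.Icc 1 N, (level V j).abs ^ γ = ENNReal.ofReal (rieszSum γ N V) := by
  obtain ⟨C, -, h⟩ := exists_depth_bound hd hp hdp
  rw [rieszSum, ENNReal.ofReal_sum_of_nonneg]
  · refine Finset.sum_congr rfl fun j hj => ?_
    obtain ⟨h1, h2, -⟩ := h V hV j (Finset.mem_Icc.1 hj).1
    rw [h1, EReal.abs_def, abs_neg, abs_of_nonneg h2, ENNReal.ofReal_rpow_of_nonneg h2 hγ.le]
  · exact fun j hj => Real.rpow_nonneg (h V hV j (Finset.mem_Icc.1 hj).1).2.1 _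

theorem rieszSum_nonneg (hd : 1 ≤ d) (hp : 1 < p) (hdp : d < 2 * p) (γ : ℝ) (N : ℕ)
    {V : Space d → ℝ} (hV : IsNormalized p V) : 0 ≤ rieszSum γ N V := by
  obtain ⟨C, -, h⟩ := exists_depth_bound hd hp hdp
  exact Finset.sum_nonneg fun j hj =>
    Real.rpow_nonneg (h V hV j (Finset.mem_Icc.1 hj).1).2.1 _

/-! ### Signature of hermitian forms -/

section Signature

variable {X E₁ E₂ E₃ : Type*} [AddCommGroup X] [Module ℂ X]
  [NormedAddCommGroup E₁] [InnerProductSpace ℂ E₁] [NormedAddCommGroup E₂] [InnerProductSpace ℂ E₂]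
  [NormedAddCommGroup E₃] [InnerProductSpace ℂ E₃]

/-- The hermitian form `‖A₁ x‖² + s ‖A₂ x‖² - ‖A₃ x‖²`. -/
def hermForm (s : ℝ) (A₁ : X →ₗ[ℂ] E₁) (A₂ : X →ₗ[ℂ] E₂) (A₃ : X →ₗ[ℂ] E₃) (x : X) : ℝ :=
  ‖A₁ x‖ ^ 2 + s * ‖A₂ x‖ ^ 2 - ‖A₃ x‖ ^ 2

/-- The sesquilinear form associated with `hermForm`. -/
def hermPolar (s : ℝ) (A₁ : X →ₗ[ℂ] E₁) (A₂ : X →ₗ[ℂ] E₂) (A₃ : X →ₗ[ℂ] E₃) (w : X) :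
    X →ₗ[ℂ] ℂ :=
  (innerₛₗ ℂ (A₁ w)).comp A₁ + (s : ℂ) • (innerₛₗ ℂ (A₂ w)).comp A₂ - (innerₛₗ ℂ (A₃ w)).comp A₃

variable (s : ℝ) (A₁ : X →ₗ[ℂ] E₁) (A₂ : X →ₗ[ℂ] E₂) (A₃ : X →ₗ[ℂ] E₃)

theorem hermPolar_apply (w x : X) : hermPolar s A₁ A₂ A₃ w x
    = inner ℂ (A₁ w) (A₁ x) + s * inner ℂ (A₂ w) (A₂ x) - inner ℂ (A₃ w) (A₃ x) := rfl

theorem hermPolar_add (w w' x : X) : hermPolar s A₁ A₂ A₃ (w + w') x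
    = hermPolar s A₁ A₂ A₃ w x + hermPolar s A₁ A₂ A₃ w' x := by
  simp only [hermPolar_apply, map_add, inner_add_left]; ring

theorem hermPolar_smul (c : ℂ) (w x : X) : hermPolar s A₁ A₂ A₃ (c • w) x
    = starRingEnd ℂ c * hermPolar s A₁ A₂ A₃ w x := by
  simp only [hermPolar_apply, map_smul, inner_smul_left]; ring

theorem hermPolar_self (x : X) : hermPolar s A₁ A₂ A₃ x x = (hermForm s A₁ A₂ A₃ x : ℂ) := by
  simp only [hermPolar_apply, hermForm, inner_self_eq_norm_sq_to_K]
  push_cast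
  rfl

theorem hermForm_add_smul (w u : X) (c : ℂ) : hermForm s A₁ A₂ A₃ (w + c • u)
    = hermForm s A₁ A₂ A₃ w + ‖c‖ ^ 2 * hermForm s A₁ A₂ A₃ u
      + 2 * (c * hermPolar s A₁ A₂ A₃ w u).re := by
  simp only [hermForm, hermPolar_apply, map_add, map_smul, norm_add_sq (𝕜 := ℂ), norm_smul,
    inner_smul_right, mul_sub, mul_add, Complex.sub_re, Complex.add_re, RCLike.re_to_complex]
  have : (c * (s * inner ℂ (A₂ w) (A₂ u))).re = s * (c * inner ℂ (A₂ w) (A₂ u)).re := by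
    rw [mul_left_comm, Complex.re_ofReal_mul]
  rw [this]
  ring

/-- Take a maximal negative definite subspace. Its complement for the sesquilinear form is cut out
by as many equations as its dimension. A negative vector in the complement could be added to the
subspace, so the form is nonnegative there. -/
theorem exists_negative_nonneg_submodules [FiniteDimensional ℂ X] :
    ∃ Wm Wp : Submodule ℂ X, (∀ x ∈ Wm, x ≠ 0 → hermForm s A₁ A₂ A₃ x < 0) ∧
      (∀ x ∈ Wp, 0 ≤ hermForm s A₁ A₂ A₃ x) ∧
      Module.finrank ℂ X ≤ Module.finrank ℂ Wm + Module.finrank ℂ Wp := by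
  obtain ⟨Wm, hWm, hmax⟩ := (wellFounded_gt (α := Submodule ℂ X)).has_min
    {W | ∀ x ∈ W, x ≠ 0 → hermForm s A₁ A₂ A₃ x < 0}
    ⟨⊥, fun x hx h0 => absurd ((Submodule.mem_bot ℂ).1 hx) h0⟩
  set k := Module.finrank ℂ Wm
  let e := Module.finBasis ℂ Wm
  let L : X →ₗ[ℂ] (Fin k → ℂ) := LinearMap.pi fun i => hermPolar s A₁ A₂ A₃ (e i : X)
  have horth : ∀ x ∈ LinearMap.ker L, ∀ w ∈ Wm, hermPolar s A₁ A₂ A₃ w x = 0 := by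
    intro x hx w hw
    have hx' : ∀ i, hermPolar s A₁ A₂ A₃ (e i : X) x = 0 := fun i =>
      congrFun (LinearMap.mem_ker.1 hx) i
    have hall : ∀ y : Wm, hermPolar s A₁ A₂ A₃ (y : X) x = 0 := by
      intro y
      have hy : y ∈ Submodule.span ℂ (Set.range e) := e.span_eq ▸ Submodule.mem_top
      induction hy using Submodule.span_induction with
      | mem y hy => obtain ⟨i, rfl⟩ := hy; exact hx' i
      | zero =>
        have := hermPolar_smul s A₁ A₂ A₃ 0 0 x
        simpa using this
      | add a b _ _ ha hb => rw [Submodule.coe_add, hermPolar_add, ha, hb, add_zero]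
      | smul c a _ ha => rw [Submodule.coe_smul, hermPolar_smul, ha, mul_zero]
    exact hall ⟨w, hw⟩
  refine ⟨Wm, LinearMap.ker L, hWm, fun u hu => ?_, ?_⟩
  · by_contra! hneg
    refine hmax (Wm ⊔ Submodule.span ℂ {u}) ?_ ?_
    · intro x hx h0
      obtain ⟨w, hw, y, hy, rfl⟩ := Submodule.mem_sup.1 hx
      obtain ⟨c, rfl⟩ := Submodule.mem_span_singleton.1 hy
      rw [hermForm_add_smul, horth u hu w hw]
      simp only [mul_zero, Complex.zero_re, add_zero]
      by_cases hc : c = 0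
      · have hw0 : w ≠ 0 := by rintro rfl; simp [hc] at h0
        have := hWm w hw hw0
        simpa [hc] using this
      · have h1 : 0 < ‖c‖ ^ 2 := by positivity
        have h2 : ‖c‖ ^ 2 * hermForm s A₁ A₂ A₃ u < 0 := mul_neg_of_pos_of_neg h1 hneg
        by_cases hw0 : w = 0
        · have h3 : hermForm s A₁ A₂ A₃ w = 0 := by simp [hw0, hermForm]
          linarith
        · linarith [hWm w hw hw0]
    -- The enlargement is strict: if u already lay in the subspace it would be orthogonal to itself,
    -- and the form would vanish at u.
    · refine lt_of_le_of_ne le_sup_left fun h => ?_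
      have hu' : u ∈ Wm := by
        rw [h]
        exact Submodule.mem_sup_right (Submodule.mem_span_singleton_self u)
      have h1 := horth u hu u hu'
      rw [hermPolar_self] at h1
      have h2 : hermForm s A₁ A₂ A₃ u = 0 := by exact_mod_cast h1
      linarith
  · have h1 := LinearMap.finrank_range_add_finrank_ker L
    have h2 : Module.finrank ℂ (LinearMap.range L) ≤ k := by
      refine (Submodule.finrank_le _).trans_eq ?_
      simp
    omega

/-- If the sum of two hermitian forms is negative definite, the dimensions of their maximal
negative subspaces add up to at least the full dimension. -/
theorem exists_negative_submodules [FiniteDimensional ℂ X]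
    {F₁ F₂ F₃ : Type*} [NormedAddCommGroup F₁] [InnerProductSpace ℂ F₁] [NormedAddCommGroup F₂]
    [InnerProductSpace ℂ F₂] [NormedAddCommGroup F₃] [InnerProductSpace ℂ F₃]
    (B₁ : X →ₗ[ℂ] F₁) (B₂ : X →ₗ[ℂ] F₂) (B₃ : X →ₗ[ℂ] F₃)
    (h : ∀ x, x ≠ 0 → hermForm s A₁ A₂ A₃ x + hermForm s B₁ B₂ B₃ x < 0) :
    ∃ W₁ W₂ : Submodule ℂ X, (∀ x ∈ W₁, x ≠ 0 → hermForm s A₁ A₂ A₃ x < 0) ∧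
      (∀ x ∈ W₂, x ≠ 0 → hermForm s B₁ B₂ B₃ x < 0) ∧
      Module.finrank ℂ X ≤ Module.finrank ℂ W₁ + Module.finrank ℂ W₂ := by
  obtain ⟨M₁, P₁, hM₁, hP₁, h₁⟩ := exists_negative_nonneg_submodules s A₁ A₂ A₃
  obtain ⟨M₂, P₂, hM₂, hP₂, h₂⟩ := exists_negative_nonneg_submodules s B₁ B₂ B₃
  refine ⟨M₁, M₂, hM₁, hM₂, ?_⟩
  -- On a common nonzero vector both forms would be nonnegative, against the negativity of their
  -- sum. Hence dim P₁ + dim P₂ ≤ dim X, and the two dimension counts combine.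
  have hdisj : Disjoint P₁ P₂ := by
    rw [Submodule.disjoint_def]
    intro x hx1 hx2
    by_contra h0
    linarith [h x h0, hP₁ x hx1, hP₂ x hx2]
  have := Submodule.finrank_add_finrank_le_of_disjoint hdisj
  omega

end Signature

/-! ### Multiplication by smooth functions -/

/-- The gradient of a real function, as a complex vector. -/
def partialVec (f : Space d → ℝ) (x : Space d) : EuclideanSpace ℂ (Fin d) :=
  WithLp.toLp 2 fun i => ((fderiv ℝ f x (EuclideanSpace.single i 1) : ℝ) : ℂ)

/-- Smooth functions bounded by one with bounded partial derivatives. -/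
structure Cutoff (d : ℕ) where
  /-- The underlying function. -/
  toFun : Space d → ℝ
  smooth : ContDiff ℝ ∞ toFun
  abs_le_one : ∀ x, |toFun x| ≤ 1
  /-- A bound on the partial derivatives. -/
  bound : ℝ
  abs_partial_le : ∀ x i, |fderiv ℝ toFun x (EuclideanSpace.single i 1)| ≤ bound

theorem norm_sq_partialVec_le {f : Space d → ℝ} {b : ℝ} {x : Space d}
    (h : ∀ i, |fderiv ℝ f x (EuclideanSpace.single i 1)| ≤ b) : ‖partialVec f x‖ ^ 2 ≤ d * b ^ 2 := by
  rw [EuclideanSpace.norm_sq_eq]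
  calc _ ≤ ∑ i : Fin d, b ^ 2 := by
        refine Finset.sum_le_sum fun i _ => ?_
        rw [partialVec, Complex.norm_real, Real.norm_eq_abs]
        gcongr
        exact h i
    _ = _ := by simp

theorem continuous_partialVec {f : Space d → ℝ} (hf : ContDiff ℝ ∞ f) :
    Continuous (partialVec f) :=
  (PiLp.continuous_toLp 2 _).comp (continuous_pi fun _ =>
    Complex.continuous_ofReal.comp (continuous_partialDeriv hf _))

/-- The product rule, by using φ f as a test function for u. -/
theorem IsWeakGradient.smooth_mul {u : Space d → ℂ} {g : Space d → EuclideanSpace ℂ (Fin d)}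
    (H : IsWeakGradient u g) (hu : MemLp u 2 volume) (hg : MemLp g 2 volume) {f : Space d → ℝ}
    (hf : ContDiff ℝ ∞ f) :
    IsWeakGradient (fun x => (f x : ℂ) • u x)
      (fun x => (f x : ℂ) • g x + u x • partialVec f x) := by
  intro φ hφ hc i
  set e : Space d := EuclideanSpace.single i 1
  have hdφ := hφ.differentiable (by simp)
  have hdf := hf.differentiable (by simp)
  have h := H (fun x => φ x * f x) (hφ.mul hf) hc.mul_right i
  have hder : ∀ x, fderiv ℝ (fun x => φ x * f x) x e
      = φ x * fderiv ℝ f x e + f x * fderiv ℝ φ x e := by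
    intro x
    rw [fderiv_fun_mul (hdφ x) (hdf x)]
    simp
  have c1 : Continuous fun x => φ x * fderiv ℝ f x e := hφ.continuous.mul (continuous_partialDeriv hf e)
  have c2 : Continuous fun x => f x * fderiv ℝ φ x e := hf.continuous.mul (continuous_partialDeriv hφ e)
  have i1 : Integrable (fun x => (φ x * fderiv ℝ f x e) • u x) volume :=
    hu.integrable_testFunction_smul c1 hc.mul_right
  have i2 : Integrable (fun x => (f x * fderiv ℝ φ x e) • u x) volume :=
    hu.integrable_testFunction_smul c2 (hasCompactSupport_partialDeriv hc e).mul_left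
  have i3 : Integrable (fun x => (φ x * f x) • g x i) volume :=
    (memLp_proj hg i).integrable_testFunction_smul (hφ.continuous.mul hf.continuous) hc.mul_right
  change ∫ x, (fderiv ℝ (fun x => φ x * f x) x e) • u x = _ at h
  simp_rw [hder, add_smul] at h
  rw [integral_add i1 i2] at h
  have e1 : ∀ x, (fderiv ℝ φ x e) • ((f x : ℂ) • u x) = (f x * fderiv ℝ φ x e) • u x := by
    intro x
    simp only [Complex.real_smul, smul_eq_mul, Complex.ofReal_mul]; ring
  have e2 : ∀ x, φ x • ((f x : ℂ) • g x + u x • partialVec f x) i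
      = (φ x * f x) • g x i + (φ x * fderiv ℝ f x e) • u x := by
    intro x
    simp only [PiLp.add_apply, PiLp.smul_apply, partialVec, Complex.real_smul, smul_eq_mul,
      Complex.ofReal_mul]
    ring
  change ∫ x, (fderiv ℝ φ x e) • ((f x : ℂ) • u x)
    = -∫ x, φ x • ((f x : ℂ) • g x + u x • partialVec f x) i
  simp_rw [e1, e2]
  rw [integral_add i3 i1]
  linear_combination h

namespace Cutoff

variable (χ : Cutoff d)

theorem memLp_smul {F : Type*} [NormedAddCommGroup F] [NormedSpace ℂ F] {μ : Measure (Space d)}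
    {u : Space d → F} (hu : MemLp u 2 μ) : MemLp (fun x => (χ.toFun x : ℂ) • u x) 2 μ := by
  refine hu.of_le ((Complex.continuous_ofReal.comp χ.smooth.continuous).aestronglyMeasurable.smul
    hu.1) (.of_forall fun x => ?_)
  rw [norm_smul, Complex.norm_real, Real.norm_eq_abs]
  exact mul_le_of_le_one_left (norm_nonneg _) (χ.abs_le_one x)

theorem memLp_smul_partialVec {u : Space d → ℂ} (hu : MemLp u 2 volume) :
    MemLp (fun x => u x • partialVec χ.toFun x) 2 volume := by
  refine hu.of_le_mul (c := Real.sqrt (d * χ.bound ^ 2))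
    (hu.1.smul (continuous_partialVec χ.smooth).aestronglyMeasurable) (.of_forall fun x => ?_)
  rw [norm_smul, mul_comm]
  gcongr
  exact Real.le_sqrt_of_sq_le (norm_sq_partialVec_le (χ.abs_partial_le x))

/-- Multiplication by a cutoff on `L²(ℝ^d)`. -/
def mulL2 : L2 d →ₗ[ℂ] L2 d where
  toFun u := (χ.memLp_smul (Lp.memLp u)).toLp
  map_add' u v := by
    rw [← MemLp.toLp_add, MemLp.toLp_eq_toLp_iff]
    filter_upwards [Lp.coeFn_add u v] with x hx
    rw [hx, Pi.add_apply, Pi.add_apply, smul_add]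
  map_smul' c u := by
    rw [RingHom.id_apply, ← MemLp.toLp_const_smul, MemLp.toLp_eq_toLp_iff]
    filter_upwards [Lp.coeFn_smul c u] with x hx
    rw [hx, Pi.smul_apply, Pi.smul_apply, smul_comm]

theorem coeFn_mulL2 (u : L2 d) : χ.mulL2 u =ᵐ[volume] fun x => (χ.toFun x : ℂ) • u x :=
  (χ.memLp_smul (Lp.memLp u)).coeFn_toLp

theorem memLp_gradient (u : H1 d) :
    MemLp (fun x => (χ.toFun x : ℂ) • grad u x + (u : L2 d) x • partialVec χ.toFun x) 2 volume :=
  (χ.memLp_smul (Lp.memLp (grad u))).add (χ.memLp_smul_partialVec (Lp.memLp (u : L2 d)))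

theorem isWeakGradient_mulL2 (u : H1 d) : IsWeakGradient (χ.mulL2 (u : L2 d))
    (fun x => (χ.toFun x : ℂ) • grad u x + (u : L2 d) x • partialVec χ.toFun x) :=
  ((isWeakGradient_grad u).smooth_mul (Lp.memLp _) (Lp.memLp _) χ.smooth).congr
    (χ.coeFn_mulL2 u).symm .rfl

/-- Multiplication by a cutoff on `H¹(ℝ^d)`. -/
def mulH1 : H1 d →ₗ[ℂ] H1 d :=
  (χ.mulL2.comp (H1 d).subtype).codRestrict (H1 d) fun u =>
    ⟨_, χ.memLp_gradient u, χ.isWeakGradient_mulL2 u⟩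

theorem coeFn_mulH1 (u : H1 d) :
    (χ.mulH1 u : L2 d) =ᵐ[volume] fun x => (χ.toFun x : ℂ) • (u : L2 d) x :=
  χ.coeFn_mulL2 u

theorem coeFn_grad_mulH1 (u : H1 d) : grad (χ.mulH1 u) =ᵐ[volume]
    fun x => (χ.toFun x : ℂ) • grad u x + (u : L2 d) x • partialVec χ.toFun x := by
  rw [grad_eq_toLp (χ.memLp_gradient u) (χ.isWeakGradient_mulL2 u)]
  exact (χ.memLp_gradient u).coeFn_toLp

end Cutoff

/-! ### The localization formula -/

/-- A smooth angle function that vanishes on a ball and equals `π / 2` outside a larger ball. -/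
structure Angle (d : ℕ) (R b : ℝ) where
  /-- The underlying function. -/
  toFun : Space d → ℝ
  smooth : ContDiff ℝ ∞ toFun
  eq_zero : ∀ x, ‖x‖ ≤ R → toFun x = 0
  eq_pi_div_two : ∀ x, 2 * R ≤ ‖x‖ → toFun x = Real.pi / 2
  abs_partial_le : ∀ x i, |fderiv ℝ toFun x (EuclideanSpace.single i 1)| ≤ b

/-- Dilating a fixed bump by R makes the partial derivatives of order 1/R, so any bound b is reached
once R is large. -/
theorem exists_angle (d : ℕ) {b : ℝ} (hb : 0 < b) :
    ∃ R₀ : ℝ, 0 < R₀ ∧ ∀ R, R₀ ≤ R → Nonempty (Angle d R b) := by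
  let B : ContDiffBump (0 : Space d) := ⟨1, 2, by norm_num, by norm_num⟩
  have hB : ContDiff ℝ ∞ B := B.contDiff
  have hcont : Continuous (fderiv ℝ B) := hB.continuous_fderiv (by simp)
  obtain ⟨M, hM⟩ := hcont.bounded_above_of_compact_support (B.hasCompactSupport.fderiv ℝ)
  have hM0 : 0 ≤ M := (norm_nonneg _).trans (hM 0)
  set R₀ := Real.pi / 2 * M / b + 1 with hR₀
  have hR₀0 : 0 < R₀ := by positivity
  refine ⟨R₀, hR₀0, fun R hR => ⟨⟨fun x => Real.pi / 2 * (1 - B (R⁻¹ • x)), ?_, ?_, ?_, ?_⟩⟩⟩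
  · exact contDiff_const.mul (contDiff_const.sub (hB.comp (by fun_prop)))
  · intro x hx
    have : B (R⁻¹ • x) = 1 := by
      refine B.one_of_mem_closedBall ?_
      rw [mem_closedBall_zero_iff, norm_smul, norm_inv, Real.norm_of_nonneg (hR₀0.trans_le hR).le,
        inv_mul_le_iff₀ (hR₀0.trans_le hR)]
      change ‖x‖ ≤ R * 1
      linarith
    simp [this]
  · intro x hx
    have hR0 := hR₀0.trans_le hR
    have : B (R⁻¹ • x) = 0 := by
      refine B.zero_of_le_dist ?_
      rw [dist_zero_right, norm_smul, norm_inv, Real.norm_of_nonneg hR0.le, le_inv_mul_iff₀ hR0]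
      change R * 2 ≤ ‖x‖
      linarith
    simp [this]
  · intro x i
    have hR0 := hR₀0.trans_le hR
    have h1 : HasFDerivAt (fun y : Space d => R⁻¹ • y) (R⁻¹ • ContinuousLinearMap.id ℝ _) x :=
      (hasFDerivAt_id x).const_smul R⁻¹
    have h2 : HasFDerivAt B (fderiv ℝ B (R⁻¹ • x)) (R⁻¹ • x) :=
      ((hB.differentiable (by simp)) _).hasFDerivAt
    have h3 := ((h2.comp x h1).const_sub 1).const_mul (Real.pi / 2)
    have h4 : fderiv ℝ (fun x => Real.pi / 2 * (1 - B (R⁻¹ • x))) x = _ := h3.fderiv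
    rw [h4]
    simp only [smul_apply, neg_apply,
      ContinuousLinearMap.comp_apply, ContinuousLinearMap.id_apply, smul_eq_mul, map_smul]
    rw [abs_mul, abs_neg, abs_mul, abs_of_pos (by positivity), abs_of_pos (inv_pos.2 hR0)]
    have h5 : |fderiv ℝ B (R⁻¹ • x) (EuclideanSpace.single i 1)| ≤ M := by
      refine ((fderiv ℝ B (R⁻¹ • x)).le_opNorm _).trans ?_
      simpa using hM (R⁻¹ • x)
    have h6 : Real.pi / 2 * M ≤ b * R := by
      have : Real.pi / 2 * M / b ≤ R := by linarith
      rwa [div_le_iff₀ hb, mul_comm R] at this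
    calc _ ≤ Real.pi / 2 * (R⁻¹ * M) := by gcongr
      _ = R⁻¹ * (Real.pi / 2 * M) := by ring
      _ ≤ R⁻¹ * (b * R) := by gcongr
      _ = b := by field_simp

namespace Angle

variable {R b : ℝ} (θ : Angle d R b)

theorem fderiv_cos (x v : Space d) : fderiv ℝ (fun x => Real.cos (θ.toFun x)) x v
    = -Real.sin (θ.toFun x) * fderiv ℝ θ.toFun x v := by
  have := (((θ.smooth.differentiable (by simp)) x).hasFDerivAt.cos).fderiv
  rw [this]; rfl

theorem fderiv_sin (x v : Space d) : fderiv ℝ (fun x => Real.sin (θ.toFun x)) x v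
    = Real.cos (θ.toFun x) * fderiv ℝ θ.toFun x v := by
  have := (((θ.smooth.differentiable (by simp)) x).hasFDerivAt.sin).fderiv
  rw [this]; rfl

/-- The inner cutoff. -/
def inner : Cutoff d where
  toFun x := Real.cos (θ.toFun x)
  smooth := θ.smooth.cos
  abs_le_one _ := Real.abs_cos_le_one _
  bound := b
  abs_partial_le x i := by
    rw [fderiv_cos, abs_mul, abs_neg]
    exact (mul_le_of_le_one_left (abs_nonneg _) (Real.abs_sin_le_one _)).trans
      (θ.abs_partial_le x i)

/-- The outer cutoff. -/
def outer : Cutoff d where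
  toFun x := Real.sin (θ.toFun x)
  smooth := θ.smooth.sin
  abs_le_one _ := Real.abs_sin_le_one _
  bound := b
  abs_partial_le x i := by
    rw [fderiv_sin, abs_mul]
    exact (mul_le_of_le_one_left (abs_nonneg _) (Real.abs_cos_le_one _)).trans
      (θ.abs_partial_le x i)

theorem partialVec_inner (x : Space d) :
    partialVec θ.inner.toFun x = -((Real.sin (θ.toFun x) : ℝ) : ℂ) • partialVec θ.toFun x := by
  ext i
  simp [partialVec, inner, fderiv_cos]

theorem partialVec_outer (x : Space d) :
    partialVec θ.outer.toFun x = ((Real.cos (θ.toFun x) : ℝ) : ℂ) • partialVec θ.toFun x := by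
  ext i
  simp [partialVec, outer, fderiv_sin]

theorem _root_.norm_sq_rotation {E : Type*} [NormedAddCommGroup E] [InnerProductSpace ℂ E]
    (t : ℝ) (a b : E) :
    ‖((Real.cos t : ℝ) : ℂ) • a - ((Real.sin t : ℝ) : ℂ) • b‖ ^ 2
      + ‖((Real.sin t : ℝ) : ℂ) • a + ((Real.cos t : ℝ) : ℂ) • b‖ ^ 2 = ‖a‖ ^ 2 + ‖b‖ ^ 2 := by
  rw [norm_sub_sq (𝕜 := ℂ), norm_add_sq (𝕜 := ℂ)]
  simp only [norm_smul, Complex.norm_real, mul_pow, inner_smul_left, inner_smul_right,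
    Complex.conj_ofReal, RCLike.re_to_complex, Complex.re_ofReal_mul, Real.norm_eq_abs, sq_abs]
  linear_combination (‖a‖ ^ 2 + ‖b‖ ^ 2) * Real.sin_sq_add_cos_sq t

/-- The localization formula. Pointwise, the gradients of (cos θ)u and (sin θ)u arise from the pair
(∇u, u∇θ) by a rotation through θ, so the cross terms cancel and only |u|²|∇θ|² remains as error. -/
theorem norm_sq_grad_add_le (u : H1 d) :
    ‖grad (θ.inner.mulH1 u)‖ ^ 2 + ‖grad (θ.outer.mulH1 u)‖ ^ 2
      ≤ ‖grad u‖ ^ 2 + d * b ^ 2 * ‖u‖ ^ 2 := by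
  have hn : ‖u‖ ^ 2 = ∫ x, ‖(u : L2 d) x‖ ^ 2 := Lp.norm_sq_eq_integral (u : L2 d)
  have hi : ∀ {F : Type} [NormedAddCommGroup F] (f : Lp F 2 (volume : Measure (Space d))),
      Integrable (fun x => ‖f x‖ ^ 2) volume := fun f => (Lp.memLp f).integrable_norm_pow two_ne_zero
  rw [hn, Lp.norm_sq_eq_integral, Lp.norm_sq_eq_integral, Lp.norm_sq_eq_integral,
    ← integral_const_mul, ← integral_add (hi _) (hi _),
    ← integral_add (hi _) ((hi (u : L2 d)).const_mul _)]
  refine integral_mono_ae ((hi _).add (hi _)) ((hi _).add ((hi (u : L2 d)).const_mul _)) ?_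
  filter_upwards [θ.inner.coeFn_grad_mulH1 u, θ.outer.coeFn_grad_mulH1 u] with x h1 h2
  simp only [h1, h2, partialVec_inner, partialVec_outer]
  have e1 : (θ.inner.toFun x : ℂ) • grad u x
      + (u : L2 d) x • -((Real.sin (θ.toFun x) : ℝ) : ℂ) • partialVec θ.toFun x
      = ((Real.cos (θ.toFun x) : ℝ) : ℂ) • grad u x
        - ((Real.sin (θ.toFun x) : ℝ) : ℂ) • ((u : L2 d) x • partialVec θ.toFun x) := by
    rw [smul_comm ((u : L2 d) x), neg_smul, ← sub_eq_add_neg]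
    rfl
  have e2 : (θ.outer.toFun x : ℂ) • grad u x
      + (u : L2 d) x • ((Real.cos (θ.toFun x) : ℝ) : ℂ) • partialVec θ.toFun x
      = ((Real.sin (θ.toFun x) : ℝ) : ℂ) • grad u x
        + ((Real.cos (θ.toFun x) : ℝ) : ℂ) • ((u : L2 d) x • partialVec θ.toFun x) := by
    rw [smul_comm ((u : L2 d) x)]
    rfl
  rw [e1, e2, norm_sq_rotation, norm_smul, mul_pow, mul_comm (‖(u : L2 d) x‖ ^ 2)]
  gcongr
  exact norm_sq_partialVec_le (θ.abs_partial_le x)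

/-- Stated for general ν because it is needed both for volume and for V dx. -/
theorem integral_sq_add {ν : Measure (Space d)} (hν : ν ≪ volume) (u : H1 d)
    (hu : MemLp (u : L2 d) 2 ν) :
    ∫ x, ‖(θ.inner.mulH1 u : L2 d) x‖ ^ 2 ∂ν + ∫ x, ‖(θ.outer.mulH1 u : L2 d) x‖ ^ 2 ∂ν
      = ∫ x, ‖(u : L2 d) x‖ ^ 2 ∂ν := by
  have h1 := hν.ae_le (θ.inner.coeFn_mulH1 u)
  have h2 := hν.ae_le (θ.outer.coeFn_mulH1 u)
  have i1 := ((θ.inner.memLp_smul hu).ae_eq (Filter.EventuallyEq.symm h1)).integrable_norm_pow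
    two_ne_zero
  have i2 := ((θ.outer.memLp_smul hu).ae_eq (Filter.EventuallyEq.symm h2)).integrable_norm_pow
    two_ne_zero
  rw [← integral_add i1 i2]
  refine integral_congr_ae ?_
  filter_upwards [h1, h2] with x hx1 hx2
  simp only [hx1, hx2, norm_smul, Complex.norm_real, mul_pow, Real.norm_eq_abs, sq_abs]
  have := Real.sin_sq_add_cos_sq (θ.toFun x)
  simp only [inner, outer]
  linear_combination (‖(u : L2 d) x‖ ^ 2) * this

theorem mulH1_inner_eq_zero (u : H1 d) : ∀ᵐ x, x ∉ Metric.closedBall (0 : Space d) (2 * R) →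
    (θ.inner.mulH1 u : L2 d) x = 0 := by
  filter_upwards [θ.inner.coeFn_mulH1 u] with x hx hxR
  rw [mem_closedBall_zero_iff, not_le] at hxR
  rw [hx]
  simp [inner, θ.eq_pi_div_two x hxR.le]

theorem mulH1_outer_eq_zero (u : H1 d) : ∀ᵐ x, x ∈ Metric.closedBall (0 : Space d) R →
    (θ.outer.mulH1 u : L2 d) x = 0 := by
  filter_upwards [θ.outer.coeFn_mulH1 u] with x hx hxR
  rw [mem_closedBall_zero_iff] at hxR
  rw [hx]
  simp [outer, θ.eq_zero x hxR]

end Angle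

/-! ### Splitting a negative subspace into an inner and an outer one. -/

/-- The part of the potential outside a ball. -/
def outerPart (R : ℝ) (V : Space d → ℝ) : Space d → ℝ :=
  (Metric.closedBall (0 : Space d) R)ᶜ.indicator V

theorem IsNormalized.outerPart {p : ℝ} (hp : 0 < p) {V : Space d → ℝ} (hV : IsNormalized p V)
    (R : ℝ) : IsNormalized p (outerPart R V) where
  measurable := hV.measurable.indicator Metric.isClosed_closedBall.measurableSet.compl
  nonneg x := Set.indicator_nonneg (fun x _ => hV.nonneg x) x
  le_one := by
    refine le_trans (lintegral_mono fun x => ?_) hV.le_one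
    gcongr
    exact Set.indicator_le_self' (fun x _ => hV.nonneg x) x

theorem energy_outerPart {R : ℝ} (V : Space d → ℝ) {u : L2 d}
    (hu : ∀ᵐ x, x ∈ Metric.closedBall (0 : Space d) R → u x = 0) :
    energy (outerPart R V) u = energy V u := by
  rw [energy, energy]
  congr 1
  refine integral_congr_ae (hu.mono fun x hx => ?_)
  by_cases h : x ∈ Metric.closedBall (0 : Space d) R
  · simp [hx h]
  · simp only [outerPart, Set.indicator_of_mem (Set.mem_compl h)]

theorem IsNormalized.memLp_potMeasure {p : ℝ} (hp : 1 < p) (hdp : d < 2 * p) {V : Space d → ℝ}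
    (hV : IsNormalized p V) (u : H1 d) : MemLp (u : L2 d) 2 (potMeasure V) := by
  obtain ⟨C, -, h⟩ := exists_form_bound (d := d) hp hdp
  exact ⟨(Lp.stronglyMeasurable (u : L2 d)).aestronglyMeasurable, (h V hV u).1.lt_top⟩

theorem potMeasure_ac (V : Space d → ℝ) : potMeasure V ≪ volume :=
  withDensity_absolutelyContinuous _ _

/-- The embedding of `H¹(ℝ^d)` into `L²(V dx)`. -/
def potMap {V : Space d → ℝ} (hV : ∀ u : H1 d, MemLp (u : L2 d) 2 (potMeasure V)) :
    H1 d →ₗ[ℂ] Lp ℂ 2 (potMeasure V) where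
  toFun u := (hV u).toLp
  map_add' u v := by
    rw [← MemLp.toLp_add, MemLp.toLp_eq_toLp_iff]
    exact (potMeasure_ac V).ae_le (Lp.coeFn_add _ _)
  map_smul' c u := by
    rw [RingHom.id_apply, ← MemLp.toLp_const_smul, MemLp.toLp_eq_toLp_iff]
    exact (potMeasure_ac V).ae_le (Lp.coeFn_smul _ _)

theorem norm_potMap {V : Space d → ℝ} (hV : ∀ u : H1 d, MemLp (u : L2 d) 2 (potMeasure V))
    (u : H1 d) : ‖potMap hV u‖ = potNorm V (u : L2 d) :=
  Lp.norm_toLp _ (hV u)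

theorem _root_.Submodule.finrank_map_of_forall {X Y : Type*} [AddCommGroup X] [Module ℂ X]
    [AddCommGroup Y] [Module ℂ Y] (f : X →ₗ[ℂ] Y) (M : Submodule ℂ X)
    (h : ∀ x ∈ M, f x = 0 → x = 0) : Module.finrank ℂ (M.map f) = Module.finrank ℂ M := by
  rw [← LinearMap.range_domRestrict]
  refine LinearMap.finrank_range_of_inj (LinearMap.ker_eq_bot.1 (LinearMap.ker_eq_bot'.2 ?_))
  intro x hx
  exact Subtype.ext (h x x.2 hx)

/-- The localization formula splits a negative subspace into an inner and an outer one. -/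
theorem exists_split {p : ℝ} (hp : 1 < p) (hdp : d < 2 * p) {V : Space d → ℝ}
    (hV : IsNormalized p V) {R b : ℝ} (θ : Angle d R b) {s : ℝ} {j : ℕ} (hj : 1 ≤ j)
    (h : level V j < ((-(s + d * b ^ 2) : ℝ) : EReal)) :
    ∃ W₁ W₂ : Submodule ℂ (H1 d), j ≤ Module.finrank ℂ W₁ + Module.finrank ℂ W₂ ∧
      (∀ v ∈ W₁, ∀ᵐ x, x ∉ Metric.closedBall (0 : Space d) (2 * R) → (v : L2 d) x = 0) ∧
      (∀ v ∈ W₁, v ≠ 0 → energy V (v : L2 d) < -s * ‖v‖ ^ 2) ∧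
      (∀ v ∈ W₂, v ≠ 0 → energy (outerPart R V) (v : L2 d) < -s * ‖v‖ ^ 2) := by
  obtain ⟨W, hWj, hW⟩ := exists_submodule_of_level_lt h
  -- `finrank` is 0 in infinite dimension, so j ≥ 1 forces finite dimension.
  have hfin : FiniteDimensional ℂ W := Module.finite_of_finrank_pos (by omega)
  have hM := hV.memLp_potMeasure hp hdp
  have hform : ∀ (χ : Cutoff d) (x : W),
      hermForm s (grad.comp (χ.mulH1.comp W.subtype))
        ((H1 d).subtype.comp (χ.mulH1.comp W.subtype))
        ((potMap hM).comp (χ.mulH1.comp W.subtype)) x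
      = energy V (χ.mulH1 (x : H1 d) : L2 d) + s * ‖χ.mulH1 (x : H1 d)‖ ^ 2 := by
    intro χ x
    rw [energy_eq_sub_sq hV.measurable hV.nonneg, ← norm_potMap hM]
    simp only [hermForm, LinearMap.comp_apply, Submodule.subtype_apply]
    rw [sub_add_eq_add_sub]
    rfl
  -- The shift d b² in the hypothesis on the level pays exactly for the localization error.
  have hsum : ∀ x : W, x ≠ 0 →
      hermForm s (grad.comp (θ.inner.mulH1.comp W.subtype))
        ((H1 d).subtype.comp (θ.inner.mulH1.comp W.subtype))
        ((potMap hM).comp (θ.inner.mulH1.comp W.subtype)) x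
      + hermForm s (grad.comp (θ.outer.mulH1.comp W.subtype))
        ((H1 d).subtype.comp (θ.outer.mulH1.comp W.subtype))
        ((potMap hM).comp (θ.outer.mulH1.comp W.subtype)) x < 0 := by
    intro x hx
    rw [hform, hform]
    have h1 := hW x x.2 (by simpa using hx)
    have h2 := θ.norm_sq_grad_add_le (x : H1 d)
    have h3 := θ.integral_sq_add Measure.AbsolutelyContinuous.rfl (x : H1 d) (Lp.memLp _)
    have h4 := θ.integral_sq_add (potMeasure_ac V) (x : H1 d) (hM _)
    have h5 : ∀ v : H1 d, ∫ x, ‖(v : L2 d) x‖ ^ 2 = ‖v‖ ^ 2 := fun v =>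
      (Lp.norm_sq_eq_integral (v : L2 d)).symm
    have h6 : ∀ v : H1 d, ∫ x, ‖(v : L2 d) x‖ ^ 2 ∂(potMeasure V) = potNorm V (v : L2 d) ^ 2 := by
      intro v
      rw [← norm_potMap hM, Lp.norm_sq_eq_integral]
      exact integral_congr_ae ((hM v).coeFn_toLp.mono fun x hx => by
        simp only [potMap, LinearMap.coe_mk, AddHom.coe_mk, hx])
    rw [h5, h5, h5] at h3
    rw [h6, h6, h6] at h4
    rw [energy_eq_sub_sq hV.measurable hV.nonneg] at h1 ⊢
    rw [energy_eq_sub_sq hV.measurable hV.nonneg]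
    linear_combination h1 + h2 + s * h3 - h4
  obtain ⟨M₁, M₂, hM₁, hM₂, hdim⟩ := exists_negative_submodules s _ _ _ _ _ _ hsum
  -- Multiplication by the cutoff loses no dimension: a vector that it kills has form value 0, which
  -- is not negative.
  have hinj : ∀ (χ : Cutoff d) (M : Submodule ℂ W), (∀ x ∈ M, x ≠ 0 →
      hermForm s (grad.comp (χ.mulH1.comp W.subtype))
        ((H1 d).subtype.comp (χ.mulH1.comp W.subtype))
        ((potMap hM).comp (χ.mulH1.comp W.subtype)) x < 0) →
      Module.finrank ℂ (M.map (χ.mulH1.comp W.subtype)) = Module.finrank ℂ M := by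
    intro χ M hneg
    refine Submodule.finrank_map_of_forall _ _ fun x hx h2 => ?_
    by_contra h0
    have h1 := hneg x hx h0
    simp only [hermForm, LinearMap.comp_apply] at h1 h2
    rw [h2] at h1
    simp at h1
  refine ⟨M₁.map (θ.inner.mulH1.comp W.subtype), M₂.map (θ.outer.mulH1.comp W.subtype), ?_, ?_,
    ?_, ?_⟩
  · rw [hinj _ _ hM₁, hinj _ _ hM₂, ← hWj]
    exact hdim
  · rintro _ ⟨x, -, rfl⟩
    exact θ.mulH1_inner_eq_zero _
  · rintro _ ⟨x, hx, rfl⟩ h0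
    have h1 := hM₁ x hx (by rintro rfl; exact h0 (map_zero _))
    rw [hform] at h1
    simp only [LinearMap.comp_apply, Submodule.subtype_apply]
    linarith
  · rintro _ ⟨x, hx, rfl⟩ h0
    have h1 := hM₂ x hx (by rintro rfl; exact h0 (map_zero _))
    rw [hform] at h1
    simp only [LinearMap.comp_apply, Submodule.subtype_apply]
    rw [energy_outerPart V (θ.mulH1_outer_eq_zero _)]
    linarith

/-! ### Comparison of levels along a weakly convergent sequence -/

/-- A single subspace of dimension k bounds each of the first k levels, through its smaller
subspaces. -/
theorem level_le_of_le_finrank {V : Space d → ℝ} {i : ℕ} (hi : 1 ≤ i) {s : ℝ}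
    (W : Submodule ℂ (H1 d)) (hiW : i ≤ Module.finrank ℂ W)
    (h : ∀ u ∈ W, energy V (u : L2 d) ≤ s * ‖u‖ ^ 2) : level V i ≤ s := by
  have hfin : FiniteDimensional ℂ W := Module.finite_of_finrank_pos (by omega)
  let b := Module.finBasis ℂ W
  let f : Fin i → H1 d := fun k => b (Fin.castLE hiW k)
  have hli : LinearIndependent ℂ f :=
    (b.linearIndependent.map' W.subtype W.ker_subtype).comp _ (Fin.castLE_injective hiW)
  refine level_le_of_submodule (Submodule.span ℂ (Set.range f)) ?_ fun u hu => h u ?_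
  · rw [finrank_span_eq_card hli, Fintype.card_fin]
  · refine (Submodule.span_le.2 ?_ : _ ≤ W) hu
    rintro _ ⟨k, rfl⟩
    exact (b (Fin.castLE hiW k)).2

/-- Negative energy controls ‖∇u‖ by ‖u‖, so the compactness error, which involves the H¹ norm,
becomes a multiple of ‖u‖². -/
theorem eventually_energy_le {p : ℝ} (hp : 1 < p) (hdp : d < 2 * p) {ι : Type*} {l : Filter ι}
    {V : ι → Space d → ℝ} (hV : ∀ n, IsNormalized p (V n)) {V₀ : Space d → ℝ}
    (hV₀ : IsNormalized p V₀)
    (hlim : ∀ k z, ∀ η : ℝ≥0∞, η ≠ 0 →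
      ∀ᶠ n in l, potMeasure (V n) (cube k z) ≤ potMeasure V₀ (cube k z) + η)
    (ρ : ℝ) {ε : ℝ} (hε : 0 < ε) :
    ∀ᶠ n in l, ∀ u : H1 d,
      (∀ᵐ x, x ∉ Metric.closedBall (0 : Space d) ρ → (u : L2 d) x = 0) →
      energy (V n) (u : L2 d) < 0 → energy V₀ (u : L2 d) ≤ energy (V n) (u : L2 d) + ε * ‖u‖ ^ 2 := by
  obtain ⟨C, hC, hform⟩ := exists_form_bound (d := d) hp hdp
  -- With y = (1 + C)‖u‖ and the norm for V₀ at most C y, expanding (norm + δ y)² gives an error of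
  -- at most δ(2C + 1)y² = δK‖u‖² when δ ≤ 1.
  set K := (1 + C) ^ 2 * (2 * C + 1) with hK
  have hK0 : 0 < K := by positivity
  set δ := min 1 (ε / K) with hδ
  have hδ0 : 0 < δ := lt_min one_pos (by positivity)
  have hδ1 : δ ≤ 1 := min_le_left _ _
  have hδK : δ * K ≤ ε := (le_div_iff₀ hK0).1 (min_le_right _ _)
  filter_upwards [eventually_eLpNorm_le (theta_lt_one hp hdp) (fun n => (hV n).isSubcritical hp)
    (hV₀.isSubcritical hp) hlim ρ (ε := ENNReal.ofReal δ) (by simpa using hδ0)] with n hn u hu hneg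
  obtain ⟨-, -, -, h1⟩ := hform _ (hV n) u
  obtain ⟨h2, h3, -, -⟩ := hform _ hV₀ u
  have h4 : potNorm (V n) (u : L2 d) ≤ potNorm V₀ (u : L2 d) + δ * (‖u‖ + ‖grad u‖) := by
    refine ENNReal.toReal_le_of_le_ofReal
      (add_nonneg (potNorm_nonneg _ _) (by positivity)) ((hn u hu).trans_eq ?_)
    rw [ENNReal.ofReal_add (potNorm_nonneg _ _) (by positivity), potNorm, ENNReal.ofReal_toReal h2,
      ENNReal.ofReal_mul hδ0.le, ENNReal.ofReal_add (norm_nonneg _) (norm_nonneg _), ofReal_norm,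
      ofReal_norm]
  have h5 := h1 hneg
  have hu0 := norm_nonneg u
  have h6 : potNorm V₀ (u : L2 d) ≤ C * ((1 + C) * ‖u‖) := h3.trans (by gcongr; linarith)
  have h7 : potNorm (V n) (u : L2 d) ≤ potNorm V₀ (u : L2 d) + δ * ((1 + C) * ‖u‖) :=
    h4.trans (by gcongr; linarith)
  have hP := potNorm_nonneg V₀ (u : L2 d)
  set y := (1 + C) * ‖u‖ with hy
  have hy0 : 0 ≤ y := by positivity
  have h8 : potNorm (V n) (u : L2 d) ^ 2 ≤ potNorm V₀ (u : L2 d) ^ 2 + ε * ‖u‖ ^ 2 := by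
    calc potNorm (V n) (u : L2 d) ^ 2 ≤ (potNorm V₀ (u : L2 d) + δ * y) ^ 2 := by
          have := potNorm_nonneg (V n) (u : L2 d)
          gcongr
      _ = potNorm V₀ (u : L2 d) ^ 2 + (2 * potNorm V₀ (u : L2 d) + δ * y) * (δ * y) := by ring
      _ ≤ potNorm V₀ (u : L2 d) ^ 2 + (2 * (C * y) + 1 * y) * (δ * y) := by gcongr
      _ = potNorm V₀ (u : L2 d) ^ 2 + δ * K * ‖u‖ ^ 2 := by rw [hy, hK]; ring
      _ ≤ _ := by gcongr
  rw [energy_eq_sub_sq hV₀.measurable hV₀.nonneg, energy_eq_sub_sq (hV n).measurable (hV n).nonneg]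
  linarith

theorem le_depth_of_level_le {V : Space d → ℝ} {i : ℕ} {s : ℝ}
    (h1 : level V i = ((-depth V i : ℝ) : EReal)) (h2 : level V i ≤ ((-s : ℝ) : EReal)) :
    s ≤ depth V i := by
  rw [h1] at h2
  have : -depth V i ≤ -s := by exact_mod_cast h2
  linarith

/-- The levels of `V n` are, up to `η`, among those of the weak limit and of the outer part. -/
theorem eventually_depth_le (hd : 1 ≤ d) {p : ℝ} (hp : 1 < p) (hdp : d < 2 * p) {ι : Type*}
    {l : Filter ι} {V : ι → Space d → ℝ} (hV : ∀ n, IsNormalized p (V n)) {V₀ : Space d → ℝ}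
    (hV₀ : IsNormalized p V₀)
    (hlim : ∀ k z, ∀ η : ℝ≥0∞, η ≠ 0 →
      ∀ᶠ n in l, potMeasure (V n) (cube k z) ≤ potMeasure V₀ (cube k z) + η)
    {η : ℝ} (hη : 0 < η) :
    ∃ R₀ : ℝ, ∀ R ≥ R₀, ∀ᶠ n in l, ∀ j, 1 ≤ j → ∃ k₁ k₂ : ℕ, j ≤ k₁ + k₂ ∧
      (∀ i ∈ Finset.Icc 1 k₁, depth (V n) j ≤ depth V₀ i + η) ∧
      (∀ i ∈ Finset.Icc 1 k₂, depth (V n) j ≤ depth (outerPart R (V n)) i + η) := by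
  have hp0 : 0 < p := by linarith
  have hd0 : (0 : ℝ) < d := by exact_mod_cast hd
  obtain ⟨C, -, hdepth⟩ := exists_depth_bound hd hp hdp
  -- The budget η: the threshold drops by η/2, of which localization uses η/4 and the rest makes the
  -- inequality strict; the change of potential uses the other η/2.
  set b := Real.sqrt (η / (4 * d)) with hb
  have hb0 : 0 < b := Real.sqrt_pos.2 (by positivity)
  have hb2 : d * b ^ 2 = η / 4 := by rw [hb, Real.sq_sqrt (by positivity)]; field_simp
  obtain ⟨R₀, -, hR₀⟩ := exists_angle d hb0
  refine ⟨R₀, fun R hR => ?_⟩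
  obtain ⟨θ⟩ := hR₀ R hR
  filter_upwards [eventually_energy_le hp hdp hV hV₀ hlim (2 * R) (half_pos hη)] with n hn j hj
  obtain ⟨hl, -, -⟩ := hdepth _ (hV n) j hj
  -- A depth below η/2 is dominated trivially, since all depths are nonnegative. Otherwise the
  -- threshold is nonnegative, so inner vectors have negative energy, as the comparison of forms
  -- requires.
  rcases lt_or_ge (depth (V n) j - η / 2) 0 with hs | hs
  · refine ⟨j, 0, by simp, fun i hi => ?_, by simp⟩
    have := (hdepth _ hV₀ i (Finset.mem_Icc.1 hi).1).2.1
    linarith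
  · obtain ⟨W₁, W₂, hdim, hsupp, hW₁, hW₂⟩ := exists_split hp hdp (hV n) θ hj
      (s := depth (V n) j - η / 2) (by
        rw [hl, hb2]
        have : -depth (V n) j < -(depth (V n) j - η / 2 + η / 4) := by linarith
        exact_mod_cast this)
    refine ⟨_, _, hdim, fun i hi => ?_, fun i hi => ?_⟩
    · obtain ⟨hi1, hi2⟩ := Finset.mem_Icc.1 hi
      rw [← sub_le_iff_le_add]
      refine le_depth_of_level_le (hdepth _ hV₀ i hi1).1
        (level_le_of_le_finrank hi1 W₁ hi2 fun u hu => ?_)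
      rcases eq_or_ne u 0 with rfl | hu0
      · have h0 := energy_smul V₀ 0 (0 : H1 d)
        simp only [smul_zero, norm_zero] at h0 ⊢
        rw [h0]; simp
      · have h1 := hW₁ u hu hu0
        have h2 : 0 ≤ (depth (V n) j - η / 2) * ‖u‖ ^ 2 := by positivity
        have h3 := hn u (hsupp u hu) (by linarith)
        linarith
    · obtain ⟨hi1, hi2⟩ := Finset.mem_Icc.1 hi
      rw [← sub_le_iff_le_add]
      refine le_depth_of_level_le (hdepth _ ((hV n).outerPart hp0 R) i hi1).1
        (level_le_of_le_finrank hi1 W₂ hi2 fun u hu => ?_)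
      rcases eq_or_ne u 0 with rfl | hu0
      · have h0 := energy_smul (outerPart R (V n)) 0 (0 : H1 d)
        simp only [smul_zero, norm_zero] at h0 ⊢
        rw [h0]; simp
      · have h1 := hW₂ u hu hu0
        have h2 : 0 ≤ η / 2 * ‖u‖ ^ 2 := by positivity
        linarith

/-- If each `a j` is dominated by `j` terms of the two families together, the sum of the `a j` is
dominated by the sum over both families. -/
theorem sum_le_sum_add_sum_of_forall {a b c : ℕ → ℝ} {N : ℕ} (hb : ∀ i ∈ Finset.Icc 1 N, 0 ≤ b i)
    (hc : ∀ i ∈ Finset.Icc 1 N, 0 ≤ c i)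
    (h : ∀ j ∈ Finset.Icc 1 N, ∃ k₁ k₂ : ℕ, j ≤ k₁ + k₂ ∧ (∀ i ∈ Finset.Icc 1 k₁, a j ≤ b i) ∧
      ∀ i ∈ Finset.Icc 1 k₂, a j ≤ c i) :
    ∑ j ∈ Finset.Icc 1 N, a j ≤ ∑ i ∈ Finset.Icc 1 N, b i + ∑ i ∈ Finset.Icc 1 N, c i := by
  -- Truncating at N keeps j ≤ k₁ + k₂ because j ≤ N.
  have h' : ∀ j : Finset.Icc 1 N, ∃ k₁ k₂ : ℕ, (k₁ ≤ N ∧ k₂ ≤ N ∧ (j : ℕ) ≤ k₁ + k₂) ∧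
      (∀ i ∈ Finset.Icc 1 k₁, a j ≤ b i) ∧ ∀ i ∈ Finset.Icc 1 k₂, a j ≤ c i := by
    rintro ⟨j, hj⟩
    obtain ⟨k₁, k₂, hk, h1, h2⟩ := h j hj
    have hjN := (Finset.mem_Icc.1 hj).2
    refine ⟨min k₁ N, min k₂ N, ⟨min_le_right _ _, min_le_right _ _, by simp only; omega⟩,
      fun i hi => h1 i ?_, fun i hi => h2 i ?_⟩
    all_goals
      simp only [Finset.mem_Icc] at hi ⊢
      omega
  choose k₁ k₂ hk h1 h2 using h'
  let t : Finset.Icc 1 N → Finset (ℕ ⊕ ℕ) := fun j =>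
    (Finset.Icc 1 (k₁ j)).disjSum (Finset.Icc 1 (k₂ j))
  -- Hall's condition: a set of indices with maximum m has at most m elements, and m alone has k₁ +
  -- k₂ ≥ m candidates. The matching sends distinct j to distinct dominating terms.
  obtain ⟨f, hf, hft⟩ := (Finset.all_card_le_biUnion_card_iff_exists_injective t).1 (by
    intro s
    rcases s.eq_empty_or_nonempty with rfl | hs
    · simp
    · obtain ⟨m, hm, hmax⟩ := s.exists_max_image id hs
      have e1 : s.card ≤ (m : ℕ) := by
        rw [← Finset.card_map (Function.Embedding.subtype _)]
        refine (Finset.card_le_card (t := Finset.Icc 1 (m : ℕ)) ?_).trans_eq (by simp)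
        intro x hx
        obtain ⟨y, hy, rfl⟩ := Finset.mem_map.1 hx
        exact Finset.mem_Icc.2 ⟨(Finset.mem_Icc.1 y.2).1, hmax y hy⟩
      have e2 : (t m).card = k₁ m + k₂ m := by simp [t, Finset.card_disjSum]
      calc s.card ≤ (t m).card := by rw [e2]; exact e1.trans (hk m).2.2
        _ ≤ _ := Finset.card_le_card (Finset.subset_biUnion_of_mem t hm))
  have e : ∑ i ∈ Finset.Icc 1 N, b i + ∑ i ∈ Finset.Icc 1 N, c i
      = ∑ x ∈ (Finset.Icc 1 N).disjSum (Finset.Icc 1 N), Sum.elim b c x := by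
    simp [Finset.sum_disjSum]
  rw [← Finset.sum_coe_sort, e]
  calc ∑ j : Finset.Icc 1 N, a j ≤ ∑ j : Finset.Icc 1 N, Sum.elim b c (f j) := by
        refine Finset.sum_le_sum fun j _ => ?_
        have := hft j
        rcases hfj : f j with i | i
        · rw [hfj] at this
          exact h1 j i (Finset.inl_mem_disjSum.1 this)
        · rw [hfj] at this
          exact h2 j i (Finset.inr_mem_disjSum.1 this)
    _ = ∑ x ∈ Finset.univ.map ⟨f, hf⟩, Sum.elim b c x := by rw [Finset.sum_map]; rfl
    _ ≤ _ := by
        refine Finset.sum_le_sum_of_subset_of_nonneg ?_ ?_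
        · intro x hx
          obtain ⟨j, -, rfl⟩ := Finset.mem_map.1 hx
          refine Finset.disjSum_mono ?_ ?_ (hft j)
          · exact Finset.Icc_subset_Icc_right (hk j).1
          · exact Finset.Icc_subset_Icc_right (hk j).2.1
        · rintro (i | i) hi -
          · exact hb i (Finset.inl_mem_disjSum.1 hi)
          · exact hc i (Finset.inr_mem_disjSum.1 hi)

/-- Uniform continuity on a compact interval treats γ < 1 and γ ≥ 1 alike. -/
theorem exists_add_rpow_le {γ : ℝ} (hγ : 0 < γ) (C : ℝ) {ε : ℝ} (hε : 0 < ε) :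
    ∃ η > 0, ∀ x, 0 ≤ x → x ≤ C → (x + η) ^ γ ≤ x ^ γ + ε := by
  have h := (isCompact_Icc (a := (0 : ℝ)) (b := C + 1)).uniformContinuousOn_of_continuous
    (Real.continuous_rpow_const hγ.le).continuousOn
  obtain ⟨δ, hδ, h⟩ := Metric.uniformContinuousOn_iff_le.1 h ε hε
  refine ⟨min δ 1, lt_min hδ one_pos, fun x hx hxC => ?_⟩
  have h0 : 0 < min δ 1 := lt_min hδ one_pos
  have h1 := h (x + min δ 1) ⟨by linarith, by linarith [min_le_right δ 1]⟩ x
    ⟨hx, by linarith⟩ (by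
      rw [Real.dist_eq, add_sub_cancel_left, abs_of_pos h0]
      exact min_le_left _ _)
  have := (le_abs_self _).trans h1
  linarith

/-- Binding: the Riesz sum of `V n` is at most that of the weak limit plus that of the outer
part. -/
theorem eventually_rieszSum_le (hd : 1 ≤ d) {p : ℝ} (hp : 1 < p) (hdp : d < 2 * p) {γ : ℝ}
    (hγ : 0 < γ) (N : ℕ) {ι : Type*} {l : Filter ι} {V : ι → Space d → ℝ}
    (hV : ∀ n, IsNormalized p (V n)) {V₀ : Space d → ℝ} (hV₀ : IsNormalized p V₀)
    (hlim : ∀ k z, ∀ η : ℝ≥0∞, η ≠ 0 →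
      ∀ᶠ n in l, potMeasure (V n) (cube k z) ≤ potMeasure V₀ (cube k z) + η)
    {ε : ℝ} (hε : 0 < ε) :
    ∃ R₀ : ℝ, ∀ R ≥ R₀, ∀ᶠ n in l,
      rieszSum γ N (V n) ≤ rieszSum γ N V₀ + rieszSum γ N (outerPart R (V n)) + ε := by
  have hp0 : 0 < p := by linarith
  obtain ⟨C, -, hdepth⟩ := exists_depth_bound hd hp hdp
  obtain ⟨η, hη, hpow⟩ := exists_add_rpow_le hγ C (ε := ε / (2 * N + 1)) (by positivity)
  obtain ⟨R₀, hR₀⟩ := eventually_depth_le hd hp hdp hV hV₀ hlim hη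
  refine ⟨R₀, fun R hR => ?_⟩
  filter_upwards [hR₀ R hR] with n hn
  have hout := (hV n).outerPart hp0 R
  have hle : ∀ W : Space d → ℝ, IsNormalized p W →
      ∑ i ∈ Finset.Icc 1 N, (depth W i + η) ^ γ ≤ rieszSum γ N W + N * (ε / (2 * N + 1)) := by
    intro W hW
    calc _ ≤ ∑ i ∈ Finset.Icc 1 N, (depth W i ^ γ + ε / (2 * N + 1)) :=
          Finset.sum_le_sum fun i hi => by
            obtain ⟨-, h1, h2⟩ := hdepth W hW i (Finset.mem_Icc.1 hi).1
            exact hpow _ h1 h2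
      _ = _ := by rw [Finset.sum_add_distrib]; simp [rieszSum]
  have hnonneg : ∀ W : Space d → ℝ, IsNormalized p W → ∀ i ∈ Finset.Icc 1 N,
      0 ≤ (depth W i + η) ^ γ := fun W hW i hi =>
    Real.rpow_nonneg (by linarith [(hdepth W hW i (Finset.mem_Icc.1 hi).1).2.1]) _
  have h1 := sum_le_sum_add_sum_of_forall (N := N) (a := fun j => depth (V n) j ^ γ)
    (hnonneg V₀ hV₀) (hnonneg _ hout) (fun j hj => by
      have hj1 := (Finset.mem_Icc.1 hj).1
      obtain ⟨k₁, k₂, hk, ha, hb⟩ := hn j hj1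
      have h0 := (hdepth _ (hV n) j hj1).2.1
      exact ⟨k₁, k₂, hk, fun i hi => Real.rpow_le_rpow h0 (ha i hi) hγ.le,
        fun i hi => Real.rpow_le_rpow h0 (hb i hi) hγ.le⟩)
  have h2 := hle V₀ hV₀
  have h3 := hle _ hout
  have h4 : 2 * (N * (ε / (2 * N + 1))) ≤ ε := by
    rw [show 2 * (N * (ε / (2 * N + 1))) = (2 * N) * ε / (2 * N + 1) by ring,
      div_le_iff₀ (by positivity)]
    nlinarith
  calc rieszSum γ N (V n) ≤ _ := h1
    _ ≤ _ := by linarith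

section

open Filter Topology

/-! ### Reduction to normalized potentials -/

theorem lintegral_rpow_eq_zero_iff {p : ℝ} (hp : 0 < p) {V : Space d → ℝ} (hV : Measurable V)
    (hV0 : ∀ x, 0 ≤ V x) : ∫⁻ x, ENNReal.ofReal (V x) ^ p = 0 ↔ V =ᵐ[volume] 0 := by
  rw [lintegral_eq_zero_iff (hV.ennreal_ofReal.pow_const p)]
  refine Filter.eventually_congr (.of_forall fun x => ?_)
  simp only [Pi.zero_apply, ENNReal.rpow_eq_zero_iff_of_pos hp, ENNReal.ofReal_eq_zero]
  exact ⟨fun h => le_antisymm h (hV0 x), fun h => h.le⟩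

theorem lintegral_rpow_ne_top {p : ℝ} (hp : 0 < p) {V : Space d → ℝ}
    (hV : MemLp V (ENNReal.ofReal p) volume) : ∫⁻ x, ENNReal.ofReal (V x) ^ p ≠ ⊤ := by
  have h := lintegral_rpow_enorm_lt_top_of_eLpNorm_lt_top (by simpa using hp)
    ENNReal.ofReal_ne_top hV.2
  rw [ENNReal.toReal_ofReal hp.le] at h
  refine ne_top_of_le_ne_top h.ne (lintegral_mono fun x => ?_)
  gcongr
  rw [← ofReal_norm]
  exact ENNReal.ofReal_le_ofReal (Real.le_norm_self _)

theorem quotient_congr {γ : ℝ} {N : ℕ} {V V' : Space d → ℝ} (h : V =ᵐ[volume] V') :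
    quotient d γ N V = quotient d γ N V' := by
  rw [quotient, quotient]
  congr 1
  · exact Finset.sum_congr rfl fun j _ => by rw [level_congr h]
  · exact lintegral_congr_ae (h.mono fun x hx => by simp only [hx])

theorem IsNormalized.isAdmissible {γ : ℝ} (hp : 0 < γ + d / 2) {V : Space d → ℝ}
    (hV : IsNormalized (γ + d / 2) V) (h0 : ¬ V =ᵐ[volume] 0) : IsAdmissible d γ V where
  memLp := by
    refine ⟨hV.measurable.aestronglyMeasurable, ?_⟩
    rw [eLpNorm_lt_top_iff_lintegral_rpow_enorm_lt_top (by simpa using hp) ENNReal.ofReal_ne_top,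
      ENNReal.toReal_ofReal hp.le]
    refine (lintegral_mono fun x => ?_).trans_lt (hV.le_one.trans_lt ENNReal.one_lt_top)
    rw [← ofReal_norm, Real.norm_of_nonneg (hV.nonneg x)]
  nonneg := .of_forall hV.nonneg
  nontrivial := h0

theorem quotient_eq_div (hd : 1 ≤ d) {γ : ℝ} (hγ : 0 < γ) (hp : 1 < γ + d / 2) (N : ℕ)
    {V : Space d → ℝ} (hV : IsNormalized (γ + d / 2) V) :
    quotient d γ N V
      = ENNReal.ofReal (rieszSum γ N V) / ∫⁻ x, ENNReal.ofReal (V x) ^ (γ + d / 2) := by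
  rw [quotient, sum_abs_level_eq hd hp (by linarith) hγ N hV]

theorem exists_measurable_representative {γ : ℝ} {V : Space d → ℝ} (hV : IsAdmissible d γ V) :
    ∃ V' : Space d → ℝ, Measurable V' ∧ (∀ x, 0 ≤ V' x) ∧ V =ᵐ[volume] V' := by
  have hm := hV.memLp.1.aemeasurable
  refine ⟨fun x => max (hm.mk V x) 0, hm.measurable_mk.max measurable_const,
    fun x => le_max_right _ _, ?_⟩
  filter_upwards [hm.ae_eq_mk, hV.nonneg] with x h1 h2
  rw [← h1]
  exact (max_eq_left h2).symm

theorem exists_normalized (hd : 1 ≤ d) {γ : ℝ} (hγ : 0 < γ) (hp : 1 < γ + d / 2) (N : ℕ)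
    {V : Space d → ℝ} (hV : IsAdmissible d γ V) :
    ∃ V' : Space d → ℝ, IsNormalized (γ + d / 2) V' ∧
      ∫⁻ x, ENNReal.ofReal (V' x) ^ (γ + d / 2) = 1 ∧
      quotient d γ N V ≤ ENNReal.ofReal (rieszSum γ N V') := by
  have hp0 : 0 < γ + d / 2 := by linarith
  obtain ⟨W, hWm, hW0, hVW⟩ := exists_measurable_representative hV
  set A := ∫⁻ x, ENNReal.ofReal (W x) ^ (γ + d / 2) with hA
  have hA0 : A ≠ 0 := fun h => hV.nontrivial
    (hVW.trans ((lintegral_rpow_eq_zero_iff hp0 hWm hW0).1 h))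
  have hAt : A ≠ ⊤ := lintegral_rpow_ne_top hp0 ((memLp_congr_ae hVW).1 hV.memLp)
  have hAr : 0 < A.toReal := ENNReal.toReal_pos hA0 hAt
  -- The solution of t^(2γ) A = 1.
  set t := A.toReal ^ (-(2 * γ)⁻¹) with ht
  have ht0 : 0 < t := Real.rpow_pos_of_pos hAr _
  have h1 : ∫⁻ x, ENNReal.ofReal (rescale t 0 W x) ^ (γ + d / 2) = 1 := by
    rw [lintegral_rescale hγ W ht0, ← hA, ENNReal.ofReal_rpow_of_pos ht0, ht,
      ← Real.rpow_mul hAr.le, neg_mul, inv_mul_cancel₀ (by positivity), Real.rpow_neg_one,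
      ENNReal.ofReal_inv_of_pos hAr, ENNReal.ofReal_toReal hAt, ENNReal.inv_mul_cancel hA0 hAt]
  have hN : IsNormalized (γ + d / 2) (rescale t 0 W) :=
    ⟨(hWm.comp (measurableEmbedding_affine ht0 0).measurable).const_mul _,
      fun x => mul_nonneg (by positivity) (hW0 _), h1.le⟩
  refine ⟨_, hN, h1, ?_⟩
  rw [quotient_congr hVW]
  refine (quotient_le_quotient_rescale hd hγ N (.of_forall hW0) ht0 0).trans_eq ?_
  rw [quotient_eq_div hd hγ hp N hN, h1, div_one]

theorem constant_lt_top (hd : 1 ≤ d) {γ : ℝ} (hγ : 0 < γ) (hp : 1 < γ + d / 2) (N : ℕ) :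
    constant d γ N < ⊤ := by
  obtain ⟨C, hC, h⟩ := exists_depth_bound hd hp (by linarith)
  refine lt_of_le_of_lt (b := ENNReal.ofReal (N * C ^ γ)) ?_ ENNReal.ofReal_lt_top
  refine iSup₂_le fun V hV => ?_
  obtain ⟨V', hV', -, hle⟩ := exists_normalized hd hγ hp N hV
  refine hle.trans (ENNReal.ofReal_le_ofReal ?_)
  calc rieszSum γ N V' ≤ ∑ j ∈ Finset.Icc 1 N, C ^ γ := Finset.sum_le_sum fun j hj => by
        obtain ⟨-, h1, h2⟩ := h V' hV' j (Finset.mem_Icc.1 hj).1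
        exact Real.rpow_le_rpow h1 h2 hγ.le
    _ = _ := by simp

/-- The Lieb-Thirring inequality for normalized potentials. -/
theorem rieszSum_le (hd : 1 ≤ d) {γ : ℝ} (hγ : 0 < γ) (hp : 1 < γ + d / 2) (N : ℕ)
    {V : Space d → ℝ} (hV : IsNormalized (γ + d / 2) V) :
    ENNReal.ofReal (rieszSum γ N V)
      ≤ constant d γ N * ∫⁻ x, ENNReal.ofReal (V x) ^ (γ + d / 2) := by
  have hp0 : 0 < γ + d / 2 := by linarith
  -- The supremum excludes V = 0, but the outer part of a potential may vanish; its levels are then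
  -- 0.
  by_cases h0 : V =ᵐ[volume] 0
  · have hz : ∀ j ∈ Finset.Icc 1 N, depth V j ^ γ = 0 := by
      intro j hj
      have hj1 := (Finset.mem_Icc.1 hj).1
      have h1 : ((0 : ℝ) : EReal) ≤ level (0 : Space d → ℝ) j := by
        refine le_level_of_forall hj1 fun u => ?_
        rw [energy_eq]
        simp only [Pi.zero_apply, zero_mul, integral_zero, sub_zero]
        positivity
      have h2 : level V j = 0 := by
        rw [level_congr h0]
        exact le_antisymm (level_zero_nonpos hd hj1) (by simpa using h1)
      rw [depth, h2, EReal.toReal_zero, neg_zero, Real.zero_rpow hγ.ne']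
    rw [rieszSum, Finset.sum_eq_zero hz, ENNReal.ofReal_zero]
    exact zero_le
  · have h1 : ∫⁻ x, ENNReal.ofReal (V x) ^ (γ + d / 2) ≠ 0 := fun h =>
      h0 ((lintegral_rpow_eq_zero_iff hp0 hV.measurable hV.nonneg).1 h)
    have h2 : ∫⁻ x, ENNReal.ofReal (V x) ^ (γ + d / 2) ≠ ⊤ :=
      ne_top_of_le_ne_top ENNReal.one_ne_top hV.le_one
    rw [← ENNReal.div_le_iff h1 h2, ← quotient_eq_div hd hγ hp N hV]
    exact le_iSup₂_of_le V (hV.isAdmissible hp0 h0) le_rfl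

/-- A potential whose Riesz sum is not small can be translated so that a fixed cube carries
substantial mass. -/
theorem exists_translate (hd : 1 ≤ d) {γ : ℝ} (hγ : 0 < γ) (hp : 1 < γ + d / 2) (N : ℕ) {c : ℝ}
    (hc : 0 < c) :
    ∃ (k : ℕ) (m : ℝ), 0 < m ∧ ∀ V : Space d → ℝ, IsNormalized (γ + d / 2) V →
      ∫⁻ x, ENNReal.ofReal (V x) ^ (γ + d / 2) = 1 → c ≤ rieszSum γ N V →
      ∃ V' : Space d → ℝ, IsNormalized (γ + d / 2) V' ∧
        ∫⁻ x, ENNReal.ofReal (V' x) ^ (γ + d / 2) = 1 ∧ rieszSum γ N V ≤ rieszSum γ N V' ∧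
        ENNReal.ofReal m ≤ potMeasure V' (cube k 0) := by
  obtain ⟨C, -, hdepth⟩ := exists_depth_bound hd hp (by linarith)
  -- N s^γ < c, so some depth among the first N exceeds s.
  set s := (c / (N + 1)) ^ γ⁻¹ with hs
  have hs0 : 0 < s := Real.rpow_pos_of_pos (by positivity) _
  have hsγ : s ^ γ = c / (N + 1) := Real.rpow_inv_rpow (by positivity) hγ.ne'
  obtain ⟨k, m, hm, hcube⟩ := exists_cube_of_level_lt (d := d) hp (by linarith) hs0
  refine ⟨k, m, hm, fun V hV h1 hcV => ?_⟩
  obtain ⟨j, hj, hlt⟩ : ∃ j ∈ Finset.Icc 1 N, s < depth V j := by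
    by_contra! hle
    have : rieszSum γ N V ≤ N * (c / (N + 1)) := by
      calc rieszSum γ N V ≤ ∑ j ∈ Finset.Icc 1 N, s ^ γ := Finset.sum_le_sum fun j hj =>
            Real.rpow_le_rpow (hdepth V hV j (Finset.mem_Icc.1 hj).1).2.1 (hle j hj) hγ.le
        _ = _ := by simp [hsγ]
    have h2 : N * (c / (N + 1)) < c := by
      rw [← mul_div_assoc, div_lt_iff₀ (by positivity)]
      nlinarith
    linarith
  have hj1 := (Finset.mem_Icc.1 hj).1
  obtain ⟨z, hz⟩ := hcube V hV j hj1 (by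
    rw [(hdepth V hV j hj1).1]
    have : -depth V j < -s := by linarith
    exact_mod_cast this)
  -- The lower corner of the heavy cube, which the translation moves to the origin.
  set a : Space d := WithLp.toLp 2 fun i => (z i : ℝ) / 2 ^ k with ha
  have h2 : ∫⁻ x, ENNReal.ofReal (rescale 1 a V x) ^ (γ + d / 2) = 1 := by
    rw [lintegral_rescale hγ V one_pos, h1]
    simp
  have hN : IsNormalized (γ + d / 2) (rescale 1 a V) :=
    ⟨(hV.measurable.comp (measurableEmbedding_affine one_pos a).measurable).const_mul _,
      fun x => mul_nonneg (by positivity) (hV.nonneg _), h2.le⟩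
  refine ⟨_, hN, h2, ?_, hz.le.trans_eq ?_⟩
  · have h3 := quotient_le_quotient_rescale hd hγ N (.of_forall hV.nonneg) one_pos a
    rw [quotient_eq_div hd hγ hp N hV, quotient_eq_div hd hγ hp N hN, h1, h2, div_one, div_one]
      at h3
    exact (ENNReal.ofReal_le_ofReal_iff (rieszSum_nonneg hd hp (by linarith) γ N hN)).1 h3
  · rw [potMeasure, potMeasure, withDensity_apply _ (measurableSet_cube k z),
      withDensity_apply _ (measurableSet_cube k 0), ← lintegral_indicator (measurableSet_cube k z),
      ← lintegral_indicator (measurableSet_cube k 0)]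
    have h3 := lintegral_comp_affine one_pos a
      ((cube k z).indicator fun x => ENNReal.ofReal (V x))
    rw [one_pow, inv_one, ENNReal.ofReal_one, one_mul] at h3
    rw [← h3]
    refine lintegral_congr fun x => ?_
    have h4 : affine 1 a x ∈ cube k z ↔ x ∈ cube k 0 := by
      rw [mem_cube, mem_cube, cell_eq_iff, cell_eq_iff]
      refine forall_congr' fun i => ?_
      simp only [affine, ha, one_smul, PiLp.add_apply, Set.mem_Ico, Pi.zero_apply, Int.cast_zero,
        zero_div, zero_add, add_div]
      constructor <;> rintro ⟨h5, h6⟩ <;> constructor <;> linarith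
    by_cases hx : x ∈ cube k 0
    · simp [h4, hx, rescale]
    · simp [h4, hx]

/-! ### Existence of an optimizer -/

/-- A maximizing sequence of normalized potentials that does not vanish. -/
theorem exists_maximizing_sequence (hd : 1 ≤ d) {γ : ℝ} (hγ : 0 < γ) (hp : 1 < γ + d / 2) (N : ℕ)
    (h0 : constant d γ N ≠ 0) :
    ∃ (k : ℕ) (m : ℝ) (V : ℕ → Space d → ℝ), 0 < m ∧ (∀ n, IsNormalized (γ + d / 2) (V n)) ∧
      (∀ n, ∫⁻ x, ENNReal.ofReal (V n x) ^ (γ + d / 2) = 1) ∧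
      (∀ n, ENNReal.ofReal m ≤ potMeasure (V n) (cube k 0)) ∧
      ∀ ε > 0, ∀ᶠ n in atTop, (constant d γ N).toReal - ε ≤ rieszSum γ N (V n) := by
  have htop := (constant_lt_top hd hγ hp N).ne
  set L := (constant d γ N).toReal with hL
  have hL0 : 0 < L := ENNReal.toReal_pos h0 htop
  obtain ⟨k, m, hm, htrans⟩ := exists_translate hd hγ hp N (half_pos hL0)
  have hex : ∀ n : ℕ, ∃ V : Space d → ℝ, IsNormalized (γ + d / 2) V ∧
      ∫⁻ x, ENNReal.ofReal (V x) ^ (γ + d / 2) = 1 ∧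
      ENNReal.ofReal m ≤ potMeasure V (cube k 0) ∧ L - L / (n + 2) ≤ rieszSum γ N V := by
    intro n
    -- The shift by 2 keeps every Riesz sum at least L/2, the threshold for the translation lemma.
    have hlt : ENNReal.ofReal (L - L / (n + 2)) < constant d γ N := by
      rw [← ENNReal.ofReal_toReal htop, ← hL]
      have : 0 < L / (n + 2) := by positivity
      exact (ENNReal.ofReal_lt_ofReal_iff hL0).2 (by linarith)
    simp only [constant, lt_iSup_iff] at hlt
    obtain ⟨W, hW, hlt⟩ := hlt
    obtain ⟨W', hW', h1, hle⟩ := exists_normalized hd hγ hp N hW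
    have h2 : L - L / (n + 2) ≤ rieszSum γ N W' :=
      (ENNReal.ofReal_le_ofReal_iff (rieszSum_nonneg hd hp (by linarith) γ N hW')).1
        (hlt.le.trans hle)
    have h3 : L / (n + 2) ≤ L / 2 := by
      gcongr
      linarith [(Nat.cast_nonneg n : (0 : ℝ) ≤ n)]
    obtain ⟨V, hV, h4, h5, h6⟩ := htrans W' hW' h1 (by linarith)
    exact ⟨V, hV, h4, h6, h2.trans h5⟩
  choose V hV h1 h2 h3 using hex
  refine ⟨k, m, V, hm, hV, h1, h2, fun ε hε => ?_⟩
  have hlim : Tendsto (fun n : ℕ => L / ((n : ℝ) + 2)) atTop (𝓝 0) :=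
    tendsto_const_nhds.div_atTop (tendsto_natCast_atTop_atTop.atTop_add tendsto_const_nhds)
  filter_upwards [hlim.eventually_le_const hε] with n hn
  linarith [h3 n]

/-- Weak limits of normalized potentials, as normalized potentials. -/
theorem exists_normalized_weak_limit {p : ℝ} (hp : 1 < p) (U : Ultrafilter ℕ)
    {V : ℕ → Space d → ℝ} (hV : ∀ n, IsNormalized p (V n)) :
    ∃ V₀ : Space d → ℝ, IsNormalized p V₀ ∧
      (∀ k z, Tendsto (fun n => potMeasure (V n) (cube k z)) U (𝓝 (potMeasure V₀ (cube k z)))) ∧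
      ∀ B, MeasurableSet B → ∀ c, (∀ᶠ n in U, ∫⁻ x in B, ENNReal.ofReal (V n x) ^ p ≤ c) →
        ∫⁻ x in B, ENNReal.ofReal (V₀ x) ^ p ≤ c := by
  have hp0 : 0 < p := by linarith
  obtain ⟨W, hWm, hcube, hball⟩ := exists_weak_limit U hp
    (W := fun n x => ENNReal.ofReal (V n x)) (fun n => (hV n).measurable.ennreal_ofReal)
    (fun n => (hV n).le_one)
  have hW1 : ∫⁻ x, W x ^ p ≤ 1 := by
    simpa using hball Set.univ .univ 1 (.of_forall fun n => by simpa using (hV n).le_one)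
  -- The weak limit takes values in `ℝ≥0∞`; it is finite almost everywhere because its p-th power is
  -- integrable.
  have hWfin : ∀ᵐ x, ENNReal.ofReal (W x).toReal = W x := by
    filter_upwards [ae_lt_top (hWm.pow_const p)
      (hW1.trans_lt ENNReal.one_lt_top).ne] with x hx
    refine ENNReal.ofReal_toReal fun h => ?_
    rw [h, ENNReal.top_rpow_of_pos hp0] at hx
    exact lt_irrefl _ hx
  have e : ∀ B, ∫⁻ x in B, ENNReal.ofReal (W x).toReal ^ p = ∫⁻ x in B, W x ^ p := fun B =>
    lintegral_congr_ae (ae_restrict_of_ae (hWfin.mono fun x hx => by simp only [hx]))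
  refine ⟨fun x => (W x).toReal, ⟨hWm.ennreal_toReal, fun x => ENNReal.toReal_nonneg, ?_⟩,
    fun k z => ?_, fun B hB c hc => ?_⟩
  · have := e Set.univ
    rw [Measure.restrict_univ] at this
    rwa [this]
  · have h := hcube k z
    simp only [potMeasure, withDensity_apply _ (measurableSet_cube k z)]
    convert h using 2
    exact lintegral_congr_ae (ae_restrict_of_ae (hWfin.mono fun x hx => hx))
  · rw [e]
    exact hball B hB c hc

theorem lintegral_le_of_forall_closedBall {f : Space d → ℝ≥0∞} {c : ℝ≥0∞} {R₀ : ℝ}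
    (h : ∀ R ≥ R₀, ∫⁻ x in Metric.closedBall 0 R, f x ≤ c) : ∫⁻ x, f x ≤ c := by
  have hmono : Monotone fun n : ℕ => Metric.closedBall (0 : Space d) n := fun m n hmn =>
    Metric.closedBall_subset_closedBall (by exact_mod_cast hmn)
  have hunion : ⋃ n : ℕ, Metric.closedBall (0 : Space d) n = Set.univ :=
    Metric.iUnion_closedBall_nat 0
  rw [← setLIntegral_univ, ← hunion, setLIntegral_iUnion_of_directed _ hmono.directed_le]
  refine iSup_le fun n => ?_
  refine (lintegral_mono_set ?_).trans (h (max n R₀) (le_max_right _ _))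
  exact Metric.closedBall_subset_closedBall (le_max_left _ _)

theorem lintegral_outerPart {p : ℝ} (hp : 0 < p) (R : ℝ) (V : Space d → ℝ) :
    ∫⁻ x, ENNReal.ofReal (outerPart R V x) ^ p
      = ∫⁻ x in (Metric.closedBall (0 : Space d) R)ᶜ, ENNReal.ofReal (V x) ^ p := by
  rw [← lintegral_indicator Metric.isClosed_closedBall.measurableSet.compl]
  refine lintegral_congr fun x => ?_
  by_cases hx : x ∈ (Metric.closedBall (0 : Space d) R)ᶜ
  · simp only [outerPart, Set.indicator_of_mem hx]
  · simp only [outerPart, Set.indicator_of_notMem hx, ENNReal.ofReal_zero,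
      ENNReal.zero_rpow_of_pos hp]

/-- The weak limit of a maximizing sequence realizes the constant. -/
theorem constant_mul_le (hd : 1 ≤ d) {γ : ℝ} (hγ : 0 < γ) (hp : 1 < γ + d / 2) (N : ℕ)
    (h0 : constant d γ N ≠ 0) {l : Filter ℕ} {V : ℕ → Space d → ℝ}
    (hV : ∀ n, IsNormalized (γ + d / 2) (V n))
    (h1 : ∀ n, ∫⁻ x, ENNReal.ofReal (V n x) ^ (γ + d / 2) = 1)
    (hmax : ∀ ε > 0, ∀ᶠ n in l, (constant d γ N).toReal - ε ≤ rieszSum γ N (V n))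
    {V₀ : Space d → ℝ} (hV₀ : IsNormalized (γ + d / 2) V₀)
    (hlim : ∀ k z, Tendsto (fun n => potMeasure (V n) (cube k z)) l
      (𝓝 (potMeasure V₀ (cube k z))))
    (hball : ∀ B, MeasurableSet B → ∀ c,
      (∀ᶠ n in l, ∫⁻ x in B, ENNReal.ofReal (V n x) ^ (γ + d / 2) ≤ c) →
        ∫⁻ x in B, ENNReal.ofReal (V₀ x) ^ (γ + d / 2) ≤ c) :
    constant d γ N * ∫⁻ x, ENNReal.ofReal (V₀ x) ^ (γ + d / 2)
      ≤ ENNReal.ofReal (rieszSum γ N V₀) := by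
  have hp0 : 0 < γ + d / 2 := by linarith
  have hdp : (d : ℝ) < 2 * (γ + d / 2) := by linarith
  have htop := (constant_lt_top hd hγ hp N).ne
  set L := constant d γ N with hL
  have hS := rieszSum_nonneg hd hp hdp γ N hV₀
  have hmass : ∀ k z, potMeasure V₀ (cube k z) ≠ ⊤ := fun k z =>
    ne_top_of_le_ne_top (by
      rw [volume_cube]
      exact ENNReal.mul_ne_top (by finiteness) (by finiteness)) ((hV₀.isSubcritical hp).le k z)
  have hlim' : ∀ k z, ∀ η : ℝ≥0∞, η ≠ 0 →
      ∀ᶠ n in l, potMeasure (V n) (cube k z) ≤ potMeasure V₀ (cube k z) + η := fun k z η hη =>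
    (hlim k z).eventually_le_const (ENNReal.lt_add_right (hmass k z) hη)
  have key : ∀ ε : ℝ, 0 < ε → L * ∫⁻ x, ENNReal.ofReal (V₀ x) ^ (γ + d / 2)
      ≤ ENNReal.ofReal (rieszSum γ N V₀) + ENNReal.ofReal (2 * ε) := by
    intro ε hε
    obtain ⟨R₀, hR₀⟩ := eventually_rieszSum_le hd hp hdp hγ N hV hV₀ hlim' hε
    rw [mul_comm, ← ENNReal.le_div_iff_mul_le (.inl h0) (.inl htop)]
    -- Lower semicontinuity on the fixed ball reduces the claim to V_n, and R → ∞ recovers the whole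
    -- space.
    refine lintegral_le_of_forall_closedBall (R₀ := R₀) fun R hR =>
      hball _ Metric.isClosed_closedBall.measurableSet _ ?_
    filter_upwards [hR₀ R hR, hmax ε hε] with n hn1 hn2
    rw [ENNReal.le_div_iff_mul_le (.inl h0) (.inl htop), mul_comm]
    have hout := (hV n).outerPart hp0 R
    have h2 := rieszSum_le hd hγ hp N hout
    rw [lintegral_outerPart hp0, ← hL] at h2
    set I := ∫⁻ x in Metric.closedBall (0 : Space d) R, ENNReal.ofReal (V n x) ^ (γ + d / 2)
    set J := ∫⁻ x in (Metric.closedBall (0 : Space d) R)ᶜ, ENNReal.ofReal (V n x) ^ (γ + d / 2)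
    have hIJ : I + J = 1 := by
      rw [← h1 n]
      exact lintegral_add_compl _ Metric.isClosed_closedBall.measurableSet
    have hJ : J ≠ ⊤ := ne_top_of_le_ne_top ENNReal.one_ne_top (hIJ ▸ le_add_self)
    have hLJ : L * J ≠ ⊤ := ENNReal.mul_ne_top htop hJ
    -- Adding L J on both sides turns L I into L, since I + J = 1.
    refine (ENNReal.add_le_add_iff_right hLJ).1 ?_
    rw [← mul_add, hIJ, mul_one]
    have hS' := rieszSum_nonneg hd hp hdp γ N hout
    calc L = ENNReal.ofReal L.toReal := (ENNReal.ofReal_toReal htop).symm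
      _ ≤ ENNReal.ofReal (rieszSum γ N V₀ + 2 * ε + rieszSum γ N (outerPart R (V n))) :=
          ENNReal.ofReal_le_ofReal (by linarith)
      _ = ENNReal.ofReal (rieszSum γ N V₀) + ENNReal.ofReal (2 * ε)
            + ENNReal.ofReal (rieszSum γ N (outerPart R (V n))) := by
          rw [ENNReal.ofReal_add (by positivity) hS', ENNReal.ofReal_add hS (by positivity)]
      _ ≤ _ := by gcongr
  refine ENNReal.le_of_forall_pos_le_add fun ε hε _ => ?_
  have := key (ε / 2) (by positivity)
  rwa [mul_div_cancel₀ _ two_ne_zero, ENNReal.ofReal_coe_nnreal] at this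

theorem exists_isAdmissible {γ : ℝ} : ∃ V : Space d → ℝ, IsAdmissible d γ V := by
  refine ⟨(Metric.closedBall 0 1).indicator fun _ => 1, ?_, ?_, fun h => ?_⟩
  · exact memLp_indicator_const _ Metric.isClosed_closedBall.measurableSet _
      (.inr measure_closedBall_lt_top.ne)
  · exact .of_forall fun x => Set.indicator_nonneg (fun _ _ => zero_le_one) x
  · have h1 : volume (Metric.closedBall (0 : Space d) 1) = 0 :=
      measure_mono_null (fun x hx => by simpa using hx) h
    exact (Metric.measure_closedBall_pos volume (0 : Space d) one_pos).ne' h1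

theorem exists_isOptimizer (hd : 1 ≤ d) {γ : ℝ} (hγ : 0 < γ) (hp : 1 < γ + d / 2) (N : ℕ) :
    ∃ V : Space d → ℝ, IsOptimizer d γ N V := by
  have hp0 : 0 < γ + d / 2 := by linarith
  -- If the constant is 0, every competitor is optimal. Otherwise L > 0 yields a maximizing sequence
  -- that does not vanish.
  by_cases h0 : constant d γ N = 0
  · obtain ⟨V, hV⟩ := exists_isAdmissible (d := d) (γ := γ)
    have hle : quotient d γ N V ≤ constant d γ N := le_iSup₂_of_le V hV le_rfl
    exact ⟨V, hV, le_antisymm hle (h0 ▸ zero_le)⟩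
  obtain ⟨k, m, V, hm, hV, h1, hcube, hmax⟩ := exists_maximizing_sequence hd hγ hp N h0
  obtain ⟨V₀, hV₀, hlim, hball⟩ := exists_normalized_weak_limit hp (hyperfilter ℕ) hV
  have hU : ((hyperfilter ℕ : Ultrafilter ℕ) : Filter ℕ) ≤ atTop := by
    rw [← Nat.cofinite_eq_atTop]
    exact hyperfilter_le_cofinite
  -- The mass of the fixed cube at the origin survives in the limit.
  have hne : ¬ V₀ =ᵐ[volume] 0 := by
    intro h
    have h2 : ENNReal.ofReal m ≤ potMeasure V₀ (cube k 0) :=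
      ge_of_tendsto (hlim k 0) (.of_forall fun n => hcube n)
    have h3 : potMeasure V₀ = 0 := by
      rw [potMeasure, withDensity_congr_ae (g := 0) (h.mono fun x hx => by simp [hx]),
        withDensity_zero]
    rw [h3] at h2
    simp at h2
    linarith
  have hadm := hV₀.isAdmissible hp0 hne
  refine ⟨V₀, hadm, le_antisymm (le_iSup₂_of_le V₀ hadm le_rfl) ?_⟩
  rw [quotient_eq_div hd hγ hp N hV₀, ENNReal.le_div_iff_mul_le
    (.inl fun h => hne ((lintegral_rpow_eq_zero_iff hp0 hV₀.measurable hV₀.nonneg).1 h))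
    (.inl (ne_top_of_le_ne_top ENNReal.one_ne_top hV₀.le_one))]
  exact constant_mul_le hd hγ hp N h0 hV h1 (fun ε hε => hU (hmax ε hε)) hV₀ hlim hball

end

end LiebThirring

end

theorem mainTheorem8 (d : ℕ) (hd : 1 ≤ d) (γ : ℝ) (hγ : 0 < γ) (hγ₁ : d = 1 → 1 / 2 < γ)
    (N : ℕ) (hN : 1 ≤ N) :
    LiebThirring.constant d γ N < ⊤ ∧
      ∃ V : LiebThirring.Space d → ℝ, LiebThirring.IsOptimizer d γ N V := by
  -- The assumption γ > 1/2 in dimension one serves only to give p > 1; for d ≥ 2 this follows from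
  -- γ > 0.
  have hp : 1 < γ + (d : ℝ) / 2 := by
    rcases hd.eq_or_lt with rfl | h
    · have := hγ₁ rfl
      push_cast
      linarith
    · have : (2 : ℝ) ≤ d := by exact_mod_cast h
      linarith
  exact ⟨LiebThirring.constant_lt_top hd hγ hp N, LiebThirring.exists_isOptimizer hd hγ hp N⟩
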